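/- Let $d\ge 1$ and let $J:\mathbb Z^d\to\mathbb R$ satisfy: $J(x)\ge 0$ for $x\ne 0$ and $J(0)=-\sum_{x\neq 0}J(x)$ is finite; $\{x: J(x)>0\}$ generates the group $\mathbb Z^d$; $J$ is invariant under all automorphisms of the nearest-neighbour graph $\mathbb Z^d$ that fix the origin; and $J$ has finite range. Let $P_a$ (with expectation $E_a$) be the law, on the space of càdlàg paths $[0,\infty)\to\mathbb Z^d$ with the $\sigma$-algebra generated by the coordinates, of the continuous-time random walk $X^{(\infty)}$ with generator $\Delta_{x,y}=J(y-x)$ started at $a$. Let $\Lambda\subset\mathbb Z^d$ be finite, $T_\Lambda=\inf\{t\ge 0: X^{(\infty)}_t\notin\Lambda\}$, and let $X_t=X^{(\infty)}_t$ for $t<T_\Lambda$, $X_t=\ast$ (a cemetery state) for $t\ge T_\Lambda$. For a Borel set $I\subset[0,\infty)$ let $\tau_{I}=(\tau_{I,x})_{x\in\Lambda}$ be the vector of local times $\tau_{I,x}=\int_I \mathbf 1_{\{X_\ell=x\}}\,d\ell$. For $Z:[0,\infty)^\Lambda\to(0,\infty)$ put $$S^{(\Lambda)}(a,b)=E_a[\tau_{[0,\infty),b}],\qquad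 G^{(\Lambda)}_{\mathbf 0}(a,b)=\int_{[0,\infty)}E_a\Big[\frac{Z_{\tau_{[0,\ell]}}}{Z_{\mathbf 0}}\mathbf 1_{\{X_\ell=b\}}\Big]d\ell,\qquad \mathcal Y_{s,t}=\frac{Z_{\tau_{[s,t]}}}{Z_{\mathbf 0}}\quad(0\le s\le t).$$ Define the vertex functions $r_s=-\lim_{t\downarrow s}\partial_1\log\mathcal Y_{s,t}$ and $r_{s,t}=-\partial_1\partial_2\log\mathcal Y_{s,t}$ for $s<t$ (a.e. derivatives, extended to the boundary $s=0$ by continuity; that is, right derivatives). For $m\ge 1$ let $\mathcal L_m(0)$ be the set of laces $L=((s_i,s'_{i+1}))_{i=0,\dots,m-1}$ with $$0=s_0=s_0'<s_1<s_1'<s_2<s_2'<\dots<s_{m-1}'<s_m=s_m',$$ with Lebesgue measure $dL$ in the $2m-1$ free coordinates, and let $\mathcal L_0(0)$ consist of the single lace $\{0\}$ (so $s_0=s_0'=0$), with unit mass. The weight is $w(L)=r_0$ for $m=0$, and for $m\ge1$ $$w(L)=\prod_{i=0}^{m-1} r_{s_i,s'_{i+1}}\;\cdot\;\mathcal Y_{s_0',s_1'}\prod_{i=0}^{m-2}\frac{\mathcal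 Y_{s_i',s_{i+2}'}}{\mathcal Y_{s_i',s_{i+1}'}} .$$ Assume: * (Z1) $Z$ is strictly positive and continuous on $[0,\infty)^\Lambda$; * (Z2) $Z$ is $C^2$ on $[0,\infty)^\Lambda$, up to the boundary; * (G0) $\int_{[0,\infty)}E_a[\mathcal Y_{0,\ell}\mathbf 1_{\{X_\ell\neq\ast\}}]\,d\ell<\infty$ for all $a\in\Lambda$ (equivalently, $G^{(\Lambda)}_{\mathbf 0}(a,b)<\infty$ for all $a,b\in\Lambda$); * (F0) $\sum_{m\ge0}\int_{\mathcal L_m(0)}E_a[|w(L)|]\,dL<\infty$ for all $a\in\Lambda$. For $x,y\in\Lambda$ set $$\Pi^{(\Lambda)}(x,y)=\sum_{m\ge0}\int_{\mathcal L_m(0)}E_x\big[w(L)\mathbf 1_{\{X_{s_m'}=y\}}\big]\,dL .$$ Then for all $a,b\in\Lambda$ $$G^{(\Lambda)}_{\mathbf 0}(a,b)=S^{(\Lambda)}(a,b)+\sum_{x,y\in\Lambda}S^{(\Lambda)}(a,x)\,\Pi^{(\Lambda)}(x,y)\,G^{(\Lambda)}_{\mathbf 0}(y,b).$$ -/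

import Mathlib

open MeasureTheory Filter Topology
open scoped NNReal ENNReal

noncomputable section

namespace LaceExpansion

/-! ### Jump kernels on the lattice -/

/-- The nearest-neighbour graph on the vertex set `ℤ^d`. -/
def latticeGraph (d : ℕ) : SimpleGraph (Fin d → ℤ) where
  Adj x y := ∑ i, |x i - y i| = 1
  symm := ⟨fun x y h => by simpa only [abs_sub_comm] using h⟩
  loopless := ⟨fun x h => by simp at h⟩

/-- Invariance of a function on `ℤ^d` under all graph automorphisms that fix the origin. -/
def IsLatticeSymmetric {d : ℕ} (f : (Fin d → ℤ) → ℝ) : Prop :=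
  ∀ T : latticeGraph d ≃g latticeGraph d, T 0 = 0 → ∀ x, f (T x) = f x

/-- The standing assumptions on `J`; the generator of the walk is the infinite matrix
`Δ x y = J (y - x)`. -/
structure IsJumpKernel {d : ℕ} (J : (Fin d → ℤ) → ℝ) : Prop where
  nonneg : ∀ x, x ≠ 0 → 0 ≤ J x
  summable : Summable fun x : {x : Fin d → ℤ // x ≠ 0} => J x
  at_zero : J 0 = - ∑' x : {x : Fin d → ℤ // x ≠ 0}, J x
  generating : AddSubgroup.closure {x | 0 < J x} = ⊤
  symmetric : IsLatticeSymmetric J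
  finite_range : ∃ R : ℝ, 0 < R ∧ ∀ x, R ≤ Real.sqrt (∑ i, (x i : ℝ) ^ 2) → J x = 0

/-- `Ĵ = -J(0)`, the total jump rate. -/
def totalRate {d : ℕ} (J : (Fin d → ℤ) → ℝ) : ℝ := - J 0

/-- `J₊`, the off-diagonal jump rates. -/
def jumpRate {d : ℕ} (J : (Fin d → ℤ) → ℝ) (x : Fin d → ℤ) : ℝ :=
  if x = 0 then 0 else J x

/-- Discrete convolution on `ℤ^d`. -/
def conv {d : ℕ} (f h : (Fin d → ℤ) → ℝ) (x : Fin d → ℤ) : ℝ :=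
  ∑' y, f y * h (x - y)

/-- The `n`-fold convolution power, with the unit mass at the origin for `n = 0`. -/
def convPow {d : ℕ} (f : (Fin d → ℤ) → ℝ) : ℕ → (Fin d → ℤ) → ℝ
  | 0 => fun x => if x = 0 then 1 else 0
  | n + 1 => conv f (convPow f n)

/-! ### The continuous-time random walk, described by its law on path space -/

/-- Càdlàg paths `[0,∞) → ℤ^d`. -/
structure CadlagPath (d : ℕ) where
  toFun : ℝ≥0 → (Fin d → ℤ)
  right_continuous : ∀ t, ContinuousWithinAt toFun (Set.Ici t) t
  left_limits : ∀ t, 0 < t → ∃ y, Tendsto toFun (𝓝[<] t) (𝓝 y)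

/-- The σ-algebra generated by the coordinate maps. -/
instance (d : ℕ) : MeasurableSpace (CadlagPath d) :=
  ⨆ t : ℝ≥0, MeasurableSpace.comap (fun ω : CadlagPath d => ω.toFun t) inferInstance

/-- The transition probability from `z` to `z + x` in time `t` of the walk with generator
`Δ x y = J (y - x)`: it makes a Poisson number, with mean `Ĵ t`, of independent jumps of law
`J₊ / Ĵ`. In other words, this is the entry of `exp (t Δ) = exp (-Ĵ t) exp (t J₊)`. -/
def transitionProb {d : ℕ} (J : (Fin d → ℤ) → ℝ) (t : ℝ) (x : Fin d → ℤ) : ℝ :=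
  Real.exp (-(totalRate J * t)) * ∑' n : ℕ, t ^ n / (n.factorial : ℝ) * convPow (jumpRate J) n x

/-- `P` is the law on path space of the continuous-time random walk with generator
`Δ x y = J (y - x)` started at `a`: the finite-dimensional distributions are those of the Markov
chain with the above transition probabilities. As the coordinates generate the σ-algebra, this
determines `P`. -/
structure IsWalkLaw {d : ℕ} (J : (Fin d → ℤ) → ℝ) (a : Fin d → ℤ)
    (P : Measure (CadlagPath d)) : Prop where
  isProbabilityMeasure : IsProbabilityMeasure P
  finite_dim : ∀ (n : ℕ) (t : Fin (n + 1) → ℝ≥0) (y : Fin (n + 1) → (Fin d → ℤ)),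
    Monotone t → t 0 = 0 → y 0 = a →
      P {ω | ∀ i, ω.toFun (t i) = y i} =
        ENNReal.ofReal (∏ i : Fin n,
          transitionProb J ((t i.succ : ℝ) - (t i.castSucc : ℝ)) (y i.succ - y i.castSucc))

/-! ### The killed walk and its local times -/

section Walk

variable {d : ℕ} (Λ : Finset (Fin d → ℤ))

/-- The first exit time from `Λ`; it is `∞` on paths that never exit. -/
def exitTime (ω : CadlagPath d) : ℝ≥0∞ :=
  ⨅ (t : ℝ≥0) (_ : ω.toFun t ∉ Λ), (t : ℝ≥0∞)

open Classical in
/-- The walk killed on exiting `Λ`; the cemetery state is `none`. -/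
def killed (ω : CadlagPath d) (t : ℝ≥0) : Option (Fin d → ℤ) :=
  if (t : ℝ≥0∞) < exitTime Λ ω then some (ω.toFun t) else none

/-- The local time at `x` of the killed walk during `I ⊆ [0,∞)`, that is, the Lebesgue measure of
the set of those times in `I` at which the killed walk is at `x`. -/
def localTime (ω : CadlagPath d) (I : Set ℝ) (x : Fin d → ℤ) : ℝ≥0∞ :=
  volume {r : ℝ | r ∈ I ∧ killed Λ ω r.toNNReal = some x}

/-- The vector of local times during a bounded set `I`. -/
def localTimes (ω : CadlagPath d) (I : Set ℝ) : Λ → ℝ :=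
  fun x => (localTime Λ ω I x).toReal

/-! ### Green's functions -/

/-- The free Green's function `S(a,b)`, the mean time that the killed walk from `a` spends at `b`
(`P` is the family of laws of the walk, indexed by the starting point). -/
def freeGreen (P : (Fin d → ℤ) → Measure (CadlagPath d)) (a b : Fin d → ℤ) : ℝ :=
  (∫⁻ ω, localTime Λ ω (Set.Ici 0) b ∂(P a)).toReal

open Classical in
/-- The Green's function
`G_t(a,b) = ∫_{[0,∞)} dℓ E_a [ (Z (t + τ_{[0,ℓ]}) / Z t) 1_{X_ℓ = b} ]`. -/
def green (P : (Fin d → ℤ) → Measure (CadlagPath d)) (Z : (Λ → ℝ) → ℝ) (t : Λ → ℝ)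
    (a b : Fin d → ℤ) : ℝ :=
  (∫⁻ l in Set.Ici (0 : ℝ), ∫⁻ ω,
    (if killed Λ ω l.toNNReal = some b then
      ENNReal.ofReal (Z (t + localTimes Λ ω (Set.Icc 0 l)) / Z t) else 0) ∂(P a)).toReal

/-- The random function `Y_{s,t} = Z (τ_{[s,t]}) / Z 0`. -/
def interaction (Z : (Λ → ℝ) → ℝ) (ω : CadlagPath d) (s t : ℝ) : ℝ :=
  Z (localTimes Λ ω (Set.Icc s t)) / Z 0

end Walk

/-! ### Vertex functions, laces and their weights

The derivatives `∂₁`, `∂₂` of a function of `0 ≤ s ≤ t` are taken as right derivatives. They are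
the ordinary derivatives wherever those exist, and at the boundary `s = 0` of the domain, where only
a one-sided derivative makes sense, they are the extension by continuity. -/

/-- `-lim_{t ↓ s} ∂₁ log Y_{s,t}`. -/
def vertexPoint (Y : ℝ → ℝ → ℝ) (s : ℝ) : ℝ :=
  - limUnder (𝓝[>] s) (fun t => derivWithin (fun s' => Real.log (Y s' t)) (Set.Ici s) s)

/-- `-∂₁ ∂₂ log Y_{s,t}`. -/
def vertexPair (Y : ℝ → ℝ → ℝ) (s t : ℝ) : ℝ :=
  - derivWithin (fun s' => derivWithin (fun t' => Real.log (Y s' t')) (Set.Ici t) t) (Set.Ici s) s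

/-- Laces with `m = k + 1` intervals `(s_i, s'_{i+1})`, `i = 0, …, m - 1`, in the `2m` coordinates
`s₀' < s₁ < s₁' < s₂ < s₂' < ⋯ < s_{m-1}' < s_m`, where `s₀ = s₀'` and `s_m' = s_m`. -/
def laceRegion (k : ℕ) : Set (Fin (2 * k + 1 + 1) → ℝ) :=
  {v | 0 ≤ v 0 ∧ StrictMono v}

/-- The laces with `s₀' = s`, in the remaining `2m - 1` coordinates. -/
def laceSlice (k : ℕ) (s : ℝ) : Set (Fin (2 * k + 1) → ℝ) :=
  {u | (Fin.cons s u : Fin (2 * k + 1 + 1) → ℝ) ∈ laceRegion k}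

/-- The left endpoint `s_i`, for `0 ≤ i ≤ m`: coordinate number `2 i - 1`, or `0` if `i = 0`. -/
def leftPt {k : ℕ} (v : Fin (2 * k + 1 + 1) → ℝ) (i : ℕ) : ℝ :=
  v ⟨min (2 * i - 1) (2 * k + 1), by omega⟩

/-- The right endpoint `s_i'`, for `0 ≤ i ≤ m`: coordinate number `2 i`, or the last one, number
`2 m - 1`, if `i = m`. -/
def rightPt {k : ℕ} (v : Fin (2 * k + 1 + 1) → ℝ) (i : ℕ) : ℝ :=
  v ⟨min (2 * i) (2 * k + 1), by omega⟩

/-- The product of the vertex functions over the `m = k + 1` intervals of a lace. -/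
def laceVertex (Y : ℝ → ℝ → ℝ) {k : ℕ} (v : Fin (2 * k + 1 + 1) → ℝ) : ℝ :=
  ∏ i ∈ Finset.range (k + 1), vertexPair Y (leftPt v i) (rightPt v (i + 1))

/-- `P(L) = Y_{s₀',s₁'} ∏_{i=0}^{m-2} Y_{s_i',s_{i+2}'} / Y_{s_i',s_{i+1}'}`, with `m = k + 1`. -/
def laceProd (Y : ℝ → ℝ → ℝ) {k : ℕ} (v : Fin (2 * k + 1 + 1) → ℝ) : ℝ :=
  Y (rightPt v 0) (rightPt v 1) *
    ∏ i ∈ Finset.range k,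
      Y (rightPt v i) (rightPt v (i + 2)) / Y (rightPt v i) (rightPt v (i + 1))

/-- The weight of a lace with `m = k + 1 ≥ 1` intervals. The weight of the lace `{s₀}` with
`m = 0` is `vertexPoint Y s₀`. -/
def laceWeight (Y : ℝ → ℝ → ℝ) {k : ℕ} (v : Fin (2 * k + 1 + 1) → ℝ) : ℝ :=
  laceVertex Y v * laceProd Y v

section Expansion

variable {d : ℕ} (Λ : Finset (Fin d → ℤ)) (P : (Fin d → ℤ) → Measure (CadlagPath d))
  (Z : (Λ → ℝ) → ℝ)

open Classical in
/-- `∫ dL E_x [ w(L) 1_{X_{s_m'} = y} ]` over the laces with `m` intervals and `s₀' = 0`. For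
`m = 0` there is only the lace `{0}`, which carries unit mass. -/
def laceTerm (x y : Fin d → ℤ) : ℕ → ℝ
  | 0 => ∫ ω, (if killed Λ ω 0 = some y then vertexPoint (interaction Λ Z ω) 0 else 0) ∂(P x)
  | k + 1 => ∫ u in laceSlice k 0, ∫ ω,
      (if killed Λ ω (rightPt (Fin.cons 0 u) (k + 1) : ℝ).toNNReal = some y then
        laceWeight (interaction Λ Z ω) (Fin.cons 0 u) else 0) ∂(P x)

/-- `∫ dL E_a [ |w(L)| ]` over the laces with `m` intervals and `s₀' = 0`. -/
def absLaceTerm (a : Fin d → ℤ) : ℕ → ℝ≥0∞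
  | 0 => ∫⁻ ω, ‖vertexPoint (interaction Λ Z ω) 0‖ₑ ∂(P a)
  | k + 1 => ∫⁻ u in laceSlice k 0, ∫⁻ ω,
      ‖laceWeight (interaction Λ Z ω) (Fin.cons 0 u)‖ₑ ∂(P a)

/-- The lace expansion kernel `Π(x,y)`. -/
def laceKernel (x y : Fin d → ℤ) : ℝ := ∑' m : ℕ, laceTerm Λ P Z x y m

open Classical in
/-- The assumptions on `Z` and on the walk in `Λ`. The set `Set.Ici 0` is the orthant `[0,∞)^Λ`. -/
structure Assumptions : Prop where
  /-- `Z` is strictly positive and continuous on the orthant. -/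
  Z1 : (∀ t ∈ Set.Ici (0 : Λ → ℝ), 0 < Z t) ∧ ContinuousOn Z (Set.Ici 0)
  /-- `Z` is twice continuously differentiable on the orthant, up to the boundary. -/
  Z2 : ContDiffOn ℝ 2 Z (Set.Ici 0)
  /-- The Green's function `∑_b G_0(a,b)` is finite. -/
  G0 : ∀ a ∈ Λ, ∫⁻ l in Set.Ici (0 : ℝ), ∫⁻ ω,
    (if killed Λ ω l.toNNReal ≠ none then
      ENNReal.ofReal (interaction Λ Z ω 0 l) else 0) ∂(P a) < ∞
  /-- The lace expansion converges absolutely. -/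
  F0 : ∀ a ∈ Λ, ∑' m : ℕ, absLaceTerm Λ P Z a m < ∞

end Expansion

end LaceExpansion

end

/-!
The proof is a renewal argument along a single path, followed by the Markov property.

Write `Y_{s,l}` for the interaction and `ρ_{s,l}` for the derivative of `log Z` at `τ_{[s,l]}` in
the direction of the site at time `s`, so that `∂_s Y_{s,l} = -ρ_{s,l} Y_{s,l}`. The fundamental theorem
of calculus in the left endpoint gives `Y_{0,l} = 1 + ∫_0^l ρ_{s,l} Y_{s,l} ds`
(`occInter_eq_one_add`). In the right endpoint it gives `ρ_{s,l} = r_s + ∫_s^l r_{s,t} dt`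
(`logD_eq_add`). The first summand is the trivial lace. In the second, the interval `(s,t)` is
covered by a pair vertex, but the interaction `Y_{s,l}` still couples the times before and after
`t`. The identity `occInter_div_eq`,
`Y_{a,l} / Y_{a,b} = Y_{b,l} + ∫_b^l dt ∫_a^b dσ r_{σ,t} (Y_{a,t} / Y_{a,b}) (Y_{b,l} / Y_{b,t})`,
decouples them: either nothing reaches across `b`, and a fresh factor `Y_{b,l}` starts there, or
there is a further interval `(σ,t)` that does, and the same ratio recurs with `(a,b)` replaced by
`(b,t)`. Iterating it (`IsLaceData.remainder_eq`) produces exactly the laces with their weights,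
each followed by a fresh interaction. The right endpoints of the intervals are ordered, so that the
remainder after `n` steps is of order `C ^ n / n!` and tends to `0` (`IsLaceData.tendsto_sum`).
The resulting pathwise identity is `endWeight_add`.

The path enters only through the occupation density `1_{X_r = x}`, which is locally constant from
the right. This is why the right derivatives in the definition of the vertex functions exist at
every time and are derivatives of `log Z` in the direction of the current sites
(`vertexPoint_occInter`, `vertexPair_occInter`).

It remains to integrate over `l` and to take expectations. Signs are dealt with by moving the
negative parts of the weights to the other side, so that Tonelli's theorem is enough throughout.
The Markov property (`markov_killed`), proved from the finite-dimensional distributions by a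
π-system argument for the pair (path frozen at `t`, path shifted by `t`), is used twice: at the time
where the lace starts, which yields the factor `S`, and at the time where it ends, which yields the
factor `G`. The outcome is the Dyson equation in `[0,∞]`, `lintegral_pathGreen_add`. It may be
rewritten with real numbers because all terms are finite: `G` and `Π` by assumption, and `S` because
the walk leaves the finite set `Λ` exponentially fast (`lintegral_prob_alive_lt_top`).
-/

noncomputable section

namespace LaceExpansion

/-! ### Shifted and frozen paths -/

section

variable {d : ℕ}

theorem CadlagPath.eventually_eq (ω : CadlagPath d) (t : ℝ≥0) :
    ∀ᶠ s in 𝓝[≥] t, ω.toFun s = ω.toFun t := by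
  have h := ω.right_continuous t
  have h2 : ({ω.toFun t} : Set (Fin d → ℤ)) ∈ 𝓝 (ω.toFun t) := by
    simp [nhds_discrete]
  exact h h2

/-- The path observed from time `t` on. -/
def shift (t : ℝ≥0) (ω : CadlagPath d) : CadlagPath d where
  toFun r := ω.toFun (t + r)
  right_continuous r := by
    have h := ω.right_continuous (t + r)
    refine h.comp (f := fun r => t + r) (by fun_prop) ?_
    intro s hs
    exact add_le_add le_rfl (Set.mem_Ici.1 hs)
  left_limits r hr := by
    obtain ⟨y, hy⟩ := ω.left_limits (t + r) (lt_of_lt_of_le hr le_add_self)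
    refine ⟨y, hy.comp ?_⟩
    refine tendsto_nhdsWithin_iff.2 ⟨?_, ?_⟩
    · exact ((continuous_const.add continuous_id).tendsto r).mono_left nhdsWithin_le_nhds
    · filter_upwards [self_mem_nhdsWithin] with s hs
      exact add_lt_add_right hs t

/-- The path frozen at time `t`. It encodes the information available up to time `t`. -/
def freeze (t : ℝ≥0) (ω : CadlagPath d) : CadlagPath d where
  toFun r := ω.toFun (min r t)
  right_continuous r := by
    have h := ω.right_continuous (min r t)
    refine h.comp (f := fun r => min r t) (by fun_prop) ?_
    intro s hs
    exact min_le_min_right _ (Set.mem_Ici.1 hs)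
  left_limits r hr := by
    rcases le_or_gt r t with h | h
    · obtain ⟨y, hy⟩ := ω.left_limits r hr
      refine ⟨y, hy.congr' ?_⟩
      filter_upwards [self_mem_nhdsWithin] with s hs
      rw [min_eq_left (le_of_lt (lt_of_lt_of_le hs h))]
    · refine ⟨ω.toFun t, ?_⟩
      refine Tendsto.congr' ?_ tendsto_const_nhds
      have : ∀ᶠ s in 𝓝[<] r, t < s := nhdsWithin_le_nhds (lt_mem_nhds h)
      filter_upwards [this] with s hs
      rw [min_eq_right hs.le]

@[simp] theorem shift_toFun (t r : ℝ≥0) (ω : CadlagPath d) :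
    (shift t ω).toFun r = ω.toFun (t + r) := rfl

@[simp] theorem freeze_toFun (t r : ℝ≥0) (ω : CadlagPath d) :
    (freeze t ω).toFun r = ω.toFun (min r t) := rfl

theorem measurable_coord (t : ℝ≥0) : Measurable fun ω : CadlagPath d => ω.toFun t := by
  refine Measurable.of_comap_le ?_
  exact le_iSup (fun t : ℝ≥0 =>
    MeasurableSpace.comap (fun ω : CadlagPath d => ω.toFun t) inferInstance) t

theorem measurable_path {α : Type*} [MeasurableSpace α] {f : α → CadlagPath d}
    (h : ∀ t, Measurable fun a => (f a).toFun t) : Measurable f := by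
  rw [measurable_iff_comap_le]
  change MeasurableSpace.comap f (⨆ t : ℝ≥0,
    MeasurableSpace.comap (fun ω : CadlagPath d => ω.toFun t) inferInstance) ≤ _
  rw [MeasurableSpace.comap_iSup]
  refine iSup_le fun t => ?_
  rw [MeasurableSpace.comap_comp]
  exact (h t).comap_le

/-- The coordinates are jointly measurable in the path and the time, being limits of the values at
the approximations `(⌊n t⌋ + 1) / n` of `t` from the right. -/
theorem measurable_eval : Measurable fun p : CadlagPath d × ℝ≥0 => p.1.toFun p.2 := by
  let q : ℕ → ℝ≥0 → ℝ≥0 := fun n t => ((⌊((n : ℝ≥0) + 1) * t⌋₊ : ℝ≥0) + 1) / ((n : ℝ≥0) + 1)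
  have hq : ∀ n, Measurable fun p : CadlagPath d × ℝ≥0 => p.1.toFun (q n p.2) := by
    intro n
    have h1 : Measurable fun p : CadlagPath d × ℕ =>
        p.1.toFun (((p.2 : ℝ≥0) + 1) / ((n : ℝ≥0) + 1)) :=
      measurable_from_prod_countable_left fun m =>
        measurable_coord (((m : ℝ≥0) + 1) / ((n : ℝ≥0) + 1))
    have h2 : Measurable fun p : CadlagPath d × ℝ≥0 => (p.1, ⌊((n : ℝ≥0) + 1) * p.2⌋₊) :=
      measurable_fst.prodMk (Nat.measurable_floor.comp (measurable_snd.const_mul _))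
    exact h1.comp h2
  refine measurable_of_tendsto_metrizable hq ?_
  rw [tendsto_pi_nhds]
  intro p
  have hlt : ∀ n, p.2 < q n p.2 := by
    intro n
    have hn : (0 : ℝ≥0) < n + 1 := by positivity
    rw [lt_div_iff₀ hn, mul_comm]
    exact Nat.lt_floor_add_one _
  have hle : ∀ n, q n p.2 ≤ p.2 + 1 / ((n : ℝ≥0) + 1) := by
    intro n
    have hn : (0 : ℝ≥0) < n + 1 := by positivity
    rw [div_le_iff₀ hn, add_mul p.2, one_div, inv_mul_cancel₀ hn.ne', mul_comm p.2]
    gcongr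
    exact Nat.floor_le (by positivity)
  have hlim : Tendsto (fun n => q n p.2) atTop (𝓝[≥] p.2) := by
    refine tendsto_nhdsWithin_iff.2 ⟨?_, Eventually.of_forall fun n => (hlt n).le⟩
    refine tendsto_of_tendsto_of_tendsto_of_le_of_le tendsto_const_nhds ?_ (fun n => (hlt n).le) hle
    have := (tendsto_one_div_add_atTop_nhds_zero_nat (𝕜 := ℝ≥0)).const_add p.2
    simpa using this
  exact (p.1.right_continuous p.2).tendsto.comp hlim

theorem measurable_shift_uncurry :
    Measurable fun p : CadlagPath d × ℝ≥0 => shift p.2 p.1 :=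
  measurable_path fun t => measurable_eval.comp
    (measurable_fst.prodMk (measurable_snd.add_const t))

theorem measurable_shift (t : ℝ≥0) : Measurable (shift t : CadlagPath d → CadlagPath d) :=
  measurable_path fun r => measurable_coord (t + r)

theorem measurable_freeze (t : ℝ≥0) : Measurable (freeze t : CadlagPath d → CadlagPath d) :=
  measurable_path fun r => measurable_coord (min r t)

/-! ### The killed walk -/

variable (Λ : Finset (Fin d → ℤ))

/-- The walk stays in `Λ` during `[0,t]`. -/
def Alive (ω : CadlagPath d) (t : ℝ≥0) : Prop := ∀ s ≤ t, ω.toFun s ∈ Λ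

theorem lt_exitTime_iff (ω : CadlagPath d) (t : ℝ≥0) :
    (t : ℝ≥0∞) < exitTime Λ ω ↔ Alive Λ ω t := by
  constructor
  · intro h s hs
    by_contra hc
    have : exitTime Λ ω ≤ s := iInf₂_le s hc
    exact absurd (h.trans_le this) (by simpa using hs)
  · intro h
    -- By right-continuity the path remains in `Λ` for a short while after `t`.
    have hev := ω.eventually_eq t
    rw [eventually_nhdsWithin_iff, Metric.eventually_nhds_iff] at hev
    obtain ⟨ε, hε, hev⟩ := hev
    have hle : ((t + ⟨ε, hε.le⟩ : ℝ≥0) : ℝ≥0∞) ≤ exitTime Λ ω := by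
      refine le_iInf₂ fun s hs => ?_
      rw [ENNReal.coe_le_coe]
      by_contra hc
      rw [not_le] at hc
      rcases le_or_gt s t with h1 | h1
      · exact hs (h s h1)
      · refine hs ?_
        rw [hev (y := s) ?_ h1.le]
        · exact h t le_rfl
        · have h2 : (s : ℝ) < t + ε := by exact_mod_cast hc
          have h3 : (t : ℝ) < s := by exact_mod_cast h1
          rw [NNReal.dist_eq, abs_lt]
          constructor <;> linarith
    refine lt_of_lt_of_le ?_ hle
    rw [ENNReal.coe_lt_coe]
    exact lt_add_of_pos_right _ hε

theorem killed_eq_some_iff (ω : CadlagPath d) (t : ℝ≥0) (x : Fin d → ℤ) :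
    killed Λ ω t = some x ↔ Alive Λ ω t ∧ ω.toFun t = x := by
  unfold killed
  rw [← lt_exitTime_iff]
  split_ifs with h <;> simp [h]

theorem killed_ne_none_iff (ω : CadlagPath d) (t : ℝ≥0) :
    killed Λ ω t ≠ none ↔ Alive Λ ω t := by
  unfold killed
  rw [← lt_exitTime_iff]
  split_ifs with h <;> simp [h]

variable {Λ} in
theorem Alive.mono {ω : CadlagPath d} {s t : ℝ≥0} (h : Alive Λ ω t) (hst : s ≤ t) :
    Alive Λ ω s := fun r hr => h r (hr.trans hst)

theorem alive_add_iff (ω : CadlagPath d) (s t : ℝ≥0) :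
    Alive Λ ω (s + t) ↔ Alive Λ ω s ∧ Alive Λ (shift s ω) t := by
  constructor
  · intro h
    exact ⟨h.mono le_self_add, fun r hr => h _ (add_le_add le_rfl hr)⟩
  · rintro ⟨h1, h2⟩ r hr
    rcases le_total r s with h | h
    · exact h1 r h
    · have := h2 (r - s) (by rw [tsub_le_iff_left]; exact hr)
      simpa [add_tsub_cancel_of_le h] using this

theorem alive_iff_exists_killed_eq (ω : CadlagPath d) (t : ℝ≥0) :
    Alive Λ ω t ↔ ∃ x ∈ Λ, killed Λ ω t = some x := by
  simp only [killed_eq_some_iff]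
  constructor
  · intro h; exact ⟨_, h t le_rfl, h, rfl⟩
  · rintro ⟨x, _, h, _⟩; exact h

theorem killed_shift {ω : CadlagPath d} {s : ℝ≥0} (h : Alive Λ ω s) (t : ℝ≥0) :
    killed Λ (shift s ω) t = killed Λ ω (s + t) := by
  have h1 : Alive Λ ω (s + t) ↔ Alive Λ (shift s ω) t := by simp [alive_add_iff, h]
  rw [← lt_exitTime_iff, ← lt_exitTime_iff] at h1
  by_cases h2 : (t : ℝ≥0∞) < exitTime Λ (shift s ω)
  · simp only [killed, h2, h1.2 h2, if_true, shift_toFun]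
  · simp only [killed, h2, mt h1.1 h2, if_false]

theorem killed_freeze (ω : CadlagPath d) {s t : ℝ≥0} (h : s ≤ t) :
    killed Λ (freeze t ω) s = killed Λ ω s := by
  have h1 : Alive Λ (freeze t ω) s ↔ Alive Λ ω s := by
    unfold Alive
    refine forall₂_congr fun r hr => ?_
    rw [freeze_toFun, min_eq_left (hr.trans h)]
  rw [← lt_exitTime_iff, ← lt_exitTime_iff] at h1
  by_cases h2 : (s : ℝ≥0∞) < exitTime Λ ω
  · simp only [killed, h2, h1.2 h2, if_true, freeze_toFun, min_eq_left h]
  · simp only [killed, h2, mt h1.1 h2, if_false]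

theorem eventually_killed_eq (ω : CadlagPath d) (t : ℝ≥0) :
    ∀ᶠ s in 𝓝[≥] t, killed Λ ω s = killed Λ ω t := by
  by_cases h : Alive Λ ω t
  · have h1 := (lt_exitTime_iff Λ ω t).2 h
    have h2 : ∀ᶠ s : ℝ≥0 in 𝓝[≥] t, (s : ℝ≥0∞) < exitTime Λ ω :=
      ((ENNReal.continuous_coe.tendsto t).mono_left nhdsWithin_le_nhds).eventually
        (gt_mem_nhds h1)
    filter_upwards [h2, ω.eventually_eq t] with s hs1 hs2
    simp [killed, hs1, h1, hs2]
  · filter_upwards [self_mem_nhdsWithin] with s hs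
    have h2 : ¬ Alive Λ ω s := fun h3 => h (h3.mono hs)
    rw [← lt_exitTime_iff] at h h2
    simp [killed, h, h2]

/-- By right-continuity, survival up to time `t` is decided by the positions at the rational times
before `t` and at `t` itself. -/
theorem measurableSet_alive : MeasurableSet {p : CadlagPath d × ℝ≥0 | Alive Λ p.1 p.2} := by
  have hset : {p : CadlagPath d × ℝ≥0 | Alive Λ p.1 p.2} =
      {p | p.1.toFun p.2 ∈ Λ} ∩
        ⋂ q : ℚ, {p | p.1.toFun (min (Real.toNNReal q) p.2) ∈ Λ} := by
    ext ⟨ω, t⟩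
    simp only [Set.mem_inter_iff, Set.mem_iInter, Set.mem_ofPred_eq]
    constructor
    · intro h
      exact ⟨h t le_rfl, fun q => h _ (min_le_right _ _)⟩
    · rintro ⟨h1, h2⟩ s hs
      rcases hs.eq_or_lt with rfl | hs
      · exact h1
      have hev := ω.eventually_eq s
      have hgt : ∀ᶠ r in 𝓝[>] s, r < t := nhdsWithin_le_nhds (gt_mem_nhds hs)
      have hev' : ∀ᶠ r in 𝓝[>] s, ω.toFun r = ω.toFun s :=
        hev.filter_mono (nhdsWithin_mono _ Set.Ioi_subset_Ici_self)
      obtain ⟨u, hu, hu'⟩ := (mem_nhdsGT_iff_exists_Ioo_subset' hs).1 (hgt.and hev')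
      obtain ⟨q, hq1, hq2⟩ := exists_rat_btwn (show (s : ℝ) < u by exact_mod_cast hu)
      have hq0 : (0 : ℝ) ≤ q := s.coe_nonneg.trans hq1.le
      have hmem : Real.toNNReal q ∈ Set.Ioo s u := by
        constructor
        · rw [← NNReal.coe_lt_coe, Real.coe_toNNReal _ hq0]; exact hq1
        · rw [← NNReal.coe_lt_coe, Real.coe_toNNReal _ hq0]; exact hq2
      obtain ⟨h3, h4⟩ := hu' hmem
      have := h2 q
      rwa [min_eq_left h3.le, h4] at this
  rw [hset]
  have hΛ : MeasurableSet (Λ : Set (Fin d → ℤ)) := Λ.finite_toSet.measurableSet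
  refine (measurable_eval hΛ).inter (MeasurableSet.iInter fun q => ?_)
  have : Measurable fun p : CadlagPath d × ℝ≥0 => p.1.toFun (min (Real.toNNReal q) p.2) :=
    measurable_eval.comp (measurable_fst.prodMk (measurable_const.min measurable_snd))
  exact this hΛ

theorem measurableSet_killed (x : Fin d → ℤ) :
    MeasurableSet {p : CadlagPath d × ℝ≥0 | killed Λ p.1 p.2 = some x} := by
  simp only [killed_eq_some_iff]
  exact (measurableSet_alive Λ).inter (measurable_eval (measurableSet_singleton x))

end

/-! ### The Markov property -/

section

variable {d : ℕ}

theorem conv_nonneg {f h : (Fin d → ℤ) → ℝ} (hf : ∀ x, 0 ≤ f x) (hh : ∀ x, 0 ≤ h x) (x : Fin d → ℤ) :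
    0 ≤ conv f h x := tsum_nonneg fun y => mul_nonneg (hf y) (hh _)

theorem convPow_nonneg {f : (Fin d → ℤ) → ℝ} (hf : ∀ x, 0 ≤ f x) (n : ℕ) :
    ∀ x, 0 ≤ convPow f n x := by
  induction n with
  | zero => intro x; unfold convPow; split_ifs <;> norm_num
  | succ n ih => exact conv_nonneg hf ih

theorem jumpRate_nonneg {J : (Fin d → ℤ) → ℝ} (hJ : IsJumpKernel J) (x : Fin d → ℤ) :
    0 ≤ jumpRate J x := by
  unfold jumpRate
  split_ifs with h
  · exact le_rfl
  · exact hJ.nonneg x h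

theorem transitionProb_nonneg {J : (Fin d → ℤ) → ℝ} (hJ : IsJumpKernel J) {t : ℝ} (ht : 0 ≤ t)
    (x : Fin d → ℤ) : 0 ≤ transitionProb J t x := by
  unfold transitionProb
  have := convPow_nonneg (jumpRate_nonneg hJ)
  exact mul_nonneg (Real.exp_nonneg _)
    (tsum_nonneg fun n => mul_nonneg (by positivity) (this n x))

variable {J : (Fin d → ℤ) → ℝ} {P : (Fin d → ℤ) → Measure (CadlagPath d)}

/-- The finite-dimensional distributions, for times indexed by `ℕ`. -/
theorem IsWalkLaw.apply_seq {a : Fin d → ℤ} {Q : Measure (CadlagPath d)} (hQ : IsWalkLaw J a Q)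
    (n : ℕ) {t : ℕ → ℝ≥0} (ht : Monotone t) (y : ℕ → Fin d → ℤ) (h0 : t 0 = 0) (hy : y 0 = a) :
    Q {ω | ∀ i ≤ n, ω.toFun (t i) = y i} = ENNReal.ofReal (∏ i ∈ Finset.range n,
      transitionProb J ((t (i + 1) : ℝ) - t i) (y (i + 1) - y i)) := by
  have h := hQ.finite_dim n (fun i => t i) (fun i => y i)
    (fun i j hij => ht (Fin.le_def.1 hij)) (by simpa using h0) (by simpa using hy)
  rw [Finset.prod_range]
  refine Eq.trans (congrArg _ ?_) h
  · ext ω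
    simp only [Set.mem_ofPred_eq]
    exact ⟨fun h i => h i (Nat.lt_succ_iff.1 i.2),
      fun h i hi => h ⟨i, Nat.lt_succ_iff.2 hi⟩⟩

theorem IsWalkLaw.ae_start {a : Fin d → ℤ} {Q : Measure (CadlagPath d)} (hQ : IsWalkLaw J a Q) :
    ∀ᵐ ω ∂Q, ω.toFun 0 = a := by
  have := hQ.isProbabilityMeasure
  have h := hQ.apply_seq 0 (t := fun _ => 0) monotone_const (fun _ => a) rfl rfl
  have hm : MeasurableSet {ω : CadlagPath d | ω.toFun 0 = a} :=
    measurable_coord 0 (measurableSet_singleton a)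
  have h1 : Q {ω : CadlagPath d | ω.toFun 0 = a} = 1 := by simpa using h
  exact (mem_ae_iff_prob_eq_one hm).2 h1

/-- An increasing enumeration of a finite set of times that contains `0`. -/
theorem exists_enum (T : Finset ℝ≥0) (h0 : 0 ∈ T) :
    ∃ (n : ℕ) (u : ℕ → ℝ≥0), Monotone u ∧ u 0 = 0 ∧ ∀ r, r ∈ T ↔ ∃ i ≤ n, u i = r := by
  have hc : T.card = (T.card - 1) + 1 :=
    (Nat.succ_pred_eq_of_pos (Finset.card_pos.2 ⟨0, h0⟩)).symm
  set n := T.card - 1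
  have hr : ∀ r, r ∈ T ↔ ∃ i ≤ n, T.orderEmbOfFin hc ⟨min i n, by omega⟩ = r := by
    intro r
    rw [← Finset.mem_coe, ← T.range_orderEmbOfFin hc]
    constructor
    · rintro ⟨i, rfl⟩
      exact ⟨i, by omega, congrArg _ (Fin.ext (by simp; omega))⟩
    · rintro ⟨i, _, rfl⟩
      exact ⟨_, rfl⟩
  have hmono : Monotone fun i : ℕ => T.orderEmbOfFin hc ⟨min i n, by omega⟩ := fun i j hij =>
    (T.orderEmbOfFin hc).monotone (Fin.mk_le_mk.2 (min_le_min_right _ hij))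
  refine ⟨n, _, hmono, ?_, hr⟩
  obtain ⟨i, _, hi⟩ := (hr 0).1 h0
  exact le_antisymm (hi ▸ hmono (Nat.zero_le i)) bot_le

/-- The Markov property for finite-dimensional events. -/
theorem markov_cylinder (hJ : IsJumpKernel J) (hP : ∀ a, IsWalkLaw J a (P a)) {a x : Fin d → ℤ}
    {t : ℝ≥0} {T T' : Finset ℝ≥0} (h0 : 0 ∈ T) (ht : t ∈ T) (hT : ∀ r ∈ T, r ≤ t) (h0' : 0 ∈ T')
    {f f' : ℝ≥0 → Fin d → ℤ} (hf0 : f 0 = a) (hft : f t = x) (hf' : f' 0 = x) :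
    P a {ω | (∀ r ∈ T, ω.toFun r = f r) ∧ ∀ r ∈ T', ω.toFun (t + r) = f' r} =
      P a {ω | ∀ r ∈ T, ω.toFun r = f r} * P x {ω | ∀ r ∈ T', ω.toFun r = f' r} := by
  obtain ⟨n, u, hu, hu0, huT⟩ := exists_enum T h0
  obtain ⟨m, u', hu', hu0', huT'⟩ := exists_enum T' h0'
  have hun : u n = t := by
    obtain ⟨i, hi, hit⟩ := (huT t).1 ht
    exact le_antisymm (hT _ ((huT _).2 ⟨n, le_rfl, rfl⟩)) (hit ▸ hu hi)
  -- The times of `T`, up to `t`, followed by those of `t + T'`, with the prescribed values.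
  let w : ℕ → ℝ≥0 := fun i => if i ≤ n then u i else t + u' (i - n)
  let z : ℕ → Fin d → ℤ := fun i => if i ≤ n then f (u i) else f' (u' (i - n))
  have hw1 : ∀ i, i ≤ n → w i = u i := fun i hi => if_pos hi
  have hz1 : ∀ i, i ≤ n → z i = f (u i) := fun i hi => if_pos hi
  have hw2 : ∀ j, w (n + j) = t + u' j := by
    intro j
    rcases Nat.eq_zero_or_pos j with rfl | hj
    · rw [hw1 _ (by omega), hu0']; simpa using hun
    · simp only [w]
      rw [if_neg (by omega), Nat.add_sub_cancel_left]
  have hz2 : ∀ j, z (n + j) = f' (u' j) := by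
    intro j
    rcases Nat.eq_zero_or_pos j with rfl | hj
    · rw [hz1 _ (by omega), hu0', hf', add_zero, hun, hft]
    · simp only [z]
      rw [if_neg (by omega), Nat.add_sub_cancel_left]
  have hwm : Monotone w := by
    refine monotone_nat_of_le_succ fun i => ?_
    rcases lt_or_ge i n with hi | hi
    · rw [hw1 i hi.le, hw1 (i + 1) hi]; exact hu (Nat.le_succ i)
    · obtain ⟨j, rfl⟩ := Nat.exists_eq_add_of_le hi
      rw [hw2, add_assoc, hw2]
      exact add_le_add le_rfl (hu' (Nat.le_succ j))
  have e1 := (hP a).apply_seq n hu (fun i => f (u i)) hu0 (by rw [hu0, hf0])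
  have e2 := (hP x).apply_seq m hu' (fun i => f' (u' i)) hu0' (by rw [hu0', hf'])
  have e3 := (hP a).apply_seq (n + m) hwm z (by rw [hw1 _ (Nat.zero_le n), hu0])
    (by rw [hz1 _ (Nat.zero_le n), hu0, hf0])
  have s1 : {ω : CadlagPath d | ∀ r ∈ T, ω.toFun r = f r} =
      {ω | ∀ i ≤ n, ω.toFun (u i) = f (u i)} := by
    ext ω
    simp only [Set.mem_ofPred_eq, huT]
    exact ⟨fun h i hi => h _ ⟨i, hi, rfl⟩, by rintro h r ⟨i, hi, rfl⟩; exact h i hi⟩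
  have s2 : {ω : CadlagPath d | ∀ r ∈ T', ω.toFun r = f' r} =
      {ω | ∀ i ≤ m, ω.toFun (u' i) = f' (u' i)} := by
    ext ω
    simp only [Set.mem_ofPred_eq, huT']
    exact ⟨fun h i hi => h _ ⟨i, hi, rfl⟩, by rintro h r ⟨i, hi, rfl⟩; exact h i hi⟩
  have s3 : {ω : CadlagPath d | (∀ r ∈ T, ω.toFun r = f r) ∧ ∀ r ∈ T', ω.toFun (t + r) = f' r} =
      {ω | ∀ i ≤ n + m, ω.toFun (w i) = z i} := by
    ext ω
    simp only [Set.mem_ofPred_eq, huT, huT']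
    constructor
    · rintro ⟨h1, h2⟩ i hi
      rcases le_total i n with hin | hin
      · rw [hw1 i hin, hz1 i hin]; exact h1 _ ⟨i, hin, rfl⟩
      · obtain ⟨j, rfl⟩ := Nat.exists_eq_add_of_le hin
        rw [hw2, hz2]
        exact h2 _ ⟨j, by omega, rfl⟩
    · intro h
      constructor
      · rintro r ⟨i, hi, rfl⟩
        have := h i (by omega)
        rwa [hw1 i hi, hz1 i hi] at this
      · rintro r ⟨j, hj, rfl⟩
        have := h (n + j) (by omega)
        rwa [hw2, hz2] at this
  rw [s1, s2, s3, e1, e2, e3, ← ENNReal.ofReal_mul, Finset.prod_range_add]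
  · congr 2
    · refine Finset.prod_congr rfl fun i hi => ?_
      have hi := Finset.mem_range.1 hi
      rw [hw1 i hi.le, hw1 (i + 1) hi, hz1 i hi.le, hz1 (i + 1) hi]
    · refine Finset.prod_congr rfl fun j _ => ?_
      rw [add_assoc, hw2, hw2, hz2, hz2]
      push_cast
      rw [add_sub_add_left_eq_sub]
  · refine Finset.prod_nonneg fun i _ => transitionProb_nonneg hJ ?_ _
    rw [sub_nonneg, NNReal.coe_le_coe]
    exact hu (Nat.le_succ i)

/-- The finite-dimensional events that prescribe the values of the path at finitely many times. -/
def cylinders (d : ℕ) : Set (Set (CadlagPath d)) :=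
  {A | ∃ (T : Finset ℝ≥0) (f : ℝ≥0 → Fin d → ℤ), A = {ω | ∀ r ∈ T, ω.toFun r = f r}}

theorem measurableSet_cylinder (T : Finset ℝ≥0) (f : ℝ≥0 → Fin d → ℤ) :
    MeasurableSet {ω : CadlagPath d | ∀ r ∈ T, ω.toFun r = f r} := by
  have : {ω : CadlagPath d | ∀ r ∈ T, ω.toFun r = f r} =
      ⋂ r ∈ T, {ω | ω.toFun r = f r} := by ext; simp
  rw [this]
  exact MeasurableSet.biInter T.countable_toSet fun r _ =>
    measurable_coord r (measurableSet_singleton _)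

theorem isPiSystem_cylinders : IsPiSystem (cylinders d) := by
  rintro _ ⟨T, f, rfl⟩ _ ⟨T', f', rfl⟩ ⟨ω, h1, h2⟩
  refine ⟨T ∪ T', ω.toFun, ?_⟩
  ext ω'
  simp only [Set.mem_inter_iff, Set.mem_ofPred_eq, Finset.mem_union] at *
  constructor
  · rintro ⟨h3, h4⟩ r (hr | hr)
    · rw [h3 r hr, h1 r hr]
    · rw [h4 r hr, h2 r hr]
  · intro h
    exact ⟨fun r hr => by rw [h r (Or.inl hr), h1 r hr],
      fun r hr => by rw [h r (Or.inr hr), h2 r hr]⟩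

theorem generateFrom_cylinders :
    (inferInstance : MeasurableSpace (CadlagPath d)) = MeasurableSpace.generateFrom (cylinders d) := by
  refine le_antisymm ?_ ?_
  · refine iSup_le fun t => ?_
    rw [← measurable_iff_comap_le]
    refine @measurable_to_countable' _ _ _ _ (MeasurableSpace.generateFrom _) _ fun x => ?_
    refine MeasurableSpace.measurableSet_generateFrom ⟨{t}, fun _ => x, ?_⟩
    ext ω
    simp only [Set.mem_preimage, Set.mem_singleton_iff, Finset.mem_singleton, forall_eq,
      Set.mem_ofPred_eq]
  · refine MeasurableSpace.generateFrom_le ?_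
    rintro _ ⟨T, f, rfl⟩
    exact measurableSet_cylinder T f

theorem univ_mem_cylinders : Set.univ ∈ cylinders d := ⟨∅, fun _ => 0, by ext; simp⟩

/-- The Markov property for cylinder events: the past is described by the frozen path and the
future by the shifted path. -/
theorem markov_freeze_shift (hJ : IsJumpKernel J) (hP : ∀ a, IsWalkLaw J a (P a)) (a x : Fin d → ℤ)
    (t : ℝ≥0) (T T' : Finset ℝ≥0) (f f' : ℝ≥0 → Fin d → ℤ) :
    P a {ω | ω.toFun t = x ∧ (∀ r ∈ T, ω.toFun (min r t) = f r) ∧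
        ∀ r ∈ T', ω.toFun (t + r) = f' r} =
      P a {ω | ω.toFun t = x ∧ ∀ r ∈ T, ω.toFun (min r t) = f r} *
        P x {ω | ∀ r ∈ T', ω.toFun r = f' r} := by
  have hs := (hP a).ae_start
  have hsx := (hP x).ae_start
  -- Values that are not attained by any path give null events. Otherwise the values may be read
  -- off from a path, which makes them consistent at the times `0` and `t` and at coinciding times.
  by_cases h1 : ∃ ω : CadlagPath d, ω.toFun 0 = a ∧ ω.toFun t = x ∧
      ∀ r ∈ T, ω.toFun (min r t) = f r
  swap
  · have hz : P a {ω | ω.toFun t = x ∧ ∀ r ∈ T, ω.toFun (min r t) = f r} = 0 := by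
      rw [measure_eq_zero_iff_ae_notMem]
      filter_upwards [hs] with ω hω hc
      exact h1 ⟨ω, hω, hc⟩
    rw [hz, zero_mul]
    rw [measure_eq_zero_iff_ae_notMem] at hz ⊢
    filter_upwards [hz] with ω hω hc
    exact hω ⟨hc.1, hc.2.1⟩
  by_cases h2 : ∃ ω : CadlagPath d, ω.toFun 0 = x ∧ ∀ r ∈ T', ω.toFun r = f' r
  swap
  · have hz : P x {ω | ∀ r ∈ T', ω.toFun r = f' r} = 0 := by
      rw [measure_eq_zero_iff_ae_notMem]
      filter_upwards [hsx] with ω hω hc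
      exact h2 ⟨ω, hω, hc⟩
    rw [hz, mul_zero]
    rw [measure_eq_zero_iff_ae_notMem]
    refine Eventually.of_forall fun ω hω => h2 ⟨shift t ω, ?_, hω.2.2⟩
    simpa using hω.1
  obtain ⟨ω₁, h10, h1t, h1⟩ := h1
  obtain ⟨ω₂, h20, h2⟩ := h2
  have key := markov_cylinder hJ hP (a := a) (x := x) (t := t)
    (T := insert 0 (insert t (T.image fun r => min r t))) (T' := insert 0 T')
    (by simp) (by simp) (by simp) (by simp) (f := ω₁.toFun) (f' := ω₂.toFun) h10 h1t h20
  have c1 : P a {ω | ω.toFun t = x ∧ (∀ r ∈ T, ω.toFun (min r t) = f r) ∧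
        ∀ r ∈ T', ω.toFun (t + r) = f' r} =
      P a {ω | (∀ r ∈ insert 0 (insert t (T.image fun r => min r t)), ω.toFun r = ω₁.toFun r) ∧
        ∀ r ∈ insert 0 T', ω.toFun (t + r) = ω₂.toFun r} := by
    refine measure_congr (eventuallyEq_set.2 ?_)
    filter_upwards [hs] with ω hω
    simp only [Finset.mem_insert, Finset.mem_image, forall_eq_or_imp,
      forall_exists_index, and_imp, forall_apply_eq_imp_iff₂, hω, h10, h1t, h20, true_and, add_zero]
    constructor
    · rintro ⟨g1, g2, g3⟩
      exact ⟨⟨g1, fun r hr => (g2 r hr).trans (h1 r hr).symm⟩, g1,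
        fun r hr => (g3 r hr).trans (h2 r hr).symm⟩
    · rintro ⟨⟨g1, g2⟩, _, g3⟩
      exact ⟨g1, fun r hr => (g2 r hr).trans (h1 r hr), fun r hr => (g3 r hr).trans (h2 r hr)⟩
  have c2 : P a {ω | ω.toFun t = x ∧ ∀ r ∈ T, ω.toFun (min r t) = f r} =
      P a {ω | ∀ r ∈ insert 0 (insert t (T.image fun r => min r t)), ω.toFun r = ω₁.toFun r} := by
    refine measure_congr (eventuallyEq_set.2 ?_)
    filter_upwards [hs] with ω hω
    simp only [Finset.mem_insert, Finset.mem_image, forall_eq_or_imp,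
      forall_exists_index, and_imp, forall_apply_eq_imp_iff₂, hω, h10, h1t, true_and]
    constructor
    · rintro ⟨g1, g2⟩
      exact ⟨g1, fun r hr => (g2 r hr).trans (h1 r hr).symm⟩
    · rintro ⟨g1, g2⟩
      exact ⟨g1, fun r hr => (g2 r hr).trans (h1 r hr)⟩
  have c3 : P x {ω | ∀ r ∈ T', ω.toFun r = f' r} =
      P x {ω | ∀ r ∈ insert 0 T', ω.toFun r = ω₂.toFun r} := by
    refine measure_congr (eventuallyEq_set.2 ?_)
    filter_upwards [hsx] with ω hω
    simp only [Finset.mem_insert, forall_eq_or_imp, hω, h20, true_and]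
    exact ⟨fun g r hr => (g r hr).trans (h2 r hr).symm, fun g r hr => (g r hr).trans (h2 r hr)⟩
  rw [c1, c2, c3, key]

/-- Under `P a`, on the event that the walk is at `x` at time `t`, the past (frozen path) and the
future (shifted path) are independent, and the future has law `P x`. -/
theorem map_freeze_shift (hJ : IsJumpKernel J) (hP : ∀ a, IsWalkLaw J a (P a)) (a x : Fin d → ℤ)
    (t : ℝ≥0) :
    ((P a).restrict {ω | ω.toFun t = x}).map (fun ω => (freeze t ω, shift t ω)) =
      (((P a).restrict {ω | ω.toFun t = x}).map (freeze t)).prod (P x) := by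
  have := (hP a).isProbabilityMeasure
  have := (hP x).isProbabilityMeasure
  have hm : Measurable fun ω : CadlagPath d => (freeze t ω, shift t ω) :=
    (measurable_freeze t).prodMk (measurable_shift t)
  have hx : MeasurableSet {ω : CadlagPath d | ω.toFun t = x} :=
    measurable_coord t (measurableSet_singleton x)
  refine (Measure.prod_eq_generateFrom (C := cylinders d) (D := cylinders d)
    generateFrom_cylinders.symm generateFrom_cylinders.symm
    isPiSystem_cylinders isPiSystem_cylinders
    ⟨fun _ => Set.univ, fun _ => univ_mem_cylinders, fun _ => measure_lt_top _ _, Set.iUnion_const _⟩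
    ⟨fun _ => Set.univ, fun _ => univ_mem_cylinders, fun _ => measure_lt_top _ _, Set.iUnion_const _⟩
    ?_).symm
  rintro _ ⟨T, f, rfl⟩ _ ⟨T', f', rfl⟩
  have hA := measurableSet_cylinder T f
  have hB := measurableSet_cylinder T' f'
  rw [Measure.map_apply hm (hA.prod hB), Measure.map_apply (measurable_freeze t) hA,
    Measure.restrict_apply (hm (hA.prod hB)), Measure.restrict_apply (measurable_freeze t hA)]
  convert markov_freeze_shift hJ hP a x t T T' f f' using 2
  · ext ω
    simp only [Set.mem_inter_iff, Set.mem_preimage, Set.mem_prod, Set.mem_ofPred_eq, freeze_toFun,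
      shift_toFun]
    tauto
  · congr 1
    ext ω
    simp only [Set.mem_inter_iff, Set.mem_preimage, Set.mem_ofPred_eq, freeze_toFun]
    tauto

theorem markov (hJ : IsJumpKernel J) (hP : ∀ a, IsWalkLaw J a (P a)) (a x : Fin d → ℤ)
    (t : ℝ≥0) {F H : CadlagPath d → ℝ≥0∞} (hF : Measurable F) (hH : Measurable H) :
    ∫⁻ ω in {ω | ω.toFun t = x}, F (freeze t ω) * H (shift t ω) ∂(P a) =
      (∫⁻ ω in {ω | ω.toFun t = x}, F (freeze t ω) ∂(P a)) * ∫⁻ ω, H ω ∂(P x) := by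
  have := (hP a).isProbabilityMeasure
  have := (hP x).isProbabilityMeasure
  have h := congrArg (fun μ => ∫⁻ p, F p.1 * H p.2 ∂μ) (map_freeze_shift hJ hP a x t)
  beta_reduce at h
  rw [lintegral_map (f := fun p : CadlagPath d × CadlagPath d => F p.1 * H p.2)
    ((hF.comp measurable_fst).mul (hH.comp measurable_snd))
    ((measurable_freeze t).prodMk (measurable_shift t)),
    lintegral_prod_mul hF.aemeasurable hH.aemeasurable, lintegral_map hF (measurable_freeze t)] at h
  exact h

variable (Λ : Finset (Fin d → ℤ))

theorem measurableSet_killed_at (t : ℝ≥0) (x : Fin d → ℤ) :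
    MeasurableSet {ω : CadlagPath d | killed Λ ω t = some x} :=
  (measurable_id.prodMk measurable_const) (measurableSet_killed Λ x)

theorem measurableSet_alive_at (t : ℝ≥0) :
    MeasurableSet {ω : CadlagPath d | Alive Λ ω t} :=
  (measurable_id.prodMk measurable_const) (measurableSet_alive Λ)

/-- The Markov property of the killed walk at time `t`, for a functional `F` of the path up to
time `t` and a functional `H` of the future. -/
theorem markov_killed (hJ : IsJumpKernel J) (hP : ∀ a, IsWalkLaw J a (P a)) (a x : Fin d → ℤ)
    (t : ℝ≥0) {F H : CadlagPath d → ℝ≥0∞} (hF : Measurable F) (hH : Measurable H)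
    (hFt : ∀ ω, F (freeze t ω) = F ω) :
    ∫⁻ ω in {ω | killed Λ ω t = some x}, F ω * H (shift t ω) ∂(P a) =
      (∫⁻ ω in {ω | killed Λ ω t = some x}, F ω ∂(P a)) * ∫⁻ ω, H ω ∂(P x) := by
  have hA := measurableSet_alive_at Λ t
  have hx : MeasurableSet {ω : CadlagPath d | ω.toFun t = x} :=
    measurable_coord t (measurableSet_singleton x)
  have hset : {ω : CadlagPath d | killed Λ ω t = some x} =
      {ω | Alive Λ ω t} ∩ {ω | ω.toFun t = x} := by
    ext ω; exact killed_eq_some_iff Λ ω t x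
  have hAs : ∀ ω, Alive Λ (freeze t ω) t ↔ Alive Λ ω t := fun ω => by
    rw [← killed_ne_none_iff, ← killed_ne_none_iff, killed_freeze Λ ω le_rfl]
  have hI : ∀ ω, ({ω | Alive Λ ω t}.indicator F) (freeze t ω) = {ω | Alive Λ ω t}.indicator F ω := by
    intro ω
    by_cases h : Alive Λ ω t
    · rw [Set.indicator_of_mem (s := {ω | Alive Λ ω t}) h,
        Set.indicator_of_mem (s := {ω | Alive Λ ω t}) ((hAs ω).2 h), hFt]
    · rw [Set.indicator_of_notMem (s := {ω | Alive Λ ω t}) h,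
        Set.indicator_of_notMem (s := {ω | Alive Λ ω t}) (mt (hAs ω).1 h)]
  have h := markov hJ hP a x t (hF.indicator hA) hH
  simp only [hI] at h
  rw [hset, ← Measure.restrict_restrict hA, ← lintegral_indicator hA, ← lintegral_indicator hA,
    ← h]
  refine lintegral_congr fun ω => ?_
  by_cases hω : Alive Λ ω t <;> simp [Set.indicator, hω]

end

/-! ### The walk leaves finite sets exponentially fast -/

section

variable {d : ℕ}

variable {J : (Fin d → ℤ) → ℝ} {P : (Fin d → ℤ) → Measure (CadlagPath d)}

theorem IsJumpKernel.exists_pos (hJ : IsJumpKernel J) (hd : 1 ≤ d) : ∃ z, z ≠ 0 ∧ 0 < J z := by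
  by_contra! hc
  have h0 : J 0 ≤ 0 := by
    rw [hJ.at_zero, neg_nonpos]
    exact tsum_nonneg fun x => hJ.nonneg x x.2
  have he : {x | 0 < J x} = ∅ := by
    rw [Set.eq_empty_iff_forall_notMem]
    intro x hx
    by_cases h : x = 0
    · subst h; exact absurd hx (not_lt.2 h0)
    · exact absurd hx (not_lt.2 (hc x h))
  have hg := hJ.generating
  rw [he, AddSubgroup.closure_empty] at hg
  have hm : (fun _ => 1 : Fin d → ℤ) ∈ (⊥ : AddSubgroup (Fin d → ℤ)) := hg ▸ AddSubgroup.mem_top _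
  rw [AddSubgroup.mem_bot] at hm
  exact one_ne_zero (congrFun hm ⟨0, hd⟩)

theorem IsJumpKernel.exists_support (hJ : IsJumpKernel J) :
    ∃ F : Finset (Fin d → ℤ), ∀ x ∉ F, jumpRate J x = 0 := by
  obtain ⟨R, _, h⟩ := hJ.finite_range
  have hfin : {x : Fin d → ℤ | Real.sqrt (∑ i, (x i : ℝ) ^ 2) < R}.Finite := by
    refine (Set.finite_Icc (fun _ => -⌈R⌉ : Fin d → ℤ) (fun _ => ⌈R⌉)).subset fun x hx => ?_
    have hi : ∀ i, |(x i : ℝ)| ≤ ⌈R⌉ := by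
      intro i
      have h1 : |(x i : ℝ)| ≤ Real.sqrt (∑ i, (x i : ℝ) ^ 2) := by
        refine Real.abs_le_sqrt ?_
        exact Finset.single_le_sum (f := fun i => (x i : ℝ) ^ 2) (fun i _ => sq_nonneg _)
          (Finset.mem_univ i)
      exact h1.trans ((le_of_lt hx).trans (Int.le_ceil R))
    constructor <;> intro i
    · have := (abs_le.1 (hi i)).1
      exact_mod_cast this
    · have := (abs_le.1 (hi i)).2
      exact_mod_cast this
  refine ⟨hfin.toFinset, fun x hx => ?_⟩
  unfold jumpRate
  split_ifs
  · rfl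
  · refine h x (not_lt.1 fun hlt => hx ?_)
    simpa using hlt

theorem conv_eq_sum {f : (Fin d → ℤ) → ℝ} {F : Finset (Fin d → ℤ)} (hF : ∀ x ∉ F, f x = 0)
    (h : (Fin d → ℤ) → ℝ) (x : Fin d → ℤ) : conv f h x = ∑ y ∈ F, f y * h (x - y) :=
  tsum_eq_sum fun y hy => by rw [hF y hy, zero_mul]

theorem convPow_le {f : (Fin d → ℤ) → ℝ} {F : Finset (Fin d → ℤ)} (hF : ∀ x ∉ F, f x = 0)
    (hf : ∀ x, 0 ≤ f x) (n : ℕ) : ∀ x, convPow f n x ≤ (∑ y ∈ F, f y) ^ n := by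
  induction n with
  | zero => intro x; unfold convPow; split_ifs <;> simp
  | succ n ih =>
    intro x
    change conv f (convPow f n) x ≤ _
    rw [conv_eq_sum hF, pow_succ', Finset.sum_mul]
    exact Finset.sum_le_sum fun y _ => mul_le_mul_of_nonneg_left (ih _) (hf y)

theorem le_convPow_nsmul {f : (Fin d → ℤ) → ℝ} {F : Finset (Fin d → ℤ)} (hF : ∀ x ∉ F, f x = 0)
    (hf : ∀ x, 0 ≤ f x) {z : Fin d → ℤ} (hz : 0 < f z) (n : ℕ) :
    f z ^ n ≤ convPow f n (n • z) := by
  induction n with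
  | zero => simp [convPow]
  | succ n ih =>
    change _ ≤ conv f (convPow f n) _
    rw [conv_eq_sum hF, pow_succ']
    have hzF : z ∈ F := by by_contra h; exact hz.ne' (hF z h)
    refine le_trans ?_ (Finset.single_le_sum (f := fun y => f y * convPow f n ((n + 1) • z - y))
      (fun y _ => mul_nonneg (hf y) (convPow_nonneg hf n _)) hzF)
    rw [succ_nsmul, add_sub_cancel_right]
    exact mul_le_mul_of_nonneg_left ih hz.le

theorem transitionProb_one_nsmul_pos (hJ : IsJumpKernel J) {z : Fin d → ℤ} (hz0 : z ≠ 0)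
    (hz : 0 < J z) (n : ℕ) : 0 < transitionProb J 1 (n • z) := by
  obtain ⟨F, hF⟩ := hJ.exists_support
  have hf := jumpRate_nonneg hJ
  have hzr : 0 < jumpRate J z := by simpa [jumpRate, hz0] using hz
  unfold transitionProb
  refine mul_pos (Real.exp_pos _) ?_
  have hs : Summable fun m : ℕ => (1 : ℝ) ^ m / (m.factorial : ℝ) * convPow (jumpRate J) m (n • z) := by
    refine Summable.of_nonneg_of_le
      (fun m => mul_nonneg (by positivity) (convPow_nonneg hf m _)) (fun m => ?_)
      (Real.summable_pow_div_factorial (∑ y ∈ F, jumpRate J y))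
    rw [one_pow, div_mul_eq_mul_div, one_mul]
    exact div_le_div_of_nonneg_right (convPow_le hF hf m _) (by positivity)
  refine hs.tsum_pos (fun m => mul_nonneg (by positivity) (convPow_nonneg hf m _)) n ?_
  exact mul_pos (by positivity) ((pow_pos hzr n).trans_le (le_convPow_nsmul hF hf hzr n))

theorem IsWalkLaw.apply_coord (hP : ∀ a, IsWalkLaw J a (P a)) (a x : Fin d → ℤ) (t : ℝ≥0) :
    P a {ω | ω.toFun t = a + x} = ENNReal.ofReal (transitionProb J t x) := by
  have h := (hP a).apply_seq 1 (t := fun i => if i = 0 then 0 else t) ?_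
    (fun i => if i = 0 then a else a + x) rfl rfl
  · simp only [Finset.prod_range_one, zero_add, one_ne_zero, if_false, if_true, NNReal.coe_zero,
      sub_zero, add_sub_cancel_left] at h
    rw [← h]
    refine measure_congr (eventuallyEq_set.2 ?_)
    filter_upwards [(hP a).ae_start] with ω hω
    constructor
    · intro h1 i hi
      rcases Nat.le_one_iff_eq_zero_or_eq_one.1 hi with rfl | rfl
      · simpa using hω
      · simpa using h1
    · intro h1
      simpa using h1 1 le_rfl
  · refine monotone_nat_of_le_succ fun i => ?_
    by_cases hi : i = 0 <;> simp [hi]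

variable (Λ : Finset (Fin d → ℤ))

/-- The walk leaves `Λ` before time `1` with positive probability: it can make any number of jumps
in one fixed direction. -/
theorem prob_alive_one_lt_one (hd : 1 ≤ d) (hJ : IsJumpKernel J) (hP : ∀ a, IsWalkLaw J a (P a))
    (a : Fin d → ℤ) : P a {ω | Alive Λ ω 1} < 1 := by
  have := (hP a).isProbabilityMeasure
  obtain ⟨z, hz0, hz⟩ := hJ.exists_pos hd
  obtain ⟨n, hn⟩ : ∃ n : ℕ, a + n • z ∉ Λ := by
    by_contra! hc
    have hinj : Function.Injective fun n : ℕ => a + n • z := by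
      intro m n hmn
      have h1 : m • z = n • z := add_left_cancel hmn
      obtain ⟨i, hi⟩ := Function.ne_iff.1 hz0
      have h2 := congrFun h1 i
      simp only [Pi.smul_apply, nsmul_eq_mul] at h2
      exact_mod_cast mul_right_cancel₀ hi h2
    exact Set.infinite_range_of_injective hinj (Λ.finite_toSet.subset (Set.range_subset_iff.2 hc))
  have h1 : 0 < P a {ω | ω.toFun 1 = a + n • z} := by
    rw [IsWalkLaw.apply_coord hP, ENNReal.ofReal_pos]
    exact_mod_cast transitionProb_one_nsmul_pos hJ hz0 hz n
  have hm : MeasurableSet {ω : CadlagPath d | ω.toFun 1 = a + n • z} :=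
    measurable_coord 1 (measurableSet_singleton _)
  have h2 : P a {ω | Alive Λ ω 1} ≤ P a {ω | ω.toFun 1 = a + n • z}ᶜ := by
    refine measure_mono fun ω hω hc => hn ?_
    rw [← show ω.toFun 1 = a + n • z from hc]
    exact hω 1 le_rfl
  rw [prob_compl_eq_one_sub hm] at h2
  exact h2.trans_lt (ENNReal.sub_lt_self ENNReal.one_ne_top one_ne_zero h1.ne')

theorem lintegral_alive_eq_sum (t : ℝ≥0) (Q : Measure (CadlagPath d)) (f : CadlagPath d → ℝ≥0∞) :
    ∫⁻ ω in {ω | Alive Λ ω t}, f ω ∂Q = ∑ x ∈ Λ, ∫⁻ ω in {ω | killed Λ ω t = some x}, f ω ∂Q := by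
  have hset : {ω : CadlagPath d | Alive Λ ω t} = ⋃ x ∈ Λ, {ω | killed Λ ω t = some x} := by
    ext ω
    simpa using alive_iff_exists_killed_eq Λ ω t
  rw [hset, lintegral_biUnion_finset _ fun x _ => measurableSet_killed_at Λ t x]
  intro x _ y _ hxy
  refine Set.disjoint_left.2 fun ω (h1 : killed Λ ω t = some x) (h2 : killed Λ ω t = some y) => ?_
  exact hxy (Option.some.inj (h1.symm.trans h2))

/-- Survival probabilities decay geometrically, by the Markov property at integer times. -/
theorem prob_alive_le_pow (hJ : IsJumpKernel J) (hP : ∀ a, IsWalkLaw J a (P a)) {q : ℝ≥0∞}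
    (hq : ∀ a ∈ Λ, P a {ω | Alive Λ ω 1} ≤ q) (a : Fin d → ℤ) (n : ℕ) :
    P a {ω | Alive Λ ω n} ≤ q ^ n := by
  have := (hP a).isProbabilityMeasure
  induction n with
  | zero => simpa using prob_le_one
  | succ n ih =>
    have h1 : P a {ω | Alive Λ ω ((n : ℝ≥0) + 1)} = ∫⁻ ω in {ω | Alive Λ ω n},
        1 * {ω | Alive Λ ω 1}.indicator 1 (shift n ω) ∂(P a) := by
      rw [← lintegral_indicator_one (measurableSet_alive_at Λ _),
        ← lintegral_indicator (measurableSet_alive_at Λ _)]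
      refine lintegral_congr fun ω => ?_
      by_cases h1 : Alive Λ ω n <;> by_cases h2 : Alive Λ (shift n ω) 1 <;>
        simp [Set.indicator, alive_add_iff, h1, h2]
    push_cast
    rw [h1, lintegral_alive_eq_sum]
    calc ∑ x ∈ Λ, ∫⁻ ω in {ω | killed Λ ω n = some x},
          1 * {ω | Alive Λ ω 1}.indicator 1 (shift n ω) ∂(P a)
        = ∑ x ∈ Λ, (∫⁻ ω in {ω | killed Λ ω n = some x}, 1 ∂(P a)) * P x {ω | Alive Λ ω 1} := by
          refine Finset.sum_congr rfl fun x _ => ?_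
          rw [markov_killed Λ hJ hP a x n (F := fun _ => 1) measurable_const
            (measurable_one.indicator (measurableSet_alive_at Λ 1)) (fun _ => rfl),
            lintegral_indicator_one (measurableSet_alive_at Λ 1)]
      _ ≤ ∑ x ∈ Λ, (∫⁻ ω in {ω | killed Λ ω n = some x}, 1 ∂(P a)) * q :=
          Finset.sum_le_sum fun x hx => mul_le_mul_right (hq x hx) _
      _ = P a {ω | Alive Λ ω n} * q := by
          rw [← Finset.sum_mul, ← lintegral_alive_eq_sum, setLIntegral_one]
      _ ≤ q ^ (n + 1) := by
          rw [pow_succ]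
          exact mul_le_mul_left ih _

/-- The mean survival time of the killed walk is finite. -/
theorem lintegral_prob_alive_lt_top (hd : 1 ≤ d) (hJ : IsJumpKernel J)
    (hP : ∀ a, IsWalkLaw J a (P a)) (a : Fin d → ℤ) :
    ∫⁻ s in Set.Ici (0 : ℝ), P a {ω | Alive Λ ω s.toNNReal} < ∞ := by
  set q : ℝ≥0∞ := Λ.sup fun x => P x {ω | Alive Λ ω 1} with hqdef
  have hq1 : q < 1 := by
    rw [hqdef, Finset.sup_lt_iff (by simp)]
    exact fun x _ => prob_alive_one_lt_one Λ hd hJ hP x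
  have hq : ∀ x ∈ Λ, P x {ω | Alive Λ ω 1} ≤ q := fun x hx =>
    Finset.le_sup (f := fun x => P x {ω | Alive Λ ω 1}) hx
  have hsub : Set.Ici (0 : ℝ) ⊆ ⋃ n : ℕ, Set.Ico (n : ℝ) (n + 1) := fun s hs =>
    Set.mem_iUnion.2 ⟨⌊s⌋₊, Nat.floor_le hs, Nat.lt_floor_add_one s⟩
  calc ∫⁻ s in Set.Ici (0 : ℝ), P a {ω | Alive Λ ω s.toNNReal}
      ≤ ∫⁻ s in ⋃ n : ℕ, Set.Ico (n : ℝ) (n + 1), P a {ω | Alive Λ ω s.toNNReal} :=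
        lintegral_mono_set hsub
    _ ≤ ∑' n : ℕ, ∫⁻ s in Set.Ico (n : ℝ) (n + 1), P a {ω | Alive Λ ω s.toNNReal} :=
        lintegral_iUnion_le _ _
    _ ≤ ∑' n : ℕ, q ^ n := by
        refine ENNReal.tsum_le_tsum fun n => ?_
        calc ∫⁻ s in Set.Ico (n : ℝ) (n + 1), P a {ω | Alive Λ ω s.toNNReal}
            ≤ ∫⁻ s in Set.Ico (n : ℝ) (n + 1), q ^ n := by
              refine setLIntegral_mono measurable_const fun s hs => ?_
              refine le_trans (measure_mono fun ω hω => ?_) (prob_alive_le_pow Λ hJ hP hq a n)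
              refine Alive.mono hω ?_
              rw [Real.le_toNNReal_iff_coe_le (n.cast_nonneg.trans hs.1)]
              exact_mod_cast hs.1
          _ = q ^ n := by simp
    _ < ∞ := by
        rw [ENNReal.tsum_geometric]
        refine ENNReal.inv_lt_top.2 ?_
        exact tsub_pos_of_lt hq1

end

/-! ### Calculus along occupation times -/

section

section Calculus

variable {ι : Type*} [Fintype ι]

/-- The properties that matter of the occupation density `γ_x(r) = 1_{X_r = x}` of a
right-continuous path on a discrete space. As the space is discrete, right-continuity says that `γ`
is constant for a short while after each time. -/
structure IsOccupation (γ : ℝ → ι → ℝ) : Prop where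
  measurable : Measurable γ
  nonneg : ∀ r, 0 ≤ γ r
  le_one : ∀ r, γ r ≤ 1
  right : ∀ r, ∀ᶠ s in 𝓝[≥] r, γ s = γ r

/-- The time integral of the occupation density over `[s,t]`. -/
def occTime (γ : ℝ → ι → ℝ) (s t : ℝ) : ι → ℝ := ∫ r in Set.Icc s t, γ r

/-- The derivative of `log Z` within the orthant, one-sided at the boundary. -/
def logD (Z : (ι → ℝ) → ℝ) (τ : ι → ℝ) : (ι → ℝ) →L[ℝ] ℝ :=
  fderivWithin ℝ (fun τ => Real.log (Z τ)) (Set.Ici 0) τ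

/-- The second derivative of `log Z` within the orthant. -/
def logD2 (Z : (ι → ℝ) → ℝ) (τ : ι → ℝ) : (ι → ℝ) →L[ℝ] (ι → ℝ) →L[ℝ] ℝ :=
  fderivWithin ℝ (logD Z) (Set.Ici 0) τ

/-- The interaction `Y_{s,t}` as a function of the occupation density. -/
def occInter (Z : (ι → ℝ) → ℝ) (γ : ℝ → ι → ℝ) (s t : ℝ) : ℝ := Z (occTime γ s t) / Z 0

/-- The second derivative of `log Z` in the directions of the sites at the times `s` and `t`. It is
the pair vertex `r_{s,t}` for `s < t`. -/
def pairRate (Z : (ι → ℝ) → ℝ) (γ : ℝ → ι → ℝ) (s t : ℝ) : ℝ :=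
  logD2 Z (occTime γ s t) (γ s) (γ t)

theorem orthant_interior_nonempty : (interior (Set.Ici (0 : ι → ℝ))).Nonempty := by
  refine ⟨fun _ => 1, ?_⟩
  rw [← Set.pi_univ_Ici, interior_pi_set Set.finite_univ]
  simp

theorem uniqueDiffOn_orthant : UniqueDiffOn ℝ (Set.Ici (0 : ι → ℝ)) :=
  uniqueDiffOn_convex (convex_Ici (𝕜 := ℝ) (0 : ι → ℝ)) orthant_interior_nonempty

theorem orthant_subset_closure_interior :
    Set.Ici (0 : ι → ℝ) ⊆ closure (interior (Set.Ici (0 : ι → ℝ))) := by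
  rw [(convex_Ici (𝕜 := ℝ) (0 : ι → ℝ)).closure_interior_eq_closure_of_nonempty_interior
    orthant_interior_nonempty]
  exact subset_closure

variable {γ : ℝ → ι → ℝ}

theorem IsOccupation.norm_le (h : IsOccupation γ) (r : ℝ) : ‖γ r‖ ≤ 1 := by
  rw [pi_norm_le_iff_of_nonneg zero_le_one]
  intro i
  rw [Real.norm_of_nonneg (h.nonneg r i)]
  exact h.le_one r i

theorem IsOccupation.intervalIntegrable (h : IsOccupation γ) (a b : ℝ) :
    IntervalIntegrable γ volume a b := by
  refine (intervalIntegrable_const (c := (1 : ℝ))).mono_fun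
    h.measurable.aestronglyMeasurable ?_
  exact Eventually.of_forall fun r => by simpa using h.norm_le r

theorem occTime_eq (γ : ℝ → ι → ℝ) {s t : ℝ} (hst : s ≤ t) :
    occTime γ s t = ∫ r in s..t, γ r := by
  rw [occTime, integral_Icc_eq_integral_Ioc, intervalIntegral.integral_of_le hst]

theorem occTime_self (γ : ℝ → ι → ℝ) (s : ℝ) : occTime γ s s = 0 := by
  rw [occTime_eq γ le_rfl, intervalIntegral.integral_same]

theorem IsOccupation.integrableOn (h : IsOccupation γ) (s t : ℝ) :
    IntegrableOn γ (Set.Icc s t) := by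
  refine Measure.integrableOn_of_bounded (M := 1) (by simp)
    h.measurable.aestronglyMeasurable (Eventually.of_forall h.norm_le)

theorem IsOccupation.occTime_apply (h : IsOccupation γ) (s t : ℝ) (i : ι) :
    occTime γ s t i = ∫ r in Set.Icc s t, γ r i :=
  MeasureTheory.eval_integral (fun i => (h.integrableOn s t).eval i) i

theorem IsOccupation.occTime_mem (h : IsOccupation γ) (s t : ℝ) :
    occTime γ s t ∈ Set.Ici (0 : ι → ℝ) := by
  intro i
  rw [h.occTime_apply]
  exact integral_nonneg fun r => h.nonneg r i

theorem IsOccupation.occTime_le (h : IsOccupation γ) {s t l : ℝ} (hl : 0 ≤ l) (hst : t - s ≤ l) :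
    occTime γ s t ≤ fun _ => l := by
  intro i
  rw [h.occTime_apply]
  have h1 : ∫ r in Set.Icc s t, γ r i ≤ ∫ _ in Set.Icc s t, (1 : ℝ) :=
    setIntegral_mono ((h.integrableOn s t).eval i) (by simp) fun r => h.le_one r i
  refine h1.trans ?_
  rw [setIntegral_const, smul_eq_mul, mul_one, Measure.real, Real.volume_Icc]
  exact ENNReal.toReal_le_of_le_ofReal hl (ENNReal.ofReal_le_ofReal hst)

theorem IsOccupation.continuousWithinAt {κ : Type*} {γ : ℝ → κ → ℝ} (h : IsOccupation γ) (r : ℝ) :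
    ContinuousWithinAt γ (Set.Ici r) r :=
  (tendsto_congr' (h.right r)).2 tendsto_const_nhds

theorem IsOccupation.hasDerivWithinAt_right (h : IsOccupation γ) {s t : ℝ} (hst : s ≤ t) :
    HasDerivWithinAt (fun t' => occTime γ s t') (γ t) (Set.Ici t) t := by
  have h1 : HasDerivWithinAt (fun t' => ∫ r in s..t', γ r) (γ t) (Set.Ici t) t :=
    intervalIntegral.integral_hasDerivWithinAt_right (h.intervalIntegrable s t)
      (t := Set.Ioi t) h.measurable.stronglyMeasurable.stronglyMeasurableAtFilter
      ((h.continuousWithinAt t).mono Set.Ioi_subset_Ici_self)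
  exact h1.congr (fun t' ht' => occTime_eq γ (hst.trans ht')) (occTime_eq γ hst)

theorem IsOccupation.hasDerivWithinAt_left (h : IsOccupation γ) {s t : ℝ} (hst : s < t) :
    HasDerivWithinAt (fun s' => occTime γ s' t) (-γ s) (Set.Ici s) s := by
  have h1 : HasDerivWithinAt (fun s' => ∫ r in s'..t, γ r) (-γ s) (Set.Ici s) s :=
    intervalIntegral.integral_hasDerivWithinAt_left (h.intervalIntegrable s t)
      (t := Set.Ioi s) h.measurable.stronglyMeasurable.stronglyMeasurableAtFilter
      ((h.continuousWithinAt s).mono Set.Ioi_subset_Ici_self)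
  refine h1.congr_of_eventuallyEq ?_ (occTime_eq γ hst.le)
  have : ∀ᶠ s' in 𝓝[≥] s, s' < t := nhdsWithin_le_nhds (gt_mem_nhds hst)
  filter_upwards [this] with s' hs'
  exact occTime_eq γ hs'.le

theorem IsOccupation.norm_occTime_sub_right (h : IsOccupation γ) {s t t' : ℝ} (hst : s ≤ t)
    (hst' : s ≤ t') : ‖occTime γ s t' - occTime γ s t‖ ≤ |t' - t| := by
  rw [occTime_eq γ hst, occTime_eq γ hst', intervalIntegral.integral_interval_sub_left
    (h.intervalIntegrable _ _) (h.intervalIntegrable _ _)]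
  simpa using intervalIntegral.norm_integral_le_of_norm_le_const (a := t) (b := t') (C := 1)
    fun r _ => h.norm_le r

theorem IsOccupation.norm_occTime_sub_left (h : IsOccupation γ) {s s' t : ℝ} (hst : s ≤ t)
    (hst' : s' ≤ t) : ‖occTime γ s' t - occTime γ s t‖ ≤ |s' - s| := by
  rw [occTime_eq γ hst, occTime_eq γ hst', ← intervalIntegral.integral_add_adjacent_intervals
    (h.intervalIntegrable s' s) (h.intervalIntegrable s t), add_sub_cancel_right, abs_sub_comm]
  simpa using intervalIntegral.norm_integral_le_of_norm_le_const (a := s') (b := s) (C := 1)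
    fun r _ => h.norm_le r

theorem IsOccupation.continuousOn_right (h : IsOccupation γ) (s : ℝ) :
    ContinuousOn (fun t => occTime γ s t) (Set.Ici s) := by
  refine (LipschitzOnWith.of_dist_le_mul (K := 1) fun t ht t' ht' => ?_).continuousOn
  rw [dist_eq_norm, Real.dist_eq]
  simpa using h.norm_occTime_sub_right ht' ht

theorem IsOccupation.continuousOn_left (h : IsOccupation γ) (t : ℝ) :
    ContinuousOn (fun s => occTime γ s t) (Set.Iic t) := by
  refine (LipschitzOnWith.of_dist_le_mul (K := 1) fun s hs s' hs' => ?_).continuousOn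
  rw [dist_eq_norm, Real.dist_eq]
  simpa using h.norm_occTime_sub_left hs' hs

section Chain

variable {F : Type*} [NormedAddCommGroup F] [NormedSpace ℝ F] {G : (ι → ℝ) → F}

theorem IsOccupation.chain_right (h : IsOccupation γ) (hG : DifferentiableOn ℝ G (Set.Ici 0))
    {s t : ℝ} (hst : s ≤ t) :
    HasDerivWithinAt (fun t' => G (occTime γ s t'))
      (fderivWithin ℝ G (Set.Ici 0) (occTime γ s t) (γ t)) (Set.Ici t) t :=
  ((hG _ (h.occTime_mem s t)).hasFDerivWithinAt).comp_hasDerivWithinAt t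
    (h.hasDerivWithinAt_right hst) fun t' _ => h.occTime_mem s t'

theorem IsOccupation.chain_left (h : IsOccupation γ) (hG : DifferentiableOn ℝ G (Set.Ici 0))
    {s t : ℝ} (hst : s < t) :
    HasDerivWithinAt (fun s' => G (occTime γ s' t))
      (-fderivWithin ℝ G (Set.Ici 0) (occTime γ s t) (γ s)) (Set.Ici s) s := by
  have := ((hG _ (h.occTime_mem s t)).hasFDerivWithinAt).comp_hasDerivWithinAt s
    (h.hasDerivWithinAt_left hst) fun s' _ => h.occTime_mem s' t
  rwa [map_neg] at this

end Chain

/-- Continuous linear functionals applied to the occupation density are integrable. -/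
theorem IsOccupation.intervalIntegrable_apply (h : IsOccupation γ) {D : ℝ → (ι → ℝ) →L[ℝ] ℝ}
    {a b : ℝ} (hab : a ≤ b) (hD : ContinuousOn D (Set.Icc a b)) :
    IntervalIntegrable (fun r => D r (γ r)) volume a b := by
  classical
  have h1 : (fun r => D r (γ r)) = ∑ i, fun r => γ r i * D r (Pi.single i 1) := by
    funext r
    rw [Finset.sum_apply]
    conv_lhs => rw [pi_eq_sum_univ' (γ r), map_sum]
    refine Finset.sum_congr rfl fun i _ => ?_
    rw [map_smul, smul_eq_mul]
  rw [h1]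
  refine IntervalIntegrable.sum _ fun i _ => ?_
  have h2 : IntervalIntegrable (fun r => γ r i) volume a b := by
    rw [intervalIntegrable_iff_integrableOn_Icc_of_le hab]
    exact (h.integrableOn a b).eval i
  refine h2.mul_continuousOn ?_
  rw [Set.uIcc_of_le hab]
  exact hD.clm_apply continuousOn_const

theorem IsOccupation.ftc_right (h : IsOccupation γ) {G : (ι → ℝ) → ℝ}
    (hG : ContDiffOn ℝ 1 G (Set.Ici 0)) {s a b : ℝ} (hsa : s ≤ a) (hab : a ≤ b) :
    ∫ t in a..b, fderivWithin ℝ G (Set.Ici 0) (occTime γ s t) (γ t) =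
      G (occTime γ s b) - G (occTime γ s a) := by
  have hc : ContinuousOn (fun t => occTime γ s t) (Set.Icc a b) :=
    (h.continuousOn_right s).mono fun t ht => hsa.trans ht.1
  have hmaps : Set.MapsTo (fun t => occTime γ s t) (Set.Icc a b) (Set.Ici 0) :=
    fun t _ => h.occTime_mem s t
  refine intervalIntegral.integral_eq_sub_of_hasDeriv_right_of_le hab
    (hG.continuousOn.comp hc hmaps) (fun t ht => ?_) ?_
  · exact (h.chain_right (hG.differentiableOn one_ne_zero) (hsa.trans ht.1.le)).mono
      Set.Ioi_subset_Ici_self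
  · exact h.intervalIntegrable_apply hab
      ((hG.continuousOn_fderivWithin uniqueDiffOn_orthant le_rfl).comp hc hmaps)

theorem IsOccupation.ftc_left (h : IsOccupation γ) {G : (ι → ℝ) → ℝ}
    (hG : ContDiffOn ℝ 1 G (Set.Ici 0)) {a b t : ℝ} (hab : a ≤ b) (hbt : b ≤ t) :
    ∫ s in a..b, fderivWithin ℝ G (Set.Ici 0) (occTime γ s t) (γ s) =
      G (occTime γ a t) - G (occTime γ b t) := by
  have hc : ContinuousOn (fun s => occTime γ s t) (Set.Icc a b) :=
    (h.continuousOn_left t).mono fun s hs => hs.2.trans hbt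
  have hmaps : Set.MapsTo (fun s => occTime γ s t) (Set.Icc a b) (Set.Ici 0) :=
    fun s _ => h.occTime_mem s t
  have hi : IntervalIntegrable
      (fun s => fderivWithin ℝ G (Set.Ici 0) (occTime γ s t) (γ s)) volume a b :=
    h.intervalIntegrable_apply hab
      ((hG.continuousOn_fderivWithin uniqueDiffOn_orthant le_rfl).comp hc hmaps)
  have h1 := intervalIntegral.integral_eq_sub_of_hasDeriv_right_of_le hab
    (hG.continuousOn.comp hc hmaps) (fun s hs => ?_) hi.neg
  · have h2 := intervalIntegral.integral_neg (μ := volume) (a := a) (b := b)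
      (f := fun s => fderivWithin ℝ G (Set.Ici 0) (occTime γ s t) (γ s))
    simp only [Pi.neg_apply, Function.comp_apply] at h1
    linarith
  · exact (h.chain_left (hG.differentiableOn one_ne_zero) (hs.2.trans_le hbt)).mono
      Set.Ioi_subset_Ici_self

variable {Z : (ι → ℝ) → ℝ}

theorem contDiffOn_log (hpos : ∀ τ ∈ Set.Ici (0 : ι → ℝ), 0 < Z τ)
    (hZ : ContDiffOn ℝ 2 Z (Set.Ici 0)) :
    ContDiffOn ℝ 2 (fun τ => Real.log (Z τ)) (Set.Ici 0) :=
  hZ.log fun τ hτ => (hpos τ hτ).ne'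

theorem contDiffOn_logD (hpos : ∀ τ ∈ Set.Ici (0 : ι → ℝ), 0 < Z τ)
    (hZ : ContDiffOn ℝ 2 Z (Set.Ici 0)) : ContDiffOn ℝ 1 (logD Z) (Set.Ici 0) :=
  (contDiffOn_log hpos hZ).fderivWithin uniqueDiffOn_orthant (by norm_num)

theorem continuousOn_logD2 (hpos : ∀ τ ∈ Set.Ici (0 : ι → ℝ), 0 < Z τ)
    (hZ : ContDiffOn ℝ 2 Z (Set.Ici 0)) : ContinuousOn (logD2 Z) (Set.Ici 0) :=
  (contDiffOn_logD hpos hZ).continuousOn_fderivWithin uniqueDiffOn_orthant le_rfl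

theorem logD2_symm (hpos : ∀ τ ∈ Set.Ici (0 : ι → ℝ), 0 < Z τ)
    (hZ : ContDiffOn ℝ 2 Z (Set.Ici 0)) {τ : ι → ℝ} (hτ : τ ∈ Set.Ici (0 : ι → ℝ)) (u v : ι → ℝ) :
    logD2 Z τ u v = logD2 Z τ v u :=
  ((contDiffOn_log hpos hZ) τ hτ).isSymmSndFDerivWithinAt (by simp) uniqueDiffOn_orthant
    (orthant_subset_closure_interior hτ) hτ u v

theorem fderivWithin_logD_apply (hpos : ∀ τ ∈ Set.Ici (0 : ι → ℝ), 0 < Z τ)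
    (hZ : ContDiffOn ℝ 2 Z (Set.Ici 0)) {τ : ι → ℝ} (hτ : τ ∈ Set.Ici (0 : ι → ℝ)) (u v : ι → ℝ) :
    fderivWithin ℝ (fun τ => logD Z τ v) (Set.Ici 0) τ u = logD2 Z τ u v := by
  have h1 := ((contDiffOn_logD hpos hZ).differentiableOn one_ne_zero τ hτ).hasFDerivWithinAt
  have h2 := (h1.clm_apply (hasFDerivWithinAt_const v τ (Set.Ici 0))).fderivWithin
    (uniqueDiffOn_orthant τ hτ)
  rw [h2]
  simp [logD2]

theorem contDiffOn_logD_apply (hpos : ∀ τ ∈ Set.Ici (0 : ι → ℝ), 0 < Z τ)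
    (hZ : ContDiffOn ℝ 2 Z (Set.Ici 0)) (v : ι → ℝ) :
    ContDiffOn ℝ 1 (fun τ => logD Z τ v) (Set.Ici 0) :=
  (contDiffOn_logD hpos hZ).clm_apply contDiffOn_const

theorem fderivWithin_eq_mul_logD (hpos : ∀ τ ∈ Set.Ici (0 : ι → ℝ), 0 < Z τ)
    (hZ : ContDiffOn ℝ 2 Z (Set.Ici 0)) {τ : ι → ℝ} (hτ : τ ∈ Set.Ici (0 : ι → ℝ)) (u : ι → ℝ) :
    fderivWithin ℝ Z (Set.Ici 0) τ u = Z τ * logD Z τ u := by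
  have h1 := (hZ.differentiableOn two_ne_zero τ hτ).hasFDerivWithinAt
  have h2 := (h1.log (hpos τ hτ).ne').fderivWithin (uniqueDiffOn_orthant τ hτ)
  rw [logD, h2]
  simp [(hpos τ hτ).ne']

theorem log_occInter (hpos : ∀ τ ∈ Set.Ici (0 : ι → ℝ), 0 < Z τ) (h : IsOccupation γ) (s t : ℝ) :
    Real.log (occInter Z γ s t) = Real.log (Z (occTime γ s t)) - Real.log (Z 0) :=
  Real.log_div (hpos _ (h.occTime_mem s t)).ne' (hpos 0 Set.self_mem_Ici).ne'

theorem occInter_pos (hpos : ∀ τ ∈ Set.Ici (0 : ι → ℝ), 0 < Z τ) (h : IsOccupation γ) (s t : ℝ) :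
    0 < occInter Z γ s t := div_pos (hpos _ (h.occTime_mem s t)) (hpos 0 Set.self_mem_Ici)

theorem occInter_self (hpos : ∀ τ ∈ Set.Ici (0 : ι → ℝ), 0 < Z τ) (s : ℝ) :
    occInter Z γ s s = 1 := by
  rw [occInter, occTime_self, div_self (hpos 0 Set.self_mem_Ici).ne']

variable (hpos : ∀ τ ∈ Set.Ici (0 : ι → ℝ), 0 < Z τ) (hZ : ContDiffOn ℝ 2 Z (Set.Ici 0))
  (h : IsOccupation γ)

include hpos hZ h

theorem hasDerivWithinAt_log_right {s t : ℝ} (hst : s ≤ t) :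
    HasDerivWithinAt (fun t' => Real.log (occInter Z γ s t')) (logD Z (occTime γ s t) (γ t))
      (Set.Ici t) t := by
  simp only [log_occInter hpos h]
  exact (h.chain_right ((contDiffOn_log hpos hZ).differentiableOn two_ne_zero) hst).sub_const _

theorem hasDerivWithinAt_log_left {s t : ℝ} (hst : s < t) :
    HasDerivWithinAt (fun s' => Real.log (occInter Z γ s' t)) (-logD Z (occTime γ s t) (γ s))
      (Set.Ici s) s := by
  simp only [log_occInter hpos h]
  exact (h.chain_left ((contDiffOn_log hpos hZ).differentiableOn two_ne_zero) hst).sub_const _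

theorem vertexPoint_occInter (s : ℝ) : vertexPoint (occInter Z γ) s = logD Z 0 (γ s) := by
  unfold vertexPoint
  rw [neg_eq_iff_eq_neg]
  refine Tendsto.limUnder_eq ?_
  have h1 : Tendsto (fun t => -logD Z (occTime γ s t) (γ s)) (𝓝[>] s) (𝓝 (-logD Z 0 (γ s))) := by
    have h2 : ContinuousOn (fun t => logD Z (occTime γ s t) (γ s)) (Set.Ici s) :=
      (contDiffOn_logD_apply hpos hZ (γ s)).continuousOn.comp (h.continuousOn_right s)
        fun t _ => h.occTime_mem s t
    have h3 := (h2 s Set.self_mem_Ici).mono Set.Ioi_subset_Ici_self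
    have h4 := h3.tendsto.neg
    rwa [occTime_self] at h4
  refine h1.congr' ?_
  filter_upwards [self_mem_nhdsWithin] with t ht
  exact ((hasDerivWithinAt_log_left hpos hZ h ht).derivWithin
    (uniqueDiffOn_Ici s s Set.self_mem_Ici)).symm

theorem vertexPair_occInter {s t : ℝ} (hst : s < t) :
    vertexPair (occInter Z γ) s t = pairRate Z γ s t := by
  unfold vertexPair
  rw [neg_eq_iff_eq_neg]
  have h1 : (fun s' => derivWithin (fun t' => Real.log (occInter Z γ s' t')) (Set.Ici t) t)
      =ᶠ[𝓝[≥] s] fun s' => logD Z (occTime γ s' t) (γ t) := by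
    have : ∀ᶠ s' in 𝓝[≥] s, s' < t := nhdsWithin_le_nhds (gt_mem_nhds hst)
    filter_upwards [this] with s' hs'
    exact (hasDerivWithinAt_log_right hpos hZ h hs'.le).derivWithin
      (uniqueDiffOn_Ici t t Set.self_mem_Ici)
  rw [h1.derivWithin_eq (h1.self_of_nhdsWithin Set.self_mem_Ici)]
  have h2 := h.chain_left ((contDiffOn_logD_apply hpos hZ (γ t)).differentiableOn one_ne_zero) hst
  rw [h2.derivWithin (uniqueDiffOn_Ici s s Set.self_mem_Ici),
    fderivWithin_logD_apply hpos hZ (h.occTime_mem s t), pairRate]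

/-- The fundamental theorem of calculus for `Y_{s,l}` in the left endpoint. -/
theorem occInter_eq_one_add {s l : ℝ} (hsl : s ≤ l) :
    occInter Z γ s l =
      1 + ∫ r in s..l, logD Z (occTime γ r l) (γ r) * occInter Z γ r l := by
  have h1 := h.ftc_left (hZ.of_le one_le_two) hsl (le_refl l)
  have h2 : ∀ r, logD Z (occTime γ r l) (γ r) * occInter Z γ r l =
      fderivWithin ℝ Z (Set.Ici 0) (occTime γ r l) (γ r) / Z 0 := by
    intro r
    rw [fderivWithin_eq_mul_logD hpos hZ (h.occTime_mem r l), occInter]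
    ring
  simp only [h2]
  rw [intervalIntegral.integral_div, h1, occTime_self, sub_div,
    div_self (hpos 0 Set.self_mem_Ici).ne', occInter]
  ring

/-- The fundamental theorem of calculus in the right endpoint. It uses the symmetry of the second
derivative, as `pairRate` differentiates first in the direction of the site at the later time. -/
theorem logD_eq_add {s l : ℝ} (hsl : s ≤ l) :
    logD Z (occTime γ s l) (γ s) = logD Z 0 (γ s) + ∫ t in s..l, pairRate Z γ s t := by
  have h1 := h.ftc_right (contDiffOn_logD_apply hpos hZ (γ s)) (le_refl s) hsl
  have h2 : ∀ t, pairRate Z γ s t =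
      fderivWithin ℝ (fun τ => logD Z τ (γ s)) (Set.Ici 0) (occTime γ s t) (γ t) := by
    intro t
    rw [fderivWithin_logD_apply hpos hZ (h.occTime_mem s t), pairRate,
      logD2_symm hpos hZ (h.occTime_mem s t)]
  simp only [h2]
  rw [h1, occTime_self]
  ring

theorem integral_pairRate_left {a b t : ℝ} (hab : a ≤ b) (hbt : b ≤ t) :
    ∫ s in a..b, pairRate Z γ s t =
      logD Z (occTime γ a t) (γ t) - logD Z (occTime γ b t) (γ t) := by
  have h1 := h.ftc_left (contDiffOn_logD_apply hpos hZ (γ t)) hab hbt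
  have h2 : ∀ s, pairRate Z γ s t =
      fderivWithin ℝ (fun τ => logD Z τ (γ t)) (Set.Ici 0) (occTime γ s t) (γ s) := by
    intro s
    rw [fderivWithin_logD_apply hpos hZ (h.occTime_mem s t), pairRate]
  simp only [h2]
  exact h1

/-- The renewal rule of the expansion: either the interaction does not couple `[a,b]` to `[b,l]`, or
there is a pair `σ < b < t` that does. It is the fundamental theorem of calculus for
`t ↦ Y_{a,t} / Y_{b,t}`, whose logarithmic derivative is `∫_a^b r_{σ,t} dσ`. -/
theorem occInter_div_eq {a b l : ℝ} (hab : a ≤ b) (hbl : b ≤ l) :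
    occInter Z γ a l / occInter Z γ a b = occInter Z γ b l +
      ∫ t in b..l, ∫ s in a..b, pairRate Z γ s t * (occInter Z γ a t / occInter Z γ a b) *
        (occInter Z γ b l / occInter Z γ b t) := by
  have hY := fun s t => occInter_pos hpos h s t
  have hc : ∀ c ≤ b, ContinuousOn (fun t => Real.log (occInter Z γ c t)) (Set.Icc b l) := by
    intro c hc
    simp only [log_occInter hpos h]
    refine ContinuousOn.sub ?_ continuousOn_const
    exact (contDiffOn_log hpos hZ).continuousOn.comp
      ((h.continuousOn_right c).mono fun t ht => hc.trans ht.1) fun t _ => h.occTime_mem c t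
  have hD : ∀ c ≤ b, IntervalIntegrable (fun t => logD Z (occTime γ c t) (γ t)) volume b l := by
    intro c hc
    exact h.intervalIntegrable_apply hbl ((contDiffOn_logD hpos hZ).continuousOn.comp
      ((h.continuousOn_right c).mono fun t ht => hc.trans ht.1) fun t _ => h.occTime_mem c t)
  have hexp : ∀ t, Real.exp (Real.log (occInter Z γ a t) - Real.log (occInter Z γ b t)) =
      occInter Z γ a t / occInter Z γ b t := fun t => by
    rw [Real.exp_sub, Real.exp_log (hY _ _), Real.exp_log (hY _ _)]
  have key := intervalIntegral.integral_eq_sub_of_hasDeriv_right_of_le hbl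
    (f := fun t => Real.exp (Real.log (occInter Z γ a t) - Real.log (occInter Z γ b t)))
    (f' := fun t => Real.exp (Real.log (occInter Z γ a t) - Real.log (occInter Z γ b t)) *
      (logD Z (occTime γ a t) (γ t) - logD Z (occTime γ b t) (γ t)))
    (Real.continuous_exp.comp_continuousOn ((hc a hab).sub (hc b le_rfl)))
    (fun t ht => (((hasDerivWithinAt_log_right hpos hZ h (hab.trans ht.1.le)).sub
      (hasDerivWithinAt_log_right hpos hZ h ht.1.le)).exp).mono Set.Ioi_subset_Ici_self)
    (((hD a hab).sub (hD b le_rfl)).continuousOn_mul (by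
      rw [Set.uIcc_of_le hbl]
      exact Real.continuous_exp.comp_continuousOn ((hc a hab).sub (hc b le_rfl))))
  rw [hexp b, occInter_self hpos b, div_one] at key
  simp only [hexp] at key
  have hcongr : ∫ t in b..l, ∫ s in a..b, pairRate Z γ s t *
        (occInter Z γ a t / occInter Z γ a b) * (occInter Z γ b l / occInter Z γ b t) =
      ∫ t in b..l, (occInter Z γ b l / occInter Z γ a b) * (occInter Z γ a t / occInter Z γ b t *
        (logD Z (occTime γ a t) (γ t) - logD Z (occTime γ b t) (γ t))) := by
    refine intervalIntegral.integral_congr fun t ht => ?_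
    rw [Set.uIcc_of_le hbl] at ht
    simp only [mul_assoc]
    rw [intervalIntegral.integral_mul_const, integral_pairRate_left hpos hZ h hab ht.1]
    have := (hY b t).ne'
    have := (hY a b).ne'
    field_simp
  rw [hcongr, intervalIntegral.integral_const_mul, key]
  have h1 := (hY a b).ne'
  have h2 := (hY b l).ne'
  field_simp
  ring

/-- The local times up to time `l` stay in a compact part of the orthant. -/
theorem exists_bounds_of_le (l : ℝ) (hl : 0 ≤ l) : ∃ C : ℝ, 1 ≤ C ∧ ∀ s t, t - s ≤ l →
    |pairRate Z γ s t| ≤ C ∧ |logD Z (occTime γ s t) (γ s)| ≤ C ∧ occInter Z γ s t ≤ C ∧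
      (occInter Z γ s t)⁻¹ ≤ C := by
  have hK : IsCompact (Set.Icc (0 : ι → ℝ) fun _ => l) := isCompact_Icc
  have hsub : Set.Icc (0 : ι → ℝ) (fun _ => l) ⊆ Set.Ici 0 := Set.Icc_subset_Ici_self
  obtain ⟨C1, h1⟩ := hK.exists_bound_of_continuousOn
    (E := (ι → ℝ) →L[ℝ] (ι → ℝ) →L[ℝ] ℝ) ((continuousOn_logD2 hpos hZ).mono hsub)
  obtain ⟨C2, h2⟩ := hK.exists_bound_of_continuousOn
    ((contDiffOn_logD hpos hZ).continuousOn.mono hsub)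
  obtain ⟨C3, h3⟩ := hK.exists_bound_of_continuousOn
    ((hZ.continuousOn.div_const (Z 0)).mono hsub)
  obtain ⟨C4, h4⟩ := hK.exists_bound_of_continuousOn
    (((hZ.continuousOn.div_const (Z 0)).inv₀ fun τ hτ =>
      (div_pos (hpos τ hτ) (hpos 0 Set.self_mem_Ici)).ne').mono hsub)
  refine ⟨max 1 (max (max C1 C2) (max C3 C4)), le_max_left _ _, fun s t hst => ?_⟩
  have hmem : occTime γ s t ∈ Set.Icc (0 : ι → ℝ) fun _ => l :=
    ⟨h.occTime_mem s t, h.occTime_le hl hst⟩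
  have hs := h.norm_le s
  have ht := h.norm_le t
  refine ⟨?_, ?_, ?_, ?_⟩
  · have : |pairRate Z γ s t| ≤ ‖logD2 Z (occTime γ s t)‖ * ‖γ s‖ * ‖γ t‖ :=
      (logD2 Z (occTime γ s t)).le_opNorm₂ _ _
    have h5 : ‖logD2 Z (occTime γ s t)‖ * ‖γ s‖ * ‖γ t‖ ≤ C1 := by
      calc _ ≤ ‖logD2 Z (occTime γ s t)‖ * 1 * 1 := by gcongr
        _ ≤ C1 := by simpa using h1 _ hmem
    refine this.trans (h5.trans ?_)
    simp
  · have : |logD Z (occTime γ s t) (γ s)| ≤ ‖logD Z (occTime γ s t)‖ * ‖γ s‖ :=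
      (logD Z (occTime γ s t)).le_opNorm _
    have h5 : ‖logD Z (occTime γ s t)‖ * ‖γ s‖ ≤ C2 := by
      calc _ ≤ ‖logD Z (occTime γ s t)‖ * 1 := by gcongr
        _ ≤ C2 := by simpa using h2 _ hmem
    refine this.trans (h5.trans ?_)
    simp
  · refine (le_abs_self _).trans ((h3 _ hmem).trans ?_)
    simp
  · refine (le_abs_self _).trans ((h4 _ hmem).trans ?_)
    simp

end Calculus

end

/-! ### Extending a lace by one interval -/

section

/-- The `j`-th endpoint, in increasing order, of the lace with free coordinates `u` and `s₀ = 0`;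
the last endpoint is number `2 k + 1`, and larger indices return it. -/
def lacePt {k : ℕ} (u : Fin (2 * k + 1) → ℝ) (j : ℕ) : ℝ :=
  (Fin.cons 0 u : Fin (2 * k + 1 + 1) → ℝ) ⟨min j (2 * k + 1), by omega⟩

theorem lacePt_zero {k : ℕ} (u : Fin (2 * k + 1) → ℝ) : lacePt u 0 = 0 := by
  simp [lacePt]

theorem lacePt_succ {k : ℕ} (u : Fin (2 * k + 1) → ℝ) {j : ℕ} (hj : j < 2 * k + 1) :
    lacePt u (j + 1) = u ⟨j, hj⟩ := by
  have h : (⟨min (j + 1) (2 * k + 1), by omega⟩ : Fin (2 * k + 1 + 1)) = Fin.succ ⟨j, hj⟩ :=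
    Fin.ext (by simp; omega)
  rw [lacePt, h, Fin.cons_succ]

theorem lacePt_of_ge {k : ℕ} (u : Fin (2 * k + 1) → ℝ) {j : ℕ} (hj : 2 * k + 1 ≤ j) :
    lacePt u j = lacePt u (2 * k + 1) := by
  unfold lacePt
  congr 2
  omega

theorem rightPt_cons {k : ℕ} (u : Fin (2 * k + 1) → ℝ) (i : ℕ) :
    rightPt (Fin.cons 0 u) i = lacePt u (2 * i) := rfl

theorem measurable_lacePt {k : ℕ} (j : ℕ) :
    Measurable fun u : Fin (2 * k + 1) → ℝ => lacePt u j := by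
  rcases j with _ | j
  · simp only [lacePt_zero]
    exact measurable_const
  · rcases lt_or_ge j (2 * k + 1) with h | h
    · simp only [lacePt_succ _ h]
      exact measurable_pi_apply _
    · have : ∀ u : Fin (2 * k + 1) → ℝ, lacePt u (j + 1) = u ⟨2 * k, by omega⟩ := fun u => by
        rw [lacePt_of_ge u (by omega), lacePt_succ u (by omega)]
      simp only [this]
      exact measurable_pi_apply _

theorem mem_laceSlice_iff {k : ℕ} (u : Fin (2 * k + 1) → ℝ) :
    u ∈ laceSlice k 0 ↔ ∀ j < 2 * k + 1, lacePt u j < lacePt u (j + 1) := by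
  have h1 : u ∈ laceSlice k 0 ↔ StrictMono (Fin.cons 0 u : Fin (2 * k + 1 + 1) → ℝ) :=
    ⟨fun h => h.2, fun h => ⟨by simp, h⟩⟩
  rw [h1, Fin.strictMono_iff_lt_succ]
  have h2 : ∀ (j : ℕ) (hj : j < 2 * k + 1), lacePt u j =
      (Fin.cons 0 u : Fin (2 * k + 1 + 1) → ℝ) (Fin.castSucc ⟨j, hj⟩) := fun j hj => by
    unfold lacePt
    congr 1
    exact Fin.ext (by simp; omega)
  have h3 : ∀ (j : ℕ) (hj : j < 2 * k + 1), lacePt u (j + 1) =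
      (Fin.cons 0 u : Fin (2 * k + 1 + 1) → ℝ) (Fin.succ ⟨j, hj⟩) := fun j hj => by
    unfold lacePt
    congr 1
    exact Fin.ext (by simp; omega)
  constructor
  · intro h j hj
    rw [h2 j hj, h3 j hj]
    exact h _
  · intro h j
    have := h j j.2
    rwa [h2 j j.2, h3 j j.2] at this

theorem lacePt_monotone {k : ℕ} {u : Fin (2 * k + 1) → ℝ} (hu : u ∈ laceSlice k 0) {i j : ℕ}
    (hij : i ≤ j) : lacePt u i ≤ lacePt u j := by
  refine hu.2.monotone (Fin.mk_le_mk.2 ?_)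
  omega

theorem lacePt_nonneg {k : ℕ} {u : Fin (2 * k + 1) → ℝ} (hu : u ∈ laceSlice k 0) (j : ℕ) :
    0 ≤ lacePt u j := by
  rw [← lacePt_zero u]
  exact lacePt_monotone hu (Nat.zero_le j)

theorem measurableSet_laceSlice (k : ℕ) : MeasurableSet (laceSlice k 0) := by
  have : laceSlice k 0 = ⋂ j ∈ Finset.range (2 * k + 1),
      {u : Fin (2 * k + 1) → ℝ | lacePt u j < lacePt u (j + 1)} := by
    ext u
    simp [mem_laceSlice_iff]
  rw [this]
  exact MeasurableSet.biInter (Finset.countable_toSet _) fun j _ =>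
    measurableSet_lt (measurable_lacePt j) (measurable_lacePt (j + 1))

/-- Laces starting at `0` and ending before `l`. -/
def boundedSlice (k : ℕ) (l : ℝ) : Set (Fin (2 * k + 1) → ℝ) :=
  laceSlice k 0 ∩ {u | lacePt u (2 * k + 1) ≤ l}

theorem measurableSet_boundedSlice (k : ℕ) (l : ℝ) : MeasurableSet (boundedSlice k l) :=
  (measurableSet_laceSlice k).inter (measurableSet_le (measurable_lacePt _) measurable_const)

/-- The coordinates of the lace obtained by adding an interval `(σ, t)`: the new left endpoint `σ`
comes just before the last endpoint of the lace `u`, and `t` is the new last endpoint. -/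
def laceInsertEquiv (k : ℕ) :
    (ℝ × ℝ × (Fin (2 * k + 1) → ℝ)) ≃ᵐ (Fin (2 * (k + 1) + 1) → ℝ) :=
  ((MeasurableEquiv.refl ℝ).prodCongr
      (MeasurableEquiv.piFinSuccAbove (fun _ : Fin (2 * k + 1 + 1) => ℝ) (Fin.last _)).symm).trans
    (MeasurableEquiv.piFinSuccAbove (fun _ : Fin (2 * k + 1 + 1 + 1) => ℝ)
      ⟨2 * k, by omega⟩).symm

theorem measurePreserving_laceInsertEquiv (k : ℕ) :
    MeasurePreserving (laceInsertEquiv k) :=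
  (((MeasurePreserving.id volume).prod
      (volume_preserving_piFinSuccAbove (fun _ : Fin (2 * k + 1 + 1) => ℝ) (Fin.last _)).symm)).trans
    (volume_preserving_piFinSuccAbove (fun _ : Fin (2 * k + 1 + 1 + 1) => ℝ)
      ⟨2 * k, by omega⟩).symm

/-- The lace `u` with the interval `(σ, t)` added. -/
def laceInsert {k : ℕ} (u : Fin (2 * k + 1) → ℝ) (σ t : ℝ) : Fin (2 * (k + 1) + 1) → ℝ :=
  laceInsertEquiv k (σ, t, u)

theorem laceInsert_eq {k : ℕ} (u : Fin (2 * k + 1) → ℝ) (σ t : ℝ) :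
    laceInsert u σ t = Fin.insertNth (α := fun _ : Fin (2 * k + 1 + 1 + 1) => ℝ)
      ⟨2 * k, by omega⟩ σ (Fin.insertNth (α := fun _ : Fin (2 * k + 1 + 1) => ℝ)
        (Fin.last _) t u) := rfl

theorem laceInsert_lt {k : ℕ} (u : Fin (2 * k + 1) → ℝ) (σ t : ℝ) {j : ℕ} (hj : j < 2 * k) :
    laceInsert u σ t ⟨j, by omega⟩ = u ⟨j, by omega⟩ := by
  have h1 : (⟨j, by omega⟩ : Fin (2 * k + 1 + 1 + 1)) =
      (⟨2 * k, by omega⟩ : Fin (2 * k + 1 + 1 + 1)).succAbove ⟨j, by omega⟩ := by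
    rw [Fin.succAbove_of_castSucc_lt _ _ (by simpa [Fin.lt_def] using hj)]
    rfl
  have h2 : (⟨j, by omega⟩ : Fin (2 * k + 1 + 1)) =
      (Fin.last (2 * k + 1)).succAbove ⟨j, by omega⟩ := by
    rw [Fin.succAbove_last]
    rfl
  rw [laceInsert_eq]
  refine Eq.trans (congrArg _ h1) ?_
  rw [Fin.insertNth_apply_succAbove]
  refine Eq.trans (congrArg _ h2) ?_
  rw [Fin.insertNth_apply_succAbove]

theorem laceInsert_mid {k : ℕ} (u : Fin (2 * k + 1) → ℝ) (σ t : ℝ) :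
    laceInsert u σ t ⟨2 * k, by omega⟩ = σ := by
  rw [laceInsert_eq]
  exact Fin.insertNth_apply_same _ _ _

theorem laceInsert_penultimate {k : ℕ} (u : Fin (2 * k + 1) → ℝ) (σ t : ℝ) :
    laceInsert u σ t ⟨2 * k + 1, by omega⟩ = u ⟨2 * k, by omega⟩ := by
  have h1 : (⟨2 * k + 1, by omega⟩ : Fin (2 * k + 1 + 1 + 1)) =
      (⟨2 * k, by omega⟩ : Fin (2 * k + 1 + 1 + 1)).succAbove ⟨2 * k, by omega⟩ := by
    rw [Fin.succAbove_of_le_castSucc _ _ (by simp)]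
    rfl
  have h2 : (⟨2 * k, by omega⟩ : Fin (2 * k + 1 + 1)) =
      (Fin.last (2 * k + 1)).succAbove ⟨2 * k, by omega⟩ := by
    rw [Fin.succAbove_last]
    rfl
  rw [laceInsert_eq]
  refine Eq.trans (congrArg _ h1) ?_
  rw [Fin.insertNth_apply_succAbove]
  refine Eq.trans (congrArg _ h2) ?_
  rw [Fin.insertNth_apply_succAbove]

theorem laceInsert_last {k : ℕ} (u : Fin (2 * k + 1) → ℝ) (σ t : ℝ) :
    laceInsert u σ t ⟨2 * k + 1 + 1, by omega⟩ = t := by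
  have h1 : (⟨2 * k + 1 + 1, by omega⟩ : Fin (2 * k + 1 + 1 + 1)) =
      (⟨2 * k, by omega⟩ : Fin (2 * k + 1 + 1 + 1)).succAbove (Fin.last _) := by
    rw [Fin.succAbove_of_le_castSucc _ _ (by simp [Fin.le_def])]
    rfl
  rw [laceInsert_eq]
  refine Eq.trans (congrArg _ h1) ?_
  rw [Fin.insertNth_apply_succAbove]
  exact Fin.insertNth_apply_same _ _ _

theorem lacePt_laceInsert_le {k : ℕ} (u : Fin (2 * k + 1) → ℝ) (σ t : ℝ) {j : ℕ}
    (hj : j ≤ 2 * k) : lacePt (laceInsert u σ t) j = lacePt u j := by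
  rcases j with _ | j
  · rw [lacePt_zero, lacePt_zero]
  · rw [lacePt_succ _ (by omega), lacePt_succ _ (by omega), laceInsert_lt u σ t (by omega)]

theorem lacePt_laceInsert_mid {k : ℕ} (u : Fin (2 * k + 1) → ℝ) (σ t : ℝ) :
    lacePt (laceInsert u σ t) (2 * k + 1) = σ := by
  rw [lacePt_succ _ (by omega), laceInsert_mid]

theorem lacePt_laceInsert_penultimate {k : ℕ} (u : Fin (2 * k + 1) → ℝ) (σ t : ℝ) :
    lacePt (laceInsert u σ t) (2 * k + 2) = lacePt u (2 * k + 1) := by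
  rw [lacePt_succ _ (by omega), lacePt_succ _ (by omega), laceInsert_penultimate]

theorem lacePt_laceInsert_last {k : ℕ} (u : Fin (2 * k + 1) → ℝ) (σ t : ℝ) {j : ℕ}
    (hj : 2 * k + 3 ≤ j) : lacePt (laceInsert u σ t) j = t := by
  rw [lacePt_of_ge _ (by omega : 2 * (k + 1) + 1 ≤ j)]
  exact (lacePt_succ _ (by omega : 2 * (k + 1) < 2 * (k + 1) + 1)).trans (laceInsert_last u σ t)

theorem lacePt_laceInsert_even {k : ℕ} (u : Fin (2 * k + 1) → ℝ) (σ t : ℝ) {i : ℕ}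
    (hi : i ≤ k + 1) : lacePt (laceInsert u σ t) (2 * i) = lacePt u (2 * i) := by
  rcases hi.eq_or_lt with rfl | hi
  · rw [lacePt_of_ge u (by omega : 2 * k + 1 ≤ 2 * (k + 1))]
    exact lacePt_laceInsert_penultimate u σ t
  · exact lacePt_laceInsert_le u σ t (by omega)

/-- The new interval has to start between the ends of the last two intervals of the lace (between
`0` and the end of the lace, if it has one interval only), and to end after the lace. -/
theorem laceInsert_mem_boundedSlice {k : ℕ} (u : Fin (2 * k + 1) → ℝ) (σ t l : ℝ) :
    laceInsert u σ t ∈ boundedSlice (k + 1) l ↔ u ∈ boundedSlice k l ∧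
      t ∈ Set.Ioc (lacePt u (2 * k + 1)) l ∧
      σ ∈ Set.Ioo (lacePt u (2 * k)) (lacePt u (2 * k + 1)) := by
  have e0 := @lacePt_laceInsert_le k u σ t
  have e1 := lacePt_laceInsert_mid u σ t
  have e2 := lacePt_laceInsert_penultimate u σ t
  have e3 : lacePt (laceInsert u σ t) (2 * k + 2 + 1) = t :=
    lacePt_laceInsert_last u σ t (by omega)
  have e4 : lacePt (laceInsert u σ t) (2 * (k + 1) + 1) = t := e3
  simp only [boundedSlice, Set.mem_inter_iff, mem_laceSlice_iff, Set.mem_ofPred_eq, Set.mem_Ioc,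
    Set.mem_Ioo, e4]
  constructor
  · rintro ⟨h, hl⟩
    have a1 := h (2 * k) (by omega)
    have a2 := h (2 * k + 1) (by omega)
    have a3 := h (2 * k + 2) (by omega)
    rw [e0 le_rfl, e1] at a1
    rw [e1, e2] at a2
    rw [e2, e3] at a3
    refine ⟨⟨fun j hj => ?_, a3.le.trans hl⟩, ⟨a3, hl⟩, a1, a2⟩
    rcases (Nat.lt_succ_iff.1 hj).eq_or_lt with rfl | hj'
    · exact a1.trans a2
    · have := h j (by omega)
      rwa [e0 (by omega), e0 (by omega)] at this
  · rintro ⟨⟨h, _⟩, ⟨h2, h3⟩, h4, h5⟩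
    refine ⟨fun j hj => ?_, h3⟩
    have hj' : j < 2 * k ∨ j = 2 * k ∨ j = 2 * k + 1 ∨ j = 2 * k + 2 := by omega
    rcases hj' with hj' | rfl | rfl | rfl
    · rw [e0 (by omega), e0 (by omega)]
      exact h j (by omega)
    · rw [e0 le_rfl, e1]; exact h4
    · rw [e1, e2]; exact h5
    · rw [e2, e3]; exact h2

theorem indicator_boundedSlice_laceInsert {β : Type*} [Zero β] {k : ℕ} (l : ℝ)
    (F : (Fin (2 * (k + 1) + 1) → ℝ) → β) (u : Fin (2 * k + 1) → ℝ) (σ t : ℝ) :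
    (boundedSlice (k + 1) l).indicator F (laceInsert u σ t) =
      (boundedSlice k l).indicator (fun u => (Set.Ioc (lacePt u (2 * k + 1)) l).indicator
        (fun t => (Set.Ioo (lacePt u (2 * k)) (lacePt u (2 * k + 1))).indicator
          (fun σ => F (laceInsert u σ t)) σ) t) u := by
  classical
  have h := laceInsert_mem_boundedSlice u σ t l
  simp only [Set.indicator_apply]
  by_cases h1 : u ∈ boundedSlice k l <;> by_cases h2 : t ∈ Set.Ioc (lacePt u (2 * k + 1)) l <;>
    by_cases h3 : σ ∈ Set.Ioo (lacePt u (2 * k)) (lacePt u (2 * k + 1)) <;>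
    simp only [h1, h2, h3, and_true, and_false, iff_true, iff_false] at h <;>
    simp only [h, h1, h2, h3, if_true, if_false]

theorem lintegral_boundedSlice_succ {k : ℕ} (l : ℝ) {F : (Fin (2 * (k + 1) + 1) → ℝ) → ℝ≥0∞}
    (hF : Measurable F) :
    ∫⁻ v in boundedSlice (k + 1) l, F v = ∫⁻ u in boundedSlice k l,
      ∫⁻ t in Set.Ioc (lacePt u (2 * k + 1)) l,
        ∫⁻ σ in Set.Ioo (lacePt u (2 * k)) (lacePt u (2 * k + 1)), F (laceInsert u σ t) := by
  have hm : Measurable ((boundedSlice (k + 1) l).indicator F) :=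
    hF.indicator (measurableSet_boundedSlice _ l)
  have hm2 : Measurable fun p : ℝ × ℝ × (Fin (2 * k + 1) → ℝ) =>
      (boundedSlice (k + 1) l).indicator F (laceInsertEquiv k p) :=
    hm.comp (laceInsertEquiv k).measurable
  rw [← lintegral_indicator (measurableSet_boundedSlice _ l),
    ← (measurePreserving_laceInsertEquiv k).lintegral_comp hm, Measure.volume_eq_prod,
    lintegral_prod_symm _ hm2.aemeasurable, Measure.volume_eq_prod,
    lintegral_prod_symm _ (hm2.lintegral_prod_left').aemeasurable,
    ← lintegral_indicator (measurableSet_boundedSlice _ l)]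
  refine lintegral_congr fun u => ?_
  change ∫⁻ t, ∫⁻ σ, (boundedSlice (k + 1) l).indicator F (laceInsert u σ t) = _
  simp only [indicator_boundedSlice_laceInsert]
  by_cases hu : u ∈ boundedSlice k l
  · simp only [Set.indicator_of_mem hu]
    rw [← lintegral_indicator measurableSet_Ioc]
    refine lintegral_congr fun t => ?_
    by_cases ht : t ∈ Set.Ioc (lacePt u (2 * k + 1)) l
    · simp only [Set.indicator_of_mem ht]
      rw [← lintegral_indicator measurableSet_Ioo]
    · simp only [Set.indicator_of_notMem ht, lintegral_zero]
  · simp only [Set.indicator_of_notMem hu, lintegral_zero]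

theorem integral_boundedSlice_succ {k : ℕ} (l : ℝ) {F : (Fin (2 * (k + 1) + 1) → ℝ) → ℝ}
    (hF : IntegrableOn F (boundedSlice (k + 1) l)) :
    ∫ v in boundedSlice (k + 1) l, F v = ∫ u in boundedSlice k l,
      ∫ t in Set.Ioc (lacePt u (2 * k + 1)) l,
        ∫ σ in Set.Ioo (lacePt u (2 * k)) (lacePt u (2 * k + 1)), F (laceInsert u σ t) := by
  have hm : Integrable ((boundedSlice (k + 1) l).indicator F) :=
    hF.integrable_indicator (measurableSet_boundedSlice _ l)
  have hm2 : Integrable fun p : ℝ × ℝ × (Fin (2 * k + 1) → ℝ) =>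
      (boundedSlice (k + 1) l).indicator F (laceInsertEquiv k p) :=
    (measurePreserving_laceInsertEquiv k).integrable_comp_emb
      (laceInsertEquiv k).measurableEmbedding |>.2 hm
  rw [← integral_indicator (measurableSet_boundedSlice _ l),
    ← (measurePreserving_laceInsertEquiv k).integral_comp', Measure.volume_eq_prod]
  rw [Measure.volume_eq_prod] at hm2
  rw [integral_prod_symm _ hm2]
  have hm3 := hm2.integral_prod_right
  rw [Measure.volume_eq_prod] at hm3 ⊢
  rw [integral_prod_symm _ hm3, ← integral_indicator (measurableSet_boundedSlice _ l)]
  refine integral_congr_ae (Eventually.of_forall fun u => ?_)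
  change ∫ t, ∫ σ, (boundedSlice (k + 1) l).indicator F (laceInsert u σ t) = _
  simp only [indicator_boundedSlice_laceInsert]
  by_cases hu : u ∈ boundedSlice k l
  · simp only [Set.indicator_of_mem hu]
    rw [← integral_indicator measurableSet_Ioc]
    refine integral_congr_ae (Eventually.of_forall fun t => ?_)
    beta_reduce
    by_cases ht : t ∈ Set.Ioc (lacePt u (2 * k + 1)) l
    · simp only [Set.indicator_of_mem ht]
      rw [← integral_indicator measurableSet_Ioo]
    · simp only [Set.indicator_of_notMem ht, integral_zero]
  · simp only [Set.indicator_of_notMem hu, integral_zero]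

/-- The single coordinate of a lace with one interval. -/
def singleEquiv : ℝ ≃ᵐ (Fin (2 * 0 + 1) → ℝ) := (MeasurableEquiv.funUnique (Fin 1) ℝ).symm

theorem measurePreserving_single : MeasurePreserving singleEquiv :=
  (volume_preserving_funUnique (Fin 1) ℝ).symm

theorem lacePt_single (r : ℝ) {j : ℕ} (hj : 1 ≤ j) :
    lacePt (k := 0) (singleEquiv r) j = r := by
  rw [lacePt_of_ge _ (by omega), lacePt_succ _ (by omega)]
  rfl

theorem preimage_boundedSlice_zero (l : ℝ) :
    singleEquiv ⁻¹' boundedSlice 0 l = Set.Ioc 0 l := by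
  ext r
  simp only [Set.mem_preimage, boundedSlice, Set.mem_inter_iff, mem_laceSlice_iff,
    Set.mem_ofPred_eq, Set.mem_Ioc, lacePt_single r (j := 2 * 0 + 1) (by omega)]
  refine and_congr_left fun _ => ?_
  constructor
  · intro h
    have := h 0 (by omega)
    rwa [lacePt_zero, lacePt_single r (by omega)] at this
  · intro h j hj
    obtain rfl : j = 0 := by omega
    rwa [lacePt_zero, lacePt_single r (by omega)]

theorem lintegral_boundedSlice_zero (l : ℝ) {F : (Fin (2 * 0 + 1) → ℝ) → ℝ≥0∞} :
    ∫⁻ u in boundedSlice 0 l, F u =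
      ∫⁻ r in Set.Ioc 0 l, F (singleEquiv r) := by
  rw [← preimage_boundedSlice_zero,
    measurePreserving_single.setLIntegral_comp_preimage_emb (MeasurableEquiv.measurableEmbedding _)]

theorem integral_boundedSlice_zero (l : ℝ) {F : (Fin (2 * 0 + 1) → ℝ) → ℝ} :
    ∫ u in boundedSlice 0 l, F u =
      ∫ r in Set.Ioc 0 l, F (singleEquiv r) := by
  rw [← preimage_boundedSlice_zero,
    measurePreserving_single.setIntegral_preimage_emb (MeasurableEquiv.measurableEmbedding _)]

end

/-! ### The expansion in laces along a fixed path -/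

section

/-- The weight of a lace starting at `0`, for given pair vertices `r` and interaction `Y`. -/
def laceW (r Y : ℝ → ℝ → ℝ) {k : ℕ} (u : Fin (2 * k + 1) → ℝ) : ℝ :=
  (∏ i ∈ Finset.range (k + 1), r (lacePt u (2 * i - 1)) (lacePt u (2 * (i + 1)))) *
    (Y (lacePt u (2 * 0)) (lacePt u (2 * 1)) * ∏ i ∈ Finset.range k,
      Y (lacePt u (2 * i)) (lacePt u (2 * (i + 2))) / Y (lacePt u (2 * i)) (lacePt u (2 * (i + 1))))

theorem laceWeight_cons {r Y : ℝ → ℝ → ℝ} (h : ∀ s t, s < t → vertexPair Y s t = r s t) {k : ℕ}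
    {u : Fin (2 * k + 1) → ℝ} (hu : u ∈ laceSlice k 0) :
    laceWeight Y (Fin.cons 0 u : Fin (2 * k + 1 + 1) → ℝ) = laceW r Y u := by
  unfold laceWeight laceW laceVertex
  congr 1
  refine Finset.prod_congr rfl fun i hi => h _ _ (hu.2 (Fin.mk_lt_mk.2 ?_))
  have := Finset.mem_range.1 hi
  omega

/-- A new interval `(σ, t)` multiplies the weight of a lace by a factor that depends on the lace only
through its last two endpoints. -/
theorem laceW_laceInsert (r Y : ℝ → ℝ → ℝ) {k : ℕ} (u : Fin (2 * k + 1) → ℝ) (σ t : ℝ) :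
    laceW r Y (laceInsert u σ t) = laceW r Y u * (r σ t *
      (Y (lacePt u (2 * k)) t / Y (lacePt u (2 * k)) (lacePt u (2 * k + 1)))) := by
  unfold laceW
  have h1 : ∏ i ∈ Finset.range (k + 1), r (lacePt (laceInsert u σ t) (2 * i - 1))
        (lacePt (laceInsert u σ t) (2 * (i + 1))) =
      ∏ i ∈ Finset.range (k + 1), r (lacePt u (2 * i - 1)) (lacePt u (2 * (i + 1))) := by
    refine Finset.prod_congr rfl fun i hi => ?_
    have := Finset.mem_range.1 hi
    rw [lacePt_laceInsert_le u σ t (by omega), lacePt_laceInsert_even u σ t (by omega)]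
  have h2 : ∏ i ∈ Finset.range (k + 1), Y (lacePt (laceInsert u σ t) (2 * i))
        (lacePt (laceInsert u σ t) (2 * (i + 2))) /
          Y (lacePt (laceInsert u σ t) (2 * i)) (lacePt (laceInsert u σ t) (2 * (i + 1))) =
      (∏ i ∈ Finset.range k, Y (lacePt u (2 * i)) (lacePt u (2 * (i + 2))) /
        Y (lacePt u (2 * i)) (lacePt u (2 * (i + 1)))) *
        (Y (lacePt u (2 * k)) t / Y (lacePt u (2 * k)) (lacePt u (2 * k + 1))) := by
    rw [Finset.prod_range_succ]
    congr 1
    · refine Finset.prod_congr rfl fun i hi => ?_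
      have := Finset.mem_range.1 hi
      rw [lacePt_laceInsert_even u σ t (by omega), lacePt_laceInsert_even u σ t (by omega),
        lacePt_laceInsert_even u σ t (by omega)]
    · rw [lacePt_laceInsert_last u σ t (j := 2 * (k + 2)) (by omega),
        lacePt_laceInsert_even u σ t (by omega), lacePt_laceInsert_even u σ t (by omega),
        lacePt_of_ge u (j := 2 * (k + 1)) (by omega)]
  have e1 : lacePt (laceInsert u σ t) (2 * (k + 1) - 1) = σ := lacePt_laceInsert_mid u σ t
  rw [h2, Finset.prod_range_succ _ (k + 1), h1, e1,
    lacePt_laceInsert_last u σ t (j := 2 * (k + 1 + 1)) (by omega),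
    lacePt_laceInsert_even u σ t (i := 0) (by omega),
    lacePt_laceInsert_even u σ t (i := 1) (by omega)]
  ring

theorem measurable_laceW {α : Type*} [MeasurableSpace α] {r Y : α → ℝ → ℝ → ℝ}
    (hr : Measurable fun p : α × ℝ × ℝ => r p.1 p.2.1 p.2.2)
    (hY : Measurable fun p : α × ℝ × ℝ => Y p.1 p.2.1 p.2.2) (k : ℕ) :
    Measurable fun p : α × (Fin (2 * k + 1) → ℝ) => laceW (r p.1) (Y p.1) p.2 := by
  have hpt : ∀ i j, Measurable fun p : α × (Fin (2 * k + 1) → ℝ) =>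
      (p.1, lacePt p.2 i, lacePt p.2 j) := fun i j =>
    measurable_fst.prodMk (((measurable_lacePt i).comp measurable_snd).prodMk
      ((measurable_lacePt j).comp measurable_snd))
  have hY' : ∀ i j, Measurable fun p : α × (Fin (2 * k + 1) → ℝ) =>
      Y p.1 (lacePt p.2 i) (lacePt p.2 j) := fun i j => hY.comp (hpt i j)
  refine (Finset.measurable_prod _ fun i _ => hr.comp (hpt _ _)).mul
    ((hY' _ _).mul (Finset.measurable_prod _ fun i _ => ?_))
  exact (hY' (2 * i) (2 * (i + 2))).div (hY' (2 * i) (2 * (i + 1)))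

/-- The properties of the pair vertices `r` and the interaction `Y` on which the expansion along a
path up to time `l` rests: bounds, and the rule for splitting off the next interval of a lace. -/
structure IsLaceData (r Y : ℝ → ℝ → ℝ) (l C : ℝ) : Prop where
  measurable_vertex : Measurable fun p : ℝ × ℝ => r p.1 p.2
  measurable_inter : Measurable fun p : ℝ × ℝ => Y p.1 p.2
  time_nonneg : 0 ≤ l
  one_le : 1 ≤ C
  vertex_le : ∀ s t, 0 ≤ s → t ≤ l → |r s t| ≤ C
  inter_pos : ∀ s t, 0 < Y s t
  inter_le : ∀ s t, 0 ≤ s → t ≤ l → Y s t ≤ C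
  inv_inter_le : ∀ s t, 0 ≤ s → t ≤ l → (Y s t)⁻¹ ≤ C
  split : ∀ a b, 0 ≤ a → a ≤ b → b ≤ l → Y a l / Y a b = Y b l +
    ∫ t in b..l, ∫ s in a..b, r s t * (Y a t / Y a b) * (Y b l / Y b t)

variable {r Y : ℝ → ℝ → ℝ} {l C : ℝ}

theorem IsLaceData.measurable_laceW (h : IsLaceData r Y l C) (k : ℕ) :
    Measurable fun u : Fin (2 * k + 1) → ℝ => laceW r Y u :=
  (LaceExpansion.measurable_laceW (α := Unit) (r := fun _ => r) (Y := fun _ => Y)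
    (h.measurable_vertex.comp measurable_snd) (h.measurable_inter.comp measurable_snd) k).comp
    (measurable_const.prodMk measurable_id : Measurable fun u => ((), u))

theorem IsLaceData.div_le (h : IsLaceData r Y l C) {s s' t t' : ℝ} (hs : 0 ≤ s) (ht : t ≤ l)
    (hs' : 0 ≤ s') (ht' : t' ≤ l) : |Y s t / Y s' t'| ≤ C * C := by
  have h1 := h.one_le
  rw [abs_of_pos (div_pos (h.inter_pos _ _) (h.inter_pos _ _)), div_eq_mul_inv]
  exact mul_le_mul (h.inter_le _ _ hs ht) (h.inv_inter_le _ _ hs' ht')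
    (inv_nonneg.2 (h.inter_pos _ _).le) (by linarith)

theorem lacePt_le_of_mem {k : ℕ} {u : Fin (2 * k + 1) → ℝ} (hu : u ∈ boundedSlice k l) (j : ℕ) :
    lacePt u j ≤ l := by
  refine le_trans ?_ hu.2
  rcases le_total j (2 * k + 1) with hj | hj
  · exact lacePt_monotone hu.1 hj
  · rw [lacePt_of_ge u hj]

theorem IsLaceData.laceW_le (h : IsLaceData r Y l C) {k : ℕ} {u : Fin (2 * k + 1) → ℝ}
    (hu : u ∈ boundedSlice k l) : |laceW r Y u| ≤ C ^ (k + 1) * (C * (C * C) ^ k) := by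
  have h0 := fun j => lacePt_nonneg hu.1 j
  have hl := fun j => lacePt_le_of_mem hu j
  have hC : 0 ≤ C := by linarith [h.one_le]
  unfold laceW
  rw [abs_mul, abs_mul, Finset.abs_prod, Finset.abs_prod]
  gcongr
  · refine (Finset.prod_le_prod (fun _ _ => abs_nonneg _)
      fun i _ => h.vertex_le _ _ (h0 _) (hl _)).trans ?_
    simp
  · rw [abs_of_pos (h.inter_pos _ _)]
    exact h.inter_le _ _ (h0 _) (hl _)
  · refine (Finset.prod_le_prod (fun _ _ => abs_nonneg _)
      fun i _ => h.div_le (h0 _) (hl _) (h0 _) (hl _)).trans ?_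
    simp

theorem lintegral_Ioc_pow_div_factorial {b l : ℝ} (hbl : b ≤ l) (j : ℕ) :
    ∫⁻ t in Set.Ioc b l, ENNReal.ofReal ((l - t) ^ j / j.factorial) =
      ENNReal.ofReal ((l - b) ^ (j + 1) / (j + 1).factorial) := by
  rw [← ofReal_integral_eq_lintegral_ofReal]
  · rw [← intervalIntegral.integral_of_le hbl,
      intervalIntegral.integral_comp_sub_left (fun t => t ^ j / (j.factorial : ℝ)),
      intervalIntegral.integral_div, integral_pow, Nat.factorial_succ]
    congr 1
    push_cast
    simp only [sub_self, ne_eq, Nat.add_eq_zero_iff, one_ne_zero, and_false, not_false_eq_true,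
      zero_pow, sub_zero]
    rw [div_div]
  · exact (Continuous.integrableOn_Icc (by fun_prop)).mono_set Set.Ioc_subset_Icc_self
  · refine (ae_restrict_iff' measurableSet_Ioc).2 (Eventually.of_forall fun t ht => ?_)
    exact div_nonneg (pow_nonneg (sub_nonneg.2 ht.2) _) (by positivity)

/-- Each left endpoint except `s₀ = 0` ranges over an interval of length at most `l`. The right
endpoints are ordered, which gives the factorial. -/
theorem lintegral_boundedSlice_pow_le (hl : 0 ≤ l) (k : ℕ) : ∀ j : ℕ,
    ∫⁻ u in boundedSlice k l, ENNReal.ofReal ((l - lacePt u (2 * k + 1)) ^ j / j.factorial) ≤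
      ENNReal.ofReal (l ^ k * (l ^ (k + 1 + j) / (k + 1 + j).factorial)) := by
  induction k with
  | zero =>
    intro j
    rw [lintegral_boundedSlice_zero]
    simp only [lacePt_single _ (j := 2 * 0 + 1) (by omega)]
    rw [lintegral_Ioc_pow_div_factorial hl]
    simp [add_comm]
  | succ k ih =>
    intro j
    rw [lintegral_boundedSlice_succ]
    · calc _ ≤ ∫⁻ u in boundedSlice k l, ENNReal.ofReal l *
            ENNReal.ofReal ((l - lacePt u (2 * k + 1)) ^ (j + 1) / (j + 1).factorial) := by
            refine setLIntegral_mono' (measurableSet_boundedSlice k l) fun u hu => ?_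
            have h0 := lacePt_nonneg hu.1 (2 * k)
            have h1 := lacePt_le_of_mem hu (2 * k + 1)
            rw [← lintegral_Ioc_pow_div_factorial h1, ← lintegral_const_mul' _ _ ENNReal.ofReal_ne_top]
            refine lintegral_mono fun t => ?_
            simp only [lacePt_laceInsert_last u _ t (j := 2 * (k + 1) + 1) (by omega)]
            rw [setLIntegral_const, Real.volume_Ioo, mul_comm]
            gcongr
            linarith
        _ ≤ ENNReal.ofReal l *
            ENNReal.ofReal (l ^ k * (l ^ (k + 1 + (j + 1)) / (k + 1 + (j + 1)).factorial)) := by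
            rw [lintegral_const_mul' _ _ ENNReal.ofReal_ne_top]
            gcongr
            exact ih (j + 1)
        _ = _ := by
            rw [← ENNReal.ofReal_mul hl, show k + 1 + 1 + j = k + 1 + (j + 1) by ring]
            congr 1
            ring
    · exact (((measurable_const.sub (measurable_lacePt _)).pow_const j).div_const _).ennreal_ofReal

theorem volume_boundedSlice_le (hl : 0 ≤ l) (k : ℕ) :
    volume (boundedSlice k l) ≤ ENNReal.ofReal (l ^ k * (l ^ (k + 1) / (k + 1).factorial)) := by
  have := lintegral_boundedSlice_pow_le hl k 0
  simpa using this

/-- A summable bound for the integrals, over the laces that end before `l`, of the weight of the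
lace times further interaction factors. -/
def laceBound (C l : ℝ) (k : ℕ) : ℝ :=
  C ^ (k + 1) * (C * (C * C) ^ k) * (C * C) * (l ^ k * (l ^ (k + 1) / (k + 1).factorial))

theorem summable_laceBound (C l : ℝ) : Summable (laceBound C l) := by
  have h := ((summable_nat_add_iff 1).2
    (Real.summable_pow_div_factorial (C ^ 3 * l ^ 2))).mul_left (C * l⁻¹)
  by_cases hl : l = 0
  · subst hl
    have : laceBound C 0 = fun _ => 0 := by
      funext k
      simp [laceBound]
    rw [this]
    exact summable_zero
  · refine h.congr fun k => ?_
    unfold laceBound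
    field_simp
    ring

theorem laceBound_nonneg (hl : 0 ≤ l) (hC : 0 ≤ C) (k : ℕ) : 0 ≤ laceBound C l k := by
  unfold laceBound
  positivity

theorem IsLaceData.lintegral_le (h : IsLaceData r Y l C) (k : ℕ)
    {f : (Fin (2 * k + 1) → ℝ) → ℝ} (hf : ∀ u ∈ boundedSlice k l, |f u| ≤ C * C) :
    ∫⁻ u in boundedSlice k l, ‖laceW r Y u * f u‖ₑ ≤ ENNReal.ofReal (laceBound C l k) := by
  have hC : 0 ≤ C := by linarith [h.one_le]
  calc ∫⁻ u in boundedSlice k l, ‖laceW r Y u * f u‖ₑ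
      ≤ ∫⁻ u in boundedSlice k l, ENNReal.ofReal (C ^ (k + 1) * (C * (C * C) ^ k) * (C * C)) := by
        refine setLIntegral_mono' (measurableSet_boundedSlice k l) fun u hu => ?_
        rw [Real.enorm_eq_ofReal_abs, abs_mul]
        refine ENNReal.ofReal_le_ofReal ?_
        gcongr
        · exact h.laceW_le hu
        · exact hf u hu
    _ = ENNReal.ofReal (C ^ (k + 1) * (C * (C * C) ^ k) * (C * C)) * volume (boundedSlice k l) := by
        rw [setLIntegral_const]
    _ ≤ _ := by
        refine (mul_le_mul_right (volume_boundedSlice_le h.time_nonneg k) _).trans_eq ?_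
        rw [← ENNReal.ofReal_mul (by positivity), laceBound]

theorem IsLaceData.integrableOn (h : IsLaceData r Y l C) (k : ℕ)
    {f : (Fin (2 * k + 1) → ℝ) → ℝ} (hf : ∀ u ∈ boundedSlice k l, |f u| ≤ C * C)
    (hm : Measurable f) : IntegrableOn (fun u => laceW r Y u * f u) (boundedSlice k l) :=
  ⟨((h.measurable_laceW k).mul hm).aestronglyMeasurable,
    (h.lintegral_le k hf).trans_lt ENNReal.ofReal_lt_top⟩

/-- The contribution of the laces with `k + 1` intervals. -/
def laceContribution (r Y : ℝ → ℝ → ℝ) (l : ℝ) (k : ℕ) : ℝ :=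
  ∫ u in boundedSlice k l, laceW r Y u * Y (lacePt u (2 * k + 1)) l

/-- The remainder of the expansion after the laces with at most `k` intervals: the integral over
laces with `k + 1` intervals that still carry the full interaction up to time `l`. -/
def laceRemainder (r Y : ℝ → ℝ → ℝ) (l : ℝ) (k : ℕ) : ℝ :=
  ∫ u in boundedSlice k l, laceW r Y u *
    (Y (lacePt u (2 * k)) l / Y (lacePt u (2 * k)) (lacePt u (2 * k + 1)))

theorem IsLaceData.measurable_comp (h : IsLaceData r Y l C) {α : Type*} [MeasurableSpace α]
    {f g : α → ℝ} (hf : Measurable f) (hg : Measurable g) : Measurable fun x => Y (f x) (g x) :=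
  h.measurable_inter.comp (hf.prodMk hg)

theorem IsLaceData.abs_le (h : IsLaceData r Y l C) {s t : ℝ} (hs : 0 ≤ s) (ht : t ≤ l) :
    |Y s t| ≤ C * C := by
  have h1 := h.one_le
  rw [abs_of_pos (h.inter_pos _ _)]
  exact (h.inter_le _ _ hs ht).trans (by nlinarith)

theorem IsLaceData.integrableOn_contribution (h : IsLaceData r Y l C) (k : ℕ) :
    IntegrableOn (fun u => laceW r Y u * Y (lacePt u (2 * k + 1)) l) (boundedSlice k l) :=
  h.integrableOn k (fun _ hu => h.abs_le (lacePt_nonneg hu.1 _) le_rfl)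
    (h.measurable_comp (measurable_lacePt _) measurable_const)

theorem IsLaceData.integrableOn_remainder (h : IsLaceData r Y l C) (k : ℕ) :
    IntegrableOn (fun u => laceW r Y u * (Y (lacePt u (2 * k)) l /
      Y (lacePt u (2 * k)) (lacePt u (2 * k + 1)))) (boundedSlice k l) :=
  h.integrableOn k (fun _ hu => h.div_le (lacePt_nonneg hu.1 _) le_rfl (lacePt_nonneg hu.1 _)
    (lacePt_le_of_mem hu _))
    ((h.measurable_comp (measurable_lacePt _) measurable_const).div
      (h.measurable_comp (measurable_lacePt _) (measurable_lacePt _)))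

theorem IsLaceData.remainder_eq (h : IsLaceData r Y l C) (k : ℕ) :
    laceRemainder r Y l k = laceContribution r Y l k + laceRemainder r Y l (k + 1) := by
  have h1 : laceRemainder r Y l (k + 1) = laceRemainder r Y l k - laceContribution r Y l k := by
    unfold laceContribution
    conv_lhs => unfold laceRemainder
    conv_rhs => unfold laceRemainder
    rw [integral_boundedSlice_succ l (h.integrableOn_remainder (k + 1)),
      ← integral_sub (h.integrableOn_remainder k) (h.integrableOn_contribution k)]
    refine setIntegral_congr_fun (measurableSet_boundedSlice k l) fun u hu => ?_
    have hsplit := h.split (lacePt u (2 * k)) (lacePt u (2 * k + 1)) (lacePt_nonneg hu.1 _)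
      (lacePt_monotone hu.1 (by omega)) (lacePt_le_of_mem hu _)
    have hp : ∀ σ t, lacePt (laceInsert u σ t) (2 * (k + 1)) = lacePt u (2 * k + 1) :=
      lacePt_laceInsert_penultimate u
    have hlast : ∀ σ t, lacePt (laceInsert u σ t) (2 * (k + 1) + 1) = t := fun σ t =>
      lacePt_laceInsert_last u σ t (by omega)
    rw [← mul_sub, hsplit, add_sub_cancel_left, intervalIntegral.integral_of_le
      (lacePt_le_of_mem hu _), ← integral_const_mul]
    refine integral_congr_ae (Eventually.of_forall fun t => ?_)
    beta_reduce
    rw [intervalIntegral.integral_of_le (lacePt_monotone hu.1 (by omega)),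
      integral_Ioc_eq_integral_Ioo, ← integral_const_mul]
    refine integral_congr_ae (Eventually.of_forall fun σ => ?_)
    beta_reduce
    rw [laceW_laceInsert, hp, hlast]
    ring
  linarith

theorem IsLaceData.abs_remainder_le (h : IsLaceData r Y l C) (k : ℕ) :
    |laceRemainder r Y l k| ≤ laceBound C l k := by
  have hC : 0 ≤ C := by linarith [h.one_le]
  have h1 := (enorm_integral_le_lintegral_enorm (μ := volume.restrict (boundedSlice k l))
    (fun u => laceW r Y u * (Y (lacePt u (2 * k)) l /
      Y (lacePt u (2 * k)) (lacePt u (2 * k + 1))))).trans (h.lintegral_le k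
        (fun _ hu => h.div_le (lacePt_nonneg hu.1 _) le_rfl (lacePt_nonneg hu.1 _)
          (lacePt_le_of_mem hu _)))
  rw [Real.enorm_eq_ofReal_abs] at h1
  exact (ENNReal.ofReal_le_ofReal_iff (laceBound_nonneg h.time_nonneg hC k)).1 h1

/-- The laces exhaust the remainder. -/
theorem IsLaceData.tendsto_sum (h : IsLaceData r Y l C) :
    Tendsto (fun n => ∑ k ∈ Finset.range n, laceContribution r Y l k) atTop
      (𝓝 (laceRemainder r Y l 0)) := by
  have h1 : ∀ n, ∑ k ∈ Finset.range n, laceContribution r Y l k =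
      laceRemainder r Y l 0 - laceRemainder r Y l n := by
    intro n
    induction n with
    | zero => simp
    | succ n ih =>
      rw [Finset.sum_range_succ, ih]
      have := h.remainder_eq n
      linarith
  have h2 : Tendsto (laceRemainder r Y l) atTop (𝓝 0) :=
    squeeze_zero_norm (fun k => by simpa using h.abs_remainder_le k)
      (summable_laceBound C l).tendsto_atTop_zero
  have h3 := (tendsto_const_nhds (x := laceRemainder r Y l 0)).sub h2
  rw [sub_zero] at h3
  exact h3.congr fun n => (h1 n).symm

theorem IsLaceData.remainder_zero (h : IsLaceData r Y l C) :
    laceRemainder r Y l 0 = ∫ t in Set.Ioc 0 l, r 0 t * Y 0 l := by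
  unfold laceRemainder
  rw [integral_boundedSlice_zero]
  refine integral_congr_ae (Eventually.of_forall fun t => ?_)
  have h0 : lacePt (singleEquiv t) (2 * 0) = 0 := lacePt_zero _
  have h1 : ∀ j, 1 ≤ j → lacePt (singleEquiv t) j = t := fun j hj => lacePt_single t hj
  simp only [laceW, zero_add, Finset.prod_range_one, Finset.prod_range_zero, mul_one]
  rw [h1 (2 * 0 + 1) (by omega), h0, h1 2 (by omega)]
  have := (h.inter_pos 0 t).ne'
  field_simp

/-- The sum over all laces with at least one interval of the parts of sign `sgn` of the weights, each
followed by a fresh interaction up to time `l`. -/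
def laceSum (sgn : ℝ) (r Y : ℝ → ℝ → ℝ) (l : ℝ) : ℝ≥0∞ :=
  ∑' k : ℕ, ∫⁻ u in boundedSlice k l,
    ENNReal.ofReal (sgn * laceW r Y u) * ENNReal.ofReal (Y (lacePt u (2 * k + 1)) l)

theorem IsLaceData.laceSum_lt_top (h : IsLaceData r Y l C) {sgn : ℝ} (hs : |sgn| = 1) :
    laceSum sgn r Y l < ∞ := by
  have hC : 0 ≤ C := by linarith [h.one_le]
  refine lt_of_le_of_lt (ENNReal.tsum_le_tsum fun k => ?_)
    (summable_laceBound C l).tsum_ofReal_lt_top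
  refine le_trans ?_ (h.lintegral_le k (f := fun u => Y (lacePt u (2 * k + 1)) l)
    fun u hu => h.abs_le (lacePt_nonneg hu.1 _) le_rfl)
  refine lintegral_mono fun u => ?_
  rw [← ENNReal.ofReal_mul' (h.inter_pos _ _).le, Real.enorm_eq_ofReal_abs]
  refine ENNReal.ofReal_le_ofReal ((le_abs_self _).trans ?_)
  rw [mul_assoc, abs_mul, hs, one_mul]

/-- The expansion in laces, written with nonnegative terms only. -/
theorem IsLaceData.add_laceSum (h : IsLaceData r Y l C) :
    ENNReal.ofReal (∫ t in Set.Ioc 0 l, r 0 t * Y 0 l) + laceSum (-1) r Y l =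
      ENNReal.ofReal (-∫ t in Set.Ioc 0 l, r 0 t * Y 0 l) + laceSum 1 r Y l := by
  rw [← h.remainder_zero]
  have hp := h.laceSum_lt_top (sgn := 1) (by simp)
  have hn := h.laceSum_lt_top (sgn := -1) (by simp)
  have hsum : ∀ k, laceContribution r Y l k =
      (∫⁻ u in boundedSlice k l, ENNReal.ofReal (1 * laceW r Y u) *
        ENNReal.ofReal (Y (lacePt u (2 * k + 1)) l)).toReal -
      (∫⁻ u in boundedSlice k l, ENNReal.ofReal (-1 * laceW r Y u) *
        ENNReal.ofReal (Y (lacePt u (2 * k + 1)) l)).toReal := by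
    intro k
    unfold laceContribution
    rw [integral_eq_lintegral_pos_part_sub_lintegral_neg_part (h.integrableOn_contribution k)]
    congr 3 <;> funext u <;> rw [← ENNReal.ofReal_mul' (h.inter_pos _ _).le] <;> congr 1 <;> ring
  have hP := ENNReal.hasSum_toReal (f := fun k => ∫⁻ u in boundedSlice k l,
    ENNReal.ofReal (1 * laceW r Y u) * ENNReal.ofReal (Y (lacePt u (2 * k + 1)) l)) hp.ne
  have hN := ENNReal.hasSum_toReal (f := fun k => ∫⁻ u in boundedSlice k l,
    ENNReal.ofReal (-1 * laceW r Y u) * ENNReal.ofReal (Y (lacePt u (2 * k + 1)) l)) hn.ne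
  have hdiff := (hP.sub hN).tendsto_sum_nat
  simp only [← hsum] at hdiff
  have heq := tendsto_nhds_unique h.tendsto_sum hdiff
  rw [← ENNReal.tsum_toReal_eq (fun k => ENNReal.ne_top_of_tsum_ne_top hp.ne k),
    ← ENNReal.tsum_toReal_eq (fun k => ENNReal.ne_top_of_tsum_ne_top hn.ne k)] at heq
  change laceRemainder r Y l 0 = (laceSum 1 r Y l).toReal - (laceSum (-1) r Y l).toReal at heq
  rw [← ENNReal.toReal_eq_toReal_iff' (ENNReal.add_ne_top.2 ⟨ENNReal.ofReal_ne_top, hn.ne⟩)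
    (ENNReal.add_ne_top.2 ⟨ENNReal.ofReal_ne_top, hp.ne⟩),
    ENNReal.toReal_add ENNReal.ofReal_ne_top hn.ne,
    ENNReal.toReal_add ENNReal.ofReal_ne_top hp.ne, ENNReal.toReal_ofReal', ENNReal.toReal_ofReal']
  have h1 := max_zero_sub_max_neg_zero_eq_self (laceRemainder r Y l 0)
  linarith

end

/-! ### Measurability of derivatives on the orthant -/

section

theorem measurable_comp_of_continuousOn {α X : Type*} [MeasurableSpace α] [TopologicalSpace X]
    [MeasurableSpace X] [OpensMeasurableSpace X] {f : X → ℝ} {S : Set X} (hf : ContinuousOn f S)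
    {g : α → X} (hg : Measurable g) (hgS : ∀ a, g a ∈ S) : Measurable fun a => f (g a) :=
  (continuousOn_iff_continuous_domRestrict.1 hf).measurable.comp (hg.subtype_mk (h := hgS))

section MeasurableDerivatives

variable {α ι : Type*} [MeasurableSpace α] [Fintype ι] {Z : (ι → ℝ) → ℝ} {τ u v : α → ι → ℝ}

theorem measurable_logD_apply (hpos : ∀ τ ∈ Set.Ici (0 : ι → ℝ), 0 < Z τ)
    (hZ : ContDiffOn ℝ 2 Z (Set.Ici 0)) (hτ : Measurable τ) (hτ0 : ∀ a, τ a ∈ Set.Ici (0 : ι → ℝ))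
    (hu : Measurable u) : Measurable fun a => logD Z (τ a) (u a) := by
  have hc : ContinuousOn (fun q : (ι → ℝ) × (ι → ℝ) => logD Z q.1 q.2)
      (Set.Ici 0 ×ˢ Set.univ) := by
    refine ContinuousOn.clm_apply ?_ (by fun_prop)
    exact (contDiffOn_logD hpos hZ).continuousOn.comp (by fun_prop) fun q hq => hq.1
  exact measurable_comp_of_continuousOn hc (hτ.prodMk hu) fun a => ⟨hτ0 a, trivial⟩

theorem measurable_logD2_apply (hpos : ∀ τ ∈ Set.Ici (0 : ι → ℝ), 0 < Z τ)
    (hZ : ContDiffOn ℝ 2 Z (Set.Ici 0)) (hτ : Measurable τ) (hτ0 : ∀ a, τ a ∈ Set.Ici (0 : ι → ℝ))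
    (hu : Measurable u) (hv : Measurable v) : Measurable fun a => logD2 Z (τ a) (u a) (v a) := by
  have hc : ContinuousOn (fun q : (ι → ℝ) × (ι → ℝ) × (ι → ℝ) => logD2 Z q.1 q.2.1 q.2.2)
      (Set.Ici 0 ×ˢ Set.univ) := by
    refine ContinuousOn.clm_apply (ContinuousOn.clm_apply ?_ (by fun_prop)) (by fun_prop)
    exact (continuousOn_logD2 hpos hZ).comp (by fun_prop) fun q hq => hq.1
  exact measurable_comp_of_continuousOn hc (hτ.prodMk (hu.prodMk hv)) fun a => ⟨hτ0 a, trivial⟩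

end MeasurableDerivatives

/-! ### The occupation density of the killed walk -/

variable {d : ℕ} (Λ : Finset (Fin d → ℤ))

open Classical in
/-- The occupation density `1_{X_r = x}` of the killed walk. -/
def occ (ω : CadlagPath d) (r : ℝ) (x : Λ) : ℝ :=
  if killed Λ ω r.toNNReal = some (x : Fin d → ℤ) then 1 else 0

theorem occ_congr {ω ω' : CadlagPath d} {r r' : ℝ}
    (h : killed Λ ω r.toNNReal = killed Λ ω' r'.toNNReal) : occ Λ ω r = occ Λ ω' r' := by
  funext x
  simp only [occ, h]

theorem measurableSet_killed_real (x : Fin d → ℤ) :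
    MeasurableSet {p : CadlagPath d × ℝ | killed Λ p.1 p.2.toNNReal = some x} :=
  (measurable_fst.prodMk measurable_snd.real_toNNReal) (measurableSet_killed Λ x)

theorem measurable_occ : Measurable fun p : CadlagPath d × ℝ => occ Λ p.1 p.2 :=
  measurable_pi_lambda _ fun x =>
    Measurable.ite (measurableSet_killed_real Λ x) measurable_const measurable_const

theorem measurable_occ_comp {α : Type*} [MeasurableSpace α] {f : α → CadlagPath d} {g : α → ℝ}
    (hf : Measurable f) (hg : Measurable g) : Measurable fun a => occ Λ (f a) (g a) := by
  have h := (measurable_occ Λ).comp (hf.prodMk hg)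
  exact h

theorem isOccupation_occ (ω : CadlagPath d) : IsOccupation (occ Λ ω) where
  measurable := measurable_occ_comp Λ measurable_const measurable_id
  nonneg r x := by
    unfold occ
    split_ifs <;> simp
  le_one r x := by
    unfold occ
    split_ifs <;> simp
  right r := by
    have h1 : Tendsto Real.toNNReal (𝓝[≥] r) (𝓝[≥] r.toNNReal) := by
      refine tendsto_nhdsWithin_iff.2
        ⟨(continuous_real_toNNReal.tendsto r).mono_left nhdsWithin_le_nhds, ?_⟩
      filter_upwards [self_mem_nhdsWithin] with s hs
      exact Real.toNNReal_le_toNNReal hs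
    filter_upwards [h1.eventually (eventually_killed_eq Λ ω r.toNNReal)] with s hs
    exact occ_congr Λ hs

theorem localTimes_eq_occTime (ω : CadlagPath d) (s t : ℝ) :
    localTimes Λ ω (Set.Icc s t) = occTime (occ Λ ω) s t := by
  funext x
  have hm : MeasurableSet {r : ℝ | killed Λ ω r.toNNReal = some (x : Fin d → ℤ)} :=
    measurable_prodMk_left (measurableSet_killed_real Λ x)
  rw [(isOccupation_occ Λ ω).occTime_apply]
  have h1 : ∀ r, occ Λ ω r x =
      {r : ℝ | killed Λ ω r.toNNReal = some (x : Fin d → ℤ)}.indicator 1 r := by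
    intro r
    simp only [occ, Set.indicator, Pi.one_apply, Set.mem_ofPred_eq]
  simp only [h1]
  rw [integral_indicator_one hm, measureReal_restrict_apply hm, Set.inter_comm]
  rfl

theorem interaction_eq (Z : (Λ → ℝ) → ℝ) (ω : CadlagPath d) :
    interaction Λ Z ω = occInter Z (occ Λ ω) := by
  funext s t
  rw [interaction, localTimes_eq_occTime, occInter]

theorem measurable_occTime :
    Measurable fun p : CadlagPath d × ℝ × ℝ => occTime (occ Λ p.1) p.2.1 p.2.2 := by
  simp only [← localTimes_eq_occTime]
  refine measurable_pi_lambda _ fun x => Measurable.ennreal_toReal ?_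
  have hm : MeasurableSet {q : (CadlagPath d × ℝ × ℝ) × ℝ |
      q.2 ∈ Set.Icc q.1.2.1 q.1.2.2 ∧ killed Λ q.1.1 q.2.toNNReal = some (x : Fin d → ℤ)} := by
    refine MeasurableSet.inter ?_ ?_
    · exact (measurableSet_le measurable_fst.snd.fst measurable_snd).inter
        (measurableSet_le measurable_snd measurable_fst.snd.snd)
    · exact (measurable_fst.fst.prodMk measurable_snd) (measurableSet_killed_real Λ x)
  exact measurable_measure_prodMk_left hm

section Weights

variable {Z : (Λ → ℝ) → ℝ} (hpos : ∀ τ ∈ Set.Ici (0 : Λ → ℝ), 0 < Z τ)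
  (hZ : ContDiffOn ℝ 2 Z (Set.Ici 0))

include hZ in
theorem measurable_occInter :
    Measurable fun p : CadlagPath d × ℝ × ℝ => occInter Z (occ Λ p.1) p.2.1 p.2.2 :=
  measurable_comp_of_continuousOn (hZ.continuousOn.div_const (Z 0)) (measurable_occTime Λ)
    fun p => (isOccupation_occ Λ p.1).occTime_mem _ _

include hpos hZ

theorem measurable_pairRate :
    Measurable fun p : CadlagPath d × ℝ × ℝ => pairRate Z (occ Λ p.1) p.2.1 p.2.2 := by
  have h1 := measurable_occ_comp Λ (α := CadlagPath d × ℝ × ℝ) measurable_fst measurable_snd.fst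
  have h2 := measurable_occ_comp Λ (α := CadlagPath d × ℝ × ℝ) measurable_fst measurable_snd.snd
  exact measurable_logD2_apply hpos hZ (measurable_occTime Λ)
    (fun p => (isOccupation_occ Λ p.1).occTime_mem _ _) h1 h2

theorem measurable_logD_occ :
    Measurable fun p : CadlagPath d × ℝ × ℝ =>
      logD Z (occTime (occ Λ p.1) p.2.1 p.2.2) (occ Λ p.1 p.2.1) := by
  have h1 := measurable_occ_comp Λ (α := CadlagPath d × ℝ × ℝ) measurable_fst measurable_snd.fst
  exact measurable_logD_apply hpos hZ (measurable_occTime Λ)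
    (fun p => (isOccupation_occ Λ p.1).occTime_mem _ _) h1

theorem measurable_laceW_occ (k : ℕ) :
    Measurable fun p : CadlagPath d × (Fin (2 * k + 1) → ℝ) =>
      laceW (pairRate Z (occ Λ p.1)) (occInter Z (occ Λ p.1)) p.2 :=
  measurable_laceW (r := fun ω => pairRate Z (occ Λ ω)) (Y := fun ω => occInter Z (occ Λ ω))
    (measurable_pairRate Λ hpos hZ) (measurable_occInter Λ hZ) k

theorem exists_isLaceData (ω : CadlagPath d) {l : ℝ} (hl : 0 ≤ l) :
    ∃ C, IsLaceData (pairRate Z (occ Λ ω)) (occInter Z (occ Λ ω)) l C := by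
  have h := isOccupation_occ Λ ω
  obtain ⟨C, hC, hb⟩ := exists_bounds_of_le hpos hZ h l hl
  have hm1 := (measurable_pairRate Λ hpos hZ).comp (measurable_prodMk_left (x := ω))
  have hm2 := (measurable_occInter Λ hZ).comp (measurable_prodMk_left (x := ω))
  exact ⟨C,
    { measurable_vertex := hm1
      measurable_inter := hm2
      time_nonneg := hl
      one_le := hC
      vertex_le := fun s t hs ht => (hb s t (by linarith)).1
      inter_pos := occInter_pos hpos h
      inter_le := fun s t hs ht => (hb s t (by linarith)).2.2.1
      inv_inter_le := fun s t hs ht => (hb s t (by linarith)).2.2.2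
      split := fun a b _ hab hbl => occInter_div_eq hpos hZ h hab hbl }⟩

end Weights

theorem occ_shift {ω : CadlagPath d} {s : ℝ} (hs : 0 ≤ s) (ha : Alive Λ ω s.toNNReal) {r : ℝ}
    (hr : 0 ≤ r) : occ Λ (shift s.toNNReal ω) r = occ Λ ω (s + r) := by
  refine occ_congr Λ ?_
  rw [killed_shift Λ ha, Real.toNNReal_add hs hr]

theorem occTime_shift {ω : CadlagPath d} {s : ℝ} (hs : 0 ≤ s) (ha : Alive Λ ω s.toNNReal)
    {p q : ℝ} (hp : 0 ≤ p) (hpq : p ≤ q) :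
    occTime (occ Λ (shift s.toNNReal ω)) p q = occTime (occ Λ ω) (s + p) (s + q) := by
  rw [occTime_eq _ hpq, occTime_eq _ (by linarith),
    ← intervalIntegral.integral_comp_add_left (fun r => occ Λ ω r)]
  refine intervalIntegral.integral_congr fun r hr => ?_
  rw [Set.uIcc_of_le hpq] at hr
  exact occ_shift Λ hs ha (hp.trans hr.1)

theorem occ_freeze (ω : CadlagPath d) {r t : ℝ} (h : r ≤ t) :
    occ Λ (freeze t.toNNReal ω) r = occ Λ ω r :=
  occ_congr Λ (killed_freeze Λ ω (Real.toNNReal_le_toNNReal h))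

theorem occTime_freeze (ω : CadlagPath d) {s q t : ℝ} (h : q ≤ t) :
    occTime (occ Λ (freeze t.toNNReal ω)) s q = occTime (occ Λ ω) s q :=
  setIntegral_congr_fun measurableSet_Icc fun _ hr => occ_freeze Λ ω (hr.2.trans h)

/-- The weight of a lace depends on the path only up to the last endpoint of the lace. -/
theorem laceW_freeze (Z : (Λ → ℝ) → ℝ) (ω : CadlagPath d) {k : ℕ} {u : Fin (2 * k + 1) → ℝ} {t : ℝ}
    (hu : u ∈ boundedSlice k t) :
    laceW (pairRate Z (occ Λ (freeze t.toNNReal ω))) (occInter Z (occ Λ (freeze t.toNNReal ω))) u =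
      laceW (pairRate Z (occ Λ ω)) (occInter Z (occ Λ ω)) u := by
  have hle := fun j => lacePt_le_of_mem hu j
  simp only [laceW, pairRate, occInter, occTime_freeze Λ ω (hle _), occ_freeze Λ ω (hle _)]

end

/-! ### The renewal identity along a path -/

section

variable {d : ℕ} (Λ : Finset (Fin d → ℤ)) (Z : (Λ → ℝ) → ℝ) (b : Fin d → ℤ)

open Classical in
/-- The indicator of survival up to time `t`. -/
def aliveInd (ω : CadlagPath d) (t : ℝ) : ℝ≥0∞ := if Alive Λ ω t.toNNReal then 1 else 0

open Classical in
/-- The integrand `Y_{0,l} 1_{X_l = b}` of the interacting Green's function. -/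
def endWeight (ω : CadlagPath d) (l : ℝ) : ℝ≥0∞ :=
  if killed Λ ω l.toNNReal = some b then ENNReal.ofReal (interaction Λ Z ω 0 l) else 0

/-- The integrand of the interacting Green's function for the path that starts afresh at
time `t`. -/
def restartWeight (ω : CadlagPath d) (t l : ℝ) : ℝ≥0∞ :=
  aliveInd Λ ω t * endWeight Λ Z b (shift t.toNNReal ω) (l - t)

/-- The positive part (`sgn = 1`) or negative part (`sgn = -1`) of the weight `r₀` of the trivial
lace. -/
def pointPart (sgn : ℝ) (ω : CadlagPath d) : ℝ≥0∞ := ENNReal.ofReal (sgn * logD Z 0 (occ Λ ω 0))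

/-- The positive part (`sgn = 1`) or negative part (`sgn = -1`) of the weight of a lace. -/
def lacePart (sgn : ℝ) {k : ℕ} (ω : CadlagPath d) (u : Fin (2 * k + 1) → ℝ) : ℝ≥0∞ :=
  ENNReal.ofReal (sgn * laceW (pairRate Z (occ Λ ω)) (occInter Z (occ Λ ω)) u)

/-- The sum over all laces that start at `0` and end before `l`, each followed by a fresh
interacting path. -/
def stepWeight (sgn : ℝ) (ω : CadlagPath d) (l : ℝ) : ℝ≥0∞ :=
  pointPart Λ Z sgn ω * restartWeight Λ Z b ω 0 l +
    ∑' k : ℕ, ∫⁻ u in laceSlice k 0, (Set.Ici (lacePt u (2 * k + 1))).indicator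
      (fun l => lacePart Λ Z sgn ω u * restartWeight Λ Z b ω (lacePt u (2 * k + 1)) l) l

open Classical in
theorem restartWeight_eq (ω : CadlagPath d) {t l : ℝ} (ht : 0 ≤ t) (htl : t ≤ l) :
    restartWeight Λ Z b ω t l = if killed Λ ω l.toNNReal = some b then
      ENNReal.ofReal (occInter Z (occ Λ ω) t l) else 0 := by
  have hl : l.toNNReal = t.toNNReal + (l - t).toNNReal := by
    rw [← Real.toNNReal_add ht (sub_nonneg.2 htl), add_sub_cancel]
  unfold restartWeight aliveInd endWeight
  by_cases ha : Alive Λ ω t.toNNReal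
  · rw [if_pos ha, one_mul, killed_shift Λ ha, ← hl, interaction_eq]
    congr 2
    unfold occInter
    rw [occTime_shift Λ ht ha le_rfl (sub_nonneg.2 htl), add_zero, add_sub_cancel]
  · rw [if_neg ha, zero_mul, if_neg]
    intro hk
    refine ha (((killed_eq_some_iff Λ ω _ b).1 hk).1.mono ?_)
    rw [hl]
    exact le_self_add

theorem lintegral_laceSlice_indicator (k : ℕ) (l : ℝ) (f : (Fin (2 * k + 1) → ℝ) → ℝ → ℝ≥0∞) :
    ∫⁻ u in laceSlice k 0, (Set.Ici (lacePt u (2 * k + 1))).indicator (f u) l =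
      ∫⁻ u in boundedSlice k l, f u l := by
  rw [boundedSlice, Set.inter_comm, ← Measure.restrict_restrict
    (measurableSet_le (measurable_lacePt _) measurable_const),
    ← lintegral_indicator (measurableSet_le (measurable_lacePt _) measurable_const)]
  rfl

open Classical in
theorem stepWeight_eq (sgn : ℝ) (ω : CadlagPath d) {l : ℝ} (hl : 0 ≤ l) :
    stepWeight Λ Z b sgn ω l = if killed Λ ω l.toNNReal = some b then
      pointPart Λ Z sgn ω * ENNReal.ofReal (occInter Z (occ Λ ω) 0 l) +
        laceSum sgn (pairRate Z (occ Λ ω)) (occInter Z (occ Λ ω)) l else 0 := by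
  have h1 : ∀ k : ℕ, ∫⁻ u in laceSlice k 0, (Set.Ici (lacePt u (2 * k + 1))).indicator
      (fun l => lacePart Λ Z sgn ω u * restartWeight Λ Z b ω (lacePt u (2 * k + 1)) l) l =
      ∫⁻ u in boundedSlice k l, lacePart Λ Z sgn ω u * (if killed Λ ω l.toNNReal = some b then
        ENNReal.ofReal (occInter Z (occ Λ ω) (lacePt u (2 * k + 1)) l) else 0) := by
    intro k
    rw [lintegral_laceSlice_indicator]
    refine setLIntegral_congr_fun (measurableSet_boundedSlice k l) fun u hu => ?_
    rw [restartWeight_eq Λ Z b ω (lacePt_nonneg hu.1 _) hu.2]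
  unfold stepWeight
  simp only [h1]
  rw [restartWeight_eq Λ Z b ω le_rfl hl]
  by_cases hk : killed Λ ω l.toNNReal = some b
  · simp only [hk, if_true]
    rfl
  · simp only [hk, if_false, mul_zero, lintegral_zero, tsum_zero, add_zero]

variable {Z} (hpos : ∀ τ ∈ Set.Ici (0 : Λ → ℝ), 0 < Z τ) (hZ : ContDiffOn ℝ 2 Z (Set.Ici 0))

include hpos hZ

/-- The derivative of the interaction in its left endpoint, expanded in laces. -/
theorem add_stepWeight (ω : CadlagPath d) {l : ℝ} (hl : 0 ≤ l)
    (hk : killed Λ ω l.toNNReal = some b) :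
    ENNReal.ofReal (logD Z (occTime (occ Λ ω) 0 l) (occ Λ ω 0) * occInter Z (occ Λ ω) 0 l) +
        stepWeight Λ Z b (-1) ω l =
      ENNReal.ofReal (-(logD Z (occTime (occ Λ ω) 0 l) (occ Λ ω 0) *
        occInter Z (occ Λ ω) 0 l)) + stepWeight Λ Z b 1 ω l := by
  have hocc := isOccupation_occ Λ ω
  obtain ⟨C, hC⟩ := exists_isLaceData Λ hpos hZ ω hl
  have hlace := hC.add_laceSum
  have hp := hC.laceSum_lt_top (sgn := 1) (by simp)
  have hn := hC.laceSum_lt_top (sgn := -1) (by simp)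
  have hY := (occInter_pos hpos hocc 0 l).le
  rw [integral_mul_const, ← intervalIntegral.integral_of_le hl] at hlace
  rw [stepWeight_eq Λ Z b _ ω hl, stepWeight_eq Λ Z b _ ω hl, if_pos hk, if_pos hk,
    logD_eq_add hpos hZ hocc hl, pointPart, pointPart, ← ENNReal.ofReal_mul' hY,
    ← ENNReal.ofReal_mul' hY]
  set R := ∫ t in (0 : ℝ)..l, pairRate Z (occ Λ ω) 0 t
  set p := logD Z 0 (occ Λ ω 0)
  set y := occInter Z (occ Λ ω) 0 l
  lift laceSum 1 (pairRate Z (occ Λ ω)) (occInter Z (occ Λ ω)) l to ℝ≥0 using hp.ne with sp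
  lift laceSum (-1) (pairRate Z (occ Λ ω)) (occInter Z (occ Λ ω)) l to ℝ≥0 using hn.ne with sn
  unfold ENNReal.ofReal at hlace ⊢
  norm_cast at hlace ⊢
  rw [← NNReal.coe_inj] at hlace ⊢
  push_cast [Real.coe_toNNReal'] at hlace ⊢
  have e1 := max_zero_sub_max_neg_zero_eq_self (R * y)
  have e2 := max_zero_sub_max_neg_zero_eq_self ((p + R) * y)
  have e3 := max_zero_sub_max_neg_zero_eq_self (p * y)
  have e4 : (-1) * p * y = -(p * y) := by ring
  have e5 : 1 * p * y = p * y := by ring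
  rw [e4, e5]
  linarith

theorem integrableOn_logD_mul (ω : CadlagPath d) (l : ℝ) (hl : 0 ≤ l) :
    IntegrableOn (fun s => logD Z (occTime (occ Λ ω) s l) (occ Λ ω s) *
      occInter Z (occ Λ ω) s l) (Set.Ioc 0 l) := by
  have hocc := isOccupation_occ Λ ω
  obtain ⟨C, hC, hb⟩ := exists_bounds_of_le hpos hZ hocc l hl
  have hpair : Measurable fun s : ℝ => ((ω, s, l) : CadlagPath d × ℝ × ℝ) :=
    measurable_const.prodMk (measurable_id.prodMk measurable_const)
  have hm1 := (measurable_logD_occ Λ hpos hZ).comp hpair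
  have hm2 := (measurable_occInter Λ hZ).comp hpair
  have hm := hm1.mul hm2
  refine Measure.integrableOn_of_bounded (M := C * C) (by simp) hm.aestronglyMeasurable
    ((ae_restrict_iff' measurableSet_Ioc).2 (Eventually.of_forall fun s hs => ?_))
  have h1 := hb s l (by linarith [hs.1])
  rw [Real.norm_eq_abs, abs_mul, abs_of_pos (occInter_pos hpos hocc s l)]
  exact mul_le_mul h1.2.1 h1.2.2.1 (occInter_pos hpos hocc s l).le (by linarith)

open Classical in
/-- The expansion of the interaction along a path: either nothing of the interaction is used, or
there is a first time `s` from which a lace emanates. -/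
theorem endWeight_add (ω : CadlagPath d) {l : ℝ} (hl : 0 ≤ l) :
    endWeight Λ Z b ω l + ∫⁻ s in Set.Ioc 0 l,
        aliveInd Λ ω s * stepWeight Λ Z b (-1) (shift s.toNNReal ω) (l - s) =
      (if killed Λ ω l.toNNReal = some b then 1 else 0) + ∫⁻ s in Set.Ioc 0 l,
        aliveInd Λ ω s * stepWeight Λ Z b 1 (shift s.toNNReal ω) (l - s) := by
  have hls : ∀ s ∈ Set.Ioc 0 l, l.toNNReal = s.toNNReal + (l - s).toNNReal := fun s hs => by
    rw [← Real.toNNReal_add hs.1.le (sub_nonneg.2 hs.2), add_sub_cancel]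
  by_cases hk : killed Λ ω l.toNNReal = some b
  · have halive : ∀ s ∈ Set.Ioc 0 l, Alive Λ ω s.toNNReal := fun s hs =>
      ((killed_eq_some_iff Λ ω _ b).1 hk).1.mono (Real.toNNReal_le_toNNReal hs.2)
    set h : ℝ → ℝ := fun s => logD Z (occTime (occ Λ ω) s l) (occ Λ ω s) *
      occInter Z (occ Λ ω) s l with hdef
    have hi : IntegrableOn h (Set.Ioc 0 l) := integrableOn_logD_mul Λ hpos hZ ω l hl
    have hstep : ∀ s ∈ Set.Ioc 0 l,
        ENNReal.ofReal (h s) + aliveInd Λ ω s * stepWeight Λ Z b (-1) (shift s.toNNReal ω) (l - s) =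
        ENNReal.ofReal (-h s) +
          aliveInd Λ ω s * stepWeight Λ Z b 1 (shift s.toNNReal ω) (l - s) := by
      intro s hs
      have hs1 := halive s hs
      have hsl : 0 ≤ l - s := sub_nonneg.2 hs.2
      have := add_stepWeight Λ b hpos hZ (shift s.toNNReal ω) hsl
        (by rw [killed_shift Λ hs1, ← hls s hs, hk])
      rw [occTime_shift Λ hs.1.le hs1 le_rfl hsl, occ_shift Λ hs.1.le hs1 le_rfl, add_zero,
        add_sub_cancel, occInter, occTime_shift Λ hs.1.le hs1 le_rfl hsl, add_zero,
        add_sub_cancel] at this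
      simp only [aliveInd, hs1, if_true, one_mul]
      exact this
    have hpair : Measurable fun s : ℝ => ((ω, s, l) : CadlagPath d × ℝ × ℝ) :=
      measurable_const.prodMk (measurable_id.prodMk measurable_const)
    have hm1 := (measurable_logD_occ Λ hpos hZ).comp hpair
    have hm2 := (measurable_occInter Λ hZ).comp hpair
    have hm : Measurable h := hm1.mul hm2
    have hint := setLIntegral_congr_fun (μ := volume) measurableSet_Ioc hstep
    rw [lintegral_add_left hm.ennreal_ofReal,
      lintegral_add_left (f := fun s => ENNReal.ofReal (-h s)) hm.neg.ennreal_ofReal] at hint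
    have hend : endWeight Λ Z b ω l = ENNReal.ofReal (occInter Z (occ Λ ω) 0 l) := by
      rw [endWeight, if_pos hk, interaction_eq]
    have hone := occInter_eq_one_add hpos hZ (isOccupation_occ Λ ω) hl
    rw [intervalIntegral.integral_of_le hl] at hone
    have hsplit := integral_eq_lintegral_pos_part_sub_lintegral_neg_part hi
    have hfp : ∫⁻ s in Set.Ioc 0 l, ENNReal.ofReal (h s) ≠ ∞ := hi.lintegral_lt_top.ne
    have hfn : ∫⁻ s in Set.Ioc 0 l, ENNReal.ofReal (-h s) ≠ ∞ := hi.neg.lintegral_lt_top.ne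
    have hY : ENNReal.ofReal (occInter Z (occ Λ ω) 0 l) +
        ∫⁻ s in Set.Ioc 0 l, ENNReal.ofReal (-h s) =
        1 + ∫⁻ s in Set.Ioc 0 l, ENNReal.ofReal (h s) := by
      rw [← ENNReal.toReal_eq_toReal_iff' (ENNReal.add_ne_top.2 ⟨ENNReal.ofReal_ne_top, hfn⟩)
        (ENNReal.add_ne_top.2 ⟨ENNReal.one_ne_top, hfp⟩), ENNReal.toReal_add ENNReal.ofReal_ne_top hfn,
        ENNReal.toReal_add ENNReal.one_ne_top hfp,
        ENNReal.toReal_ofReal (occInter_pos hpos (isOccupation_occ Λ ω) 0 l).le, ENNReal.toReal_one]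
      linarith
    rw [if_pos hk, hend]
    refine (ENNReal.add_left_inj (ENNReal.add_ne_top.2 ⟨hfp, hfn⟩)).1 ?_
    calc _ = (ENNReal.ofReal (occInter Z (occ Λ ω) 0 l) +
          ∫⁻ s in Set.Ioc 0 l, ENNReal.ofReal (-h s)) +
          ((∫⁻ s in Set.Ioc 0 l, ENNReal.ofReal (h s)) + ∫⁻ s in Set.Ioc 0 l,
            aliveInd Λ ω s * stepWeight Λ Z b (-1) (shift s.toNNReal ω) (l - s)) := by ring
      _ = _ := by
        rw [hY, hint]
        ring
  · have hz : ∀ sgn, ∀ s ∈ Set.Ioc 0 l,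
        aliveInd Λ ω s * stepWeight Λ Z b sgn (shift s.toNNReal ω) (l - s) = 0 := by
      intro sgn s hs
      by_cases ha : Alive Λ ω s.toNNReal
      · rw [stepWeight_eq Λ Z b sgn _ (sub_nonneg.2 hs.2), killed_shift Λ ha, ← hls s hs,
          if_neg hk, mul_zero]
      · rw [aliveInd, if_neg ha, zero_mul]
    rw [setLIntegral_congr_fun measurableSet_Ioc (hz (-1)),
      setLIntegral_congr_fun measurableSet_Ioc (hz 1), endWeight, if_neg hk, if_neg hk]

end

/-! ### Taking expectations -/

section

variable {d : ℕ} (Λ : Finset (Fin d → ℤ)) (Z : (Λ → ℝ) → ℝ) (b : Fin d → ℤ)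

/-- The time integral `∫ Y_{0,l} 1_{X_l = b} dl` along a path. -/
def pathGreen (ω : CadlagPath d) : ℝ≥0∞ := ∫⁻ l in Set.Ici (0 : ℝ), endWeight Λ Z b ω l

/-- The sum over all laces starting at `0`, each followed by the Green's function of the path that
starts afresh at the end of the lace. -/
def totalWeight (sgn : ℝ) (ω : CadlagPath d) : ℝ≥0∞ :=
  pointPart Λ Z sgn ω * (aliveInd Λ ω 0 * pathGreen Λ Z b (shift (0 : ℝ).toNNReal ω)) +
    ∑' k : ℕ, ∫⁻ u in laceSlice k 0, lacePart Λ Z sgn ω u *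
      (aliveInd Λ ω (lacePt u (2 * k + 1)) *
        pathGreen Λ Z b (shift (lacePt u (2 * k + 1)).toNNReal ω))

theorem lintegral_indicator_sub {t : ℝ} (ht : 0 ≤ t) (f : ℝ → ℝ≥0∞) :
    ∫⁻ l in Set.Ici (0 : ℝ), (Set.Ici t).indicator (fun l => f (l - t)) l =
      ∫⁻ x in Set.Ici (0 : ℝ), f x := by
  rw [← lintegral_indicator measurableSet_Ici, ← lintegral_indicator measurableSet_Ici,
    ← lintegral_sub_right_eq_self ((Set.Ici (0 : ℝ)).indicator f) t]
  refine lintegral_congr fun l => ?_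
  by_cases h : t ≤ l
  · have h1 : l ∈ Set.Ici (0 : ℝ) := ht.trans h
    have h2 : l - t ∈ Set.Ici (0 : ℝ) := sub_nonneg.2 h
    rw [Set.indicator_of_mem h1, Set.indicator_of_mem (s := Set.Ici t) h, Set.indicator_of_mem h2]
  · have h2 : l - t ∉ Set.Ici (0 : ℝ) := fun h2 => h (sub_nonneg.1 h2)
    rw [Set.indicator_of_notMem h2]
    simp only [Set.indicator_apply_eq_zero]
    exact fun _ h3 => absurd h3 h

theorem lintegral_Ioc_sub {F : ℝ → ℝ → ℝ≥0∞} (hF : Measurable fun p : ℝ × ℝ => F p.1 p.2) :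
    ∫⁻ l in Set.Ici (0 : ℝ), ∫⁻ s in Set.Ioc 0 l, F s (l - s) =
      ∫⁻ s in Set.Ioi (0 : ℝ), ∫⁻ x in Set.Ici (0 : ℝ), F s x := by
  have h1 : ∀ l, ∫⁻ s in Set.Ioc 0 l, F s (l - s) =
      ∫⁻ s in Set.Ioi (0 : ℝ), (Set.Ici s).indicator (fun l => F s (l - s)) l := by
    intro l
    have h2 : Set.Ioc 0 l = Set.Iic l ∩ Set.Ioi 0 := by
      rw [Set.inter_comm]; rfl
    rw [h2, ← Measure.restrict_restrict measurableSet_Iic, ← lintegral_indicator measurableSet_Iic]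
    rfl
  simp only [h1]
  rw [lintegral_lintegral_swap]
  · exact setLIntegral_congr_fun measurableSet_Ioi fun s hs =>
      lintegral_indicator_sub (le_of_lt hs) (F s)
  · refine Measurable.aemeasurable ?_
    have h3 : Measurable fun p : ℝ × ℝ => F p.2 (p.1 - p.2) :=
      hF.comp (measurable_snd.prodMk (measurable_fst.sub measurable_snd))
    exact h3.indicator (s := {p : ℝ × ℝ | p.2 ≤ p.1})
      (measurableSet_le measurable_snd measurable_fst)

theorem measurable_aliveInd : Measurable fun p : CadlagPath d × ℝ => aliveInd Λ p.1 p.2 :=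
  Measurable.ite ((measurable_fst.prodMk measurable_snd.real_toNNReal) (measurableSet_alive Λ))
    measurable_const measurable_const

theorem measurable_shift_real :
    Measurable fun p : CadlagPath d × ℝ => shift p.2.toNNReal p.1 :=
  measurable_shift_uncurry.comp (measurable_fst.prodMk measurable_snd.real_toNNReal)

/-- The Markov property of the killed walk, summed over the position at time `t`. -/
theorem markov_sum {J : (Fin d → ℤ) → ℝ} {P : (Fin d → ℤ) → Measure (CadlagPath d)}
    (hJ : IsJumpKernel J) (hP : ∀ a, IsWalkLaw J a (P a)) (a : Fin d → ℤ)
    (t : ℝ) {F H : CadlagPath d → ℝ≥0∞} (hF : Measurable F) (hH : Measurable H)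
    (hFt : ∀ ω, F (freeze t.toNNReal ω) = F ω) :
    ∫⁻ ω, F ω * (aliveInd Λ ω t * H (shift t.toNNReal ω)) ∂(P a) =
      ∑ x ∈ Λ, (∫⁻ ω in {ω | killed Λ ω t.toNNReal = some x}, F ω ∂(P a)) * ∫⁻ ω, H ω ∂(P x) := by
  have h1 : ∫⁻ ω, F ω * (aliveInd Λ ω t * H (shift t.toNNReal ω)) ∂(P a) =
      ∫⁻ ω in {ω | Alive Λ ω t.toNNReal}, F ω * H (shift t.toNNReal ω) ∂(P a) := by
    rw [← lintegral_indicator (measurableSet_alive_at Λ _)]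
    refine lintegral_congr fun ω => ?_
    by_cases h : Alive Λ ω t.toNNReal
    · rw [Set.indicator_of_mem (s := {ω | Alive Λ ω t.toNNReal}) h, aliveInd, if_pos h, one_mul]
    · rw [Set.indicator_of_notMem (s := {ω | Alive Λ ω t.toNNReal}) h, aliveInd, if_neg h,
        zero_mul, mul_zero]
  rw [h1, lintegral_alive_eq_sum]
  exact Finset.sum_congr rfl fun x _ => markov_killed Λ hJ hP a x t.toNNReal hF hH hFt

theorem localTime_eq (ω : CadlagPath d) (x : Fin d → ℤ) :
    localTime Λ ω (Set.Ici 0) x = ∫⁻ s in Set.Ioi (0 : ℝ),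
      {p : CadlagPath d × ℝ | killed Λ p.1 p.2.toNNReal = some x}.indicator 1 (ω, s) := by
  have hm : MeasurableSet {r : ℝ | killed Λ ω r.toNNReal = some x} :=
    measurable_prodMk_left (measurableSet_killed_real Λ x)
  have h1 : ∀ s, {p : CadlagPath d × ℝ | killed Λ p.1 p.2.toNNReal = some x}.indicator
      (1 : CadlagPath d × ℝ → ℝ≥0∞) (ω, s) =
      {r : ℝ | killed Λ ω r.toNNReal = some x}.indicator 1 s := fun s => rfl
  simp only [h1]
  rw [restrict_Ioi_eq_restrict_Ici, lintegral_indicator_one hm, Measure.restrict_apply hm,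
    Set.inter_comm]
  rfl

theorem lintegral_localTime (Q : Measure (CadlagPath d)) [SFinite Q] (x : Fin d → ℤ) :
    ∫⁻ ω, localTime Λ ω (Set.Ici 0) x ∂Q =
      ∫⁻ s in Set.Ioi (0 : ℝ), Q {ω | killed Λ ω s.toNNReal = some x} := by
  simp only [localTime_eq]
  rw [lintegral_lintegral_swap]
  · refine lintegral_congr fun s => ?_
    rw [← lintegral_indicator_one (measurableSet_killed_at Λ s.toNNReal x)]
    rfl
  · exact (measurable_one.indicator (measurableSet_killed_real Λ x)).aemeasurable

/-- The expectation of a sum, over all times `s`, of a functional of the path from time `s` on. -/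
theorem lintegral_restart {J : (Fin d → ℤ) → ℝ} {P : (Fin d → ℤ) → Measure (CadlagPath d)}
    (hJ : IsJumpKernel J) (hP : ∀ a, IsWalkLaw J a (P a)) (a : Fin d → ℤ)
    {H : CadlagPath d → ℝ≥0∞} (hH : Measurable H) :
    ∫⁻ ω, (∫⁻ s in Set.Ioi (0 : ℝ), aliveInd Λ ω s * H (shift s.toNNReal ω)) ∂(P a) =
      ∑ x ∈ Λ, (∫⁻ ω, localTime Λ ω (Set.Ici 0) x ∂(P a)) * ∫⁻ ω, H ω ∂(P x) := by
  have := (hP a).isProbabilityMeasure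
  rw [lintegral_lintegral_swap]
  · have h1 : ∀ s : ℝ, ∫⁻ ω, aliveInd Λ ω s * H (shift s.toNNReal ω) ∂(P a) =
        ∑ x ∈ Λ, P a {ω | killed Λ ω s.toNNReal = some x} * ∫⁻ ω, H ω ∂(P x) := by
      intro s
      have := markov_sum Λ hJ hP a s (F := fun _ => 1) measurable_const hH (fun _ => rfl)
      simpa using this
    simp only [h1]
    have hm : ∀ x, Measurable fun s : ℝ => P a {ω | killed Λ ω s.toNNReal = some x} := fun x =>
      measurable_measure_prodMk_right (measurableSet_killed_real Λ x)
    rw [lintegral_finsetSum _ fun x _ => (hm x).mul_const _]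
    refine Finset.sum_congr rfl fun x _ => ?_
    rw [lintegral_mul_const _ (hm x), lintegral_localTime]
  · exact ((measurable_aliveInd Λ).mul (hH.comp measurable_shift_real)).aemeasurable

variable {Z} (hpos : ∀ τ ∈ Set.Ici (0 : Λ → ℝ), 0 < Z τ) (hZ : ContDiffOn ℝ 2 Z (Set.Ici 0))

section

include hZ

theorem measurable_endWeight : Measurable fun p : CadlagPath d × ℝ => endWeight Λ Z b p.1 p.2 := by
  have hm := (measurable_occInter Λ hZ).comp
    (measurable_fst.prodMk (measurable_const.prodMk measurable_snd) :
      Measurable fun p : CadlagPath d × ℝ => (p.1, (0 : ℝ), p.2))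
  simp only [endWeight, interaction_eq]
  exact Measurable.ite (measurableSet_killed_real Λ b) hm.ennreal_ofReal measurable_const

theorem measurable_restartWeight :
    Measurable fun p : CadlagPath d × ℝ × ℝ => restartWeight Λ Z b p.1 p.2.1 p.2.2 := by
  have h1 := (measurable_aliveInd Λ).comp
    (measurable_fst.prodMk measurable_snd.fst : Measurable fun p : CadlagPath d × ℝ × ℝ => (p.1, p.2.1))
  have h2 := measurable_shift_real.comp
    (measurable_fst.prodMk measurable_snd.fst : Measurable fun p : CadlagPath d × ℝ × ℝ => (p.1, p.2.1))
  have h3 := (measurable_endWeight Λ b hZ).comp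
    (h2.prodMk (measurable_snd.snd.sub measurable_snd.fst))
  exact h1.mul h3

theorem measurable_pathGreen : Measurable (pathGreen Λ Z b) :=
  (measurable_endWeight Λ b hZ).lintegral_prod_right'

theorem measurable_restart_zero :
    Measurable fun p : CadlagPath d × ℝ => restartWeight Λ Z b p.1 0 p.2 := by
  have h := (measurable_restartWeight Λ b hZ).comp
    (measurable_fst.prodMk (measurable_const.prodMk measurable_snd) :
      Measurable fun p : CadlagPath d × ℝ => (p.1, (0 : ℝ), p.2))
  exact h

theorem measurable_restartGreen (k : ℕ) :
    Measurable fun p : CadlagPath d × (Fin (2 * k + 1) → ℝ) =>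
      aliveInd Λ p.1 (lacePt p.2 (2 * k + 1)) *
        pathGreen Λ Z b (shift (lacePt p.2 (2 * k + 1)).toNNReal p.1) := by
  have hpt : Measurable fun p : CadlagPath d × (Fin (2 * k + 1) → ℝ) =>
      (p.1, lacePt p.2 (2 * k + 1)) :=
    measurable_fst.prodMk ((measurable_lacePt _).comp measurable_snd)
  exact ((measurable_aliveInd Λ).comp hpt).mul
    ((measurable_pathGreen Λ b hZ).comp (measurable_shift_real.comp hpt))

theorem measurable_restartGreen_zero :
    Measurable fun ω : CadlagPath d =>
      aliveInd Λ ω 0 * pathGreen Λ Z b (shift (0 : ℝ).toNNReal ω) := by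
  have h1 := (measurable_aliveInd Λ).comp
    (measurable_prodMk_right : Measurable fun ω : CadlagPath d => (ω, (0 : ℝ)))
  exact h1.mul ((measurable_pathGreen Λ b hZ).comp (measurable_shift _))

theorem lintegral_restartWeight (ω : CadlagPath d) {t : ℝ} (ht : 0 ≤ t) (c : ℝ≥0∞) :
    ∫⁻ l in Set.Ici (0 : ℝ), (Set.Ici t).indicator (fun l => c * restartWeight Λ Z b ω t l) l =
      c * (aliveInd Λ ω t * pathGreen Λ Z b (shift t.toNNReal ω)) := by
  have hm : Measurable fun l => endWeight Λ Z b (shift t.toNNReal ω) l := by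
    have h := (measurable_endWeight Λ b hZ).comp (measurable_prodMk_left (x := shift t.toNNReal ω))
    exact h
  have h := lintegral_indicator_sub ht
    fun x => c * (aliveInd Λ ω t * endWeight Λ Z b (shift t.toNNReal ω) x)
  rw [lintegral_const_mul _ (hm.const_mul _), lintegral_const_mul _ hm] at h
  exact h

end

include hpos hZ

theorem measurable_pointPart (sgn : ℝ) : Measurable (pointPart Λ Z sgn) := by
  have h := measurable_logD_apply (τ := fun _ : CadlagPath d => 0) hpos hZ measurable_const
    (fun _ => Set.self_mem_Ici) (measurable_occ_comp Λ measurable_id (measurable_const (a := (0 : ℝ))))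
  exact (h.const_mul sgn).ennreal_ofReal

theorem measurable_lacePart (sgn : ℝ) (k : ℕ) :
    Measurable fun p : CadlagPath d × (Fin (2 * k + 1) → ℝ) => lacePart Λ Z sgn p.1 p.2 :=
  ((measurable_laceW_occ Λ hpos hZ k).const_mul sgn).ennreal_ofReal

theorem measurable_laceStep (sgn : ℝ) (k : ℕ) :
    Measurable fun p : (CadlagPath d × ℝ) × (Fin (2 * k + 1) → ℝ) =>
      (Set.Ici (lacePt p.2 (2 * k + 1))).indicator (fun l => lacePart Λ Z sgn p.1.1 p.2 *
        restartWeight Λ Z b p.1.1 (lacePt p.2 (2 * k + 1)) l) p.1.2 := by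
  have hpt : Measurable fun p : (CadlagPath d × ℝ) × (Fin (2 * k + 1) → ℝ) =>
      lacePt p.2 (2 * k + 1) := (measurable_lacePt _).comp measurable_snd
  have h1 := (measurable_lacePart Λ hpos hZ sgn k).comp
    (measurable_fst.fst.prodMk measurable_snd : Measurable
      fun p : (CadlagPath d × ℝ) × (Fin (2 * k + 1) → ℝ) => (p.1.1, p.2))
  have h2 := (measurable_restartWeight Λ b hZ).comp
    (measurable_fst.fst.prodMk (hpt.prodMk measurable_fst.snd))
  have h3 := (h1.mul h2).indicator
    (s := {p : (CadlagPath d × ℝ) × (Fin (2 * k + 1) → ℝ) | lacePt p.2 (2 * k + 1) ≤ p.1.2})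
    (measurableSet_le hpt measurable_fst.snd)
  exact h3

theorem measurable_stepWeight (sgn : ℝ) :
    Measurable fun p : CadlagPath d × ℝ => stepWeight Λ Z b sgn p.1 p.2 := by
  have h1 := (measurable_pointPart Λ hpos hZ sgn).comp
    (measurable_fst : Measurable fun p : CadlagPath d × ℝ => p.1)
  refine (h1.mul (measurable_restart_zero Λ b hZ)).add (Measurable.tsum fun k => ?_)
  exact (measurable_laceStep Λ b hpos hZ sgn k).lintegral_prod_right'

theorem measurable_totalWeight (sgn : ℝ) : Measurable (totalWeight Λ Z b sgn) := by
  refine ((measurable_pointPart Λ hpos hZ sgn).mul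
    (measurable_restartGreen_zero Λ b hZ)).add (Measurable.tsum fun k => ?_)
  have h := (measurable_lacePart Λ hpos hZ sgn k).mul (measurable_restartGreen Λ b hZ k)
  exact h.lintegral_prod_right'

theorem lintegral_stepWeight (sgn : ℝ) (ω : CadlagPath d) :
    ∫⁻ l in Set.Ici (0 : ℝ), stepWeight Λ Z b sgn ω l = totalWeight Λ Z b sgn ω := by
  have hm0 : Measurable fun l => restartWeight Λ Z b ω 0 l := by
    have h := (measurable_restart_zero Λ b hZ).comp (measurable_prodMk_left (x := ω))
    exact h
  have hmk : ∀ k : ℕ, Measurable fun p : ℝ × (Fin (2 * k + 1) → ℝ) =>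
      (Set.Ici (lacePt p.2 (2 * k + 1))).indicator (fun l => lacePart Λ Z sgn ω p.2 *
        restartWeight Λ Z b ω (lacePt p.2 (2 * k + 1)) l) p.1 := by
    intro k
    have h := (measurable_laceStep Λ b hpos hZ sgn k).comp
      ((measurable_const.prodMk measurable_fst).prodMk measurable_snd :
        Measurable fun p : ℝ × (Fin (2 * k + 1) → ℝ) => ((ω, p.1), p.2))
    exact h
  unfold stepWeight totalWeight
  rw [lintegral_add_left (hm0.const_mul _)]
  congr 1
  · rw [← lintegral_restartWeight Λ b hZ ω le_rfl]
    refine setLIntegral_congr_fun measurableSet_Ici fun l hl => ?_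
    rw [Set.indicator_of_mem hl]
  · rw [lintegral_tsum fun k => (hmk k).lintegral_prod_right'.aemeasurable]
    refine tsum_congr fun k => ?_
    rw [lintegral_lintegral_swap (μ := volume.restrict (Set.Ici (0 : ℝ)))
      (ν := volume.restrict (laceSlice k 0)) (f := fun l u =>
        (Set.Ici (lacePt u (2 * k + 1))).indicator (fun l => lacePart Λ Z sgn ω u *
          restartWeight Λ Z b ω (lacePt u (2 * k + 1)) l) l) (hmk k).aemeasurable]
    exact setLIntegral_congr_fun (measurableSet_laceSlice k) fun u hu =>
      lintegral_restartWeight Λ b hZ ω (t := lacePt u (2 * k + 1)) (lacePt_nonneg hu _) _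

/-- The renewal identity along a path, integrated over the final time. -/
theorem pathGreen_add (ω : CadlagPath d) :
    pathGreen Λ Z b ω + ∫⁻ s in Set.Ioi (0 : ℝ),
        aliveInd Λ ω s * totalWeight Λ Z b (-1) (shift s.toNNReal ω) =
      localTime Λ ω (Set.Ici 0) b + ∫⁻ s in Set.Ioi (0 : ℝ),
        aliveInd Λ ω s * totalWeight Λ Z b 1 (shift s.toNNReal ω) := by
  classical
  have hshift : ∀ sgn, Measurable fun p : ℝ × ℝ =>
      stepWeight Λ Z b sgn (shift p.1.toNNReal ω) p.2 := by
    intro sgn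
    have h1 := measurable_shift_real.comp
      (measurable_const.prodMk measurable_fst : Measurable fun p : ℝ × ℝ => (ω, p.1))
    have h := (measurable_stepWeight Λ b hpos hZ sgn).comp (h1.prodMk measurable_snd)
    exact h
  have halive : Measurable fun s : ℝ => aliveInd Λ ω s := by
    have h := (measurable_aliveInd Λ).comp (measurable_prodMk_left (x := ω))
    exact h
  have hF : ∀ sgn, ∫⁻ s in Set.Ioi (0 : ℝ),
      aliveInd Λ ω s * totalWeight Λ Z b sgn (shift s.toNNReal ω) =
      ∫⁻ l in Set.Ici (0 : ℝ), ∫⁻ s in Set.Ioc 0 l,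
        aliveInd Λ ω s * stepWeight Λ Z b sgn (shift s.toNNReal ω) (l - s) := by
    intro sgn
    rw [lintegral_Ioc_sub
      (F := fun s x => aliveInd Λ ω s * stepWeight Λ Z b sgn (shift s.toNNReal ω) x)
      ((halive.comp measurable_fst).mul (hshift sgn))]
    refine lintegral_congr fun s => ?_
    have h := (hshift sgn).comp (measurable_prodMk_left (x := s))
    have h1 : Measurable fun x => stepWeight Λ Z b sgn (shift s.toNNReal ω) x := h
    rw [lintegral_const_mul _ h1, lintegral_stepWeight Λ b hpos hZ]
  have hk : MeasurableSet {r : ℝ | killed Λ ω r.toNNReal = some b} :=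
    measurable_prodMk_left (measurableSet_killed_real Λ b)
  have hloc : localTime Λ ω (Set.Ici 0) b = ∫⁻ l in Set.Ici (0 : ℝ),
      if killed Λ ω l.toNNReal = some b then 1 else 0 := by
    rw [localTime_eq, restrict_Ioi_eq_restrict_Ici]
    refine lintegral_congr fun l => ?_
    simp only [Set.indicator_apply, Set.mem_ofPred_eq, Pi.one_apply]
  have hend : Measurable fun l => endWeight Λ Z b ω l := by
    have h := (measurable_endWeight Λ b hZ).comp (measurable_prodMk_left (x := ω))
    exact h
  rw [hF, hF, hloc, pathGreen, ← lintegral_add_left hend,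
    ← lintegral_add_left (Measurable.ite hk measurable_const measurable_const)]
  exact setLIntegral_congr_fun measurableSet_Ici fun l hl => endWeight_add Λ b hpos hZ ω hl

end

/-! ### The lace expansion kernel and the Dyson equation -/

section

section Integration

variable {α β : Type*} [MeasurableSpace α] [MeasurableSpace β] {μ : Measure α} {ν : Measure β}

theorem integral_integral_eq_sub [SFinite μ] [SFinite ν] {f : α → β → ℝ}
    (hf : Measurable fun p : α × β => f p.1 p.2) (h : ∫⁻ a, ∫⁻ b, ‖f a b‖ₑ ∂ν ∂μ < ∞) :
    ∫ a, ∫ b, f a b ∂ν ∂μ = (∫⁻ a, ∫⁻ b, ENNReal.ofReal (f a b) ∂ν ∂μ).toReal -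
      (∫⁻ a, ∫⁻ b, ENNReal.ofReal (-f a b) ∂ν ∂μ).toReal := by
  have hi : Integrable (fun p : α × β => f p.1 p.2) (μ.prod ν) := by
    refine ⟨hf.aestronglyMeasurable, ?_⟩
    rw [hasFiniteIntegral_iff_enorm, lintegral_prod _ hf.enorm.aemeasurable]
    exact h
  have h1 := integral_prod _ hi
  have hneg : Measurable fun p : α × β => ENNReal.ofReal (-f p.1 p.2) := hf.neg.ennreal_ofReal
  rw [integral_eq_lintegral_pos_part_sub_lintegral_neg_part hi,
    lintegral_prod _ hf.ennreal_ofReal.aemeasurable, lintegral_prod _ hneg.aemeasurable] at h1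
  exact h1.symm

theorem ofReal_mul_le_enorm {sgn : ℝ} (hs : |sgn| = 1) (x : ℝ) :
    ENNReal.ofReal (sgn * x) ≤ ‖x‖ₑ := by
  rw [Real.enorm_eq_ofReal_abs]
  refine ENNReal.ofReal_le_ofReal ((le_abs_self _).trans ?_)
  rw [abs_mul, hs, one_mul]

end Integration

variable {d : ℕ} (Λ : Finset (Fin d → ℤ)) (P : (Fin d → ℤ) → Measure (CadlagPath d))
  (Z : (Λ → ℝ) → ℝ)

/-- The contribution to the kernel of the parts of sign `sgn` of the weights of the laces with `m`
intervals. -/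
def kernelTerm (sgn : ℝ) (x y : Fin d → ℤ) : ℕ → ℝ≥0∞
  | 0 => ∫⁻ ω in {ω | killed Λ ω 0 = some y}, pointPart Λ Z sgn ω ∂(P x)
  | k + 1 => ∫⁻ u in laceSlice k 0,
      ∫⁻ ω in {ω | killed Λ ω (lacePt u (2 * k + 1)).toNNReal = some y}, lacePart Λ Z sgn ω u ∂(P x)

/-- The contribution to the kernel of the parts of sign `sgn` of the weights of all laces. -/
def kernelPart (sgn : ℝ) (x y : Fin d → ℤ) : ℝ≥0∞ := ∑' m : ℕ, kernelTerm Λ P Z sgn x y m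

variable {Z} (hpos : ∀ τ ∈ Set.Ici (0 : Λ → ℝ), 0 < Z τ) (hZ : ContDiffOn ℝ 2 Z (Set.Ici 0))

theorem measurableSet_killed_lacePt (k : ℕ) (y : Fin d → ℤ) :
    MeasurableSet {p : (Fin (2 * k + 1) → ℝ) × CadlagPath d |
      killed Λ p.2 (lacePt p.1 (2 * k + 1)).toNNReal = some y} :=
  (measurable_snd.prodMk ((measurable_lacePt _).comp measurable_fst))
    (measurableSet_killed_real Λ y)

include hpos hZ

theorem measurable_setLIntegral_lacePart (sgn : ℝ) (Q : Measure (CadlagPath d)) [SFinite Q]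
    (k : ℕ) (y : Fin d → ℤ) :
    Measurable fun u : Fin (2 * k + 1) → ℝ =>
      ∫⁻ ω in {ω | killed Λ ω (lacePt u (2 * k + 1)).toNNReal = some y},
        lacePart Λ Z sgn ω u ∂Q := by
  have h1 := (measurable_lacePart Λ hpos hZ sgn k).comp measurable_swap
  have h2 := (h1.indicator (measurableSet_killed_lacePt Λ k y)).lintegral_prod_right' (ν := Q)
  convert h2 using 2 with u
  rw [← lintegral_indicator (measurableSet_killed_at Λ _ y)]
  rfl

/-- The Markov property at the last endpoint of a lace. -/
theorem lintegral_totalWeight {J : (Fin d → ℤ) → ℝ} (hJ : IsJumpKernel J)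
    (hP : ∀ a, IsWalkLaw J a (P a)) (sgn : ℝ) (x b : Fin d → ℤ) :
    ∫⁻ ω, totalWeight Λ Z b sgn ω ∂(P x) =
      ∑ y ∈ Λ, kernelPart Λ P Z sgn x y * ∫⁻ ω, pathGreen Λ Z b ω ∂(P y) := by
  have := (hP x).isProbabilityMeasure
  have hpt := measurable_pointPart Λ hpos hZ sgn
  have hG := measurable_pathGreen Λ b hZ
  have hlace : ∀ k : ℕ, Measurable fun p : CadlagPath d × (Fin (2 * k + 1) → ℝ) =>
      lacePart Λ Z sgn p.1 p.2 * (aliveInd Λ p.1 (lacePt p.2 (2 * k + 1)) *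
        pathGreen Λ Z b (shift (lacePt p.2 (2 * k + 1)).toNNReal p.1)) := fun k =>
    (measurable_lacePart Λ hpos hZ sgn k).mul (measurable_restartGreen Λ b hZ k)
  have h0 := markov_sum Λ hJ hP x 0 hpt hG fun ω => by
    rw [pointPart, occ_freeze Λ ω le_rfl, ← pointPart]
  have hk : ∀ k : ℕ, ∫⁻ ω, (∫⁻ u in laceSlice k 0, lacePart Λ Z sgn ω u *
      (aliveInd Λ ω (lacePt u (2 * k + 1)) *
        pathGreen Λ Z b (shift (lacePt u (2 * k + 1)).toNNReal ω))) ∂(P x) =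
      ∑ y ∈ Λ, kernelTerm Λ P Z sgn x y (k + 1) * ∫⁻ ω, pathGreen Λ Z b ω ∂(P y) := by
    intro k
    rw [lintegral_lintegral_swap (ν := volume.restrict (laceSlice k 0)) (f := fun ω u =>
      lacePart Λ Z sgn ω u * (aliveInd Λ ω (lacePt u (2 * k + 1)) *
        pathGreen Λ Z b (shift (lacePt u (2 * k + 1)).toNNReal ω))) (hlace k).aemeasurable]
    have h1 : ∀ u ∈ laceSlice k 0, ∫⁻ ω, lacePart Λ Z sgn ω u *
        (aliveInd Λ ω (lacePt u (2 * k + 1)) *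
          pathGreen Λ Z b (shift (lacePt u (2 * k + 1)).toNNReal ω)) ∂(P x) =
        ∑ y ∈ Λ, (∫⁻ ω in {ω | killed Λ ω (lacePt u (2 * k + 1)).toNNReal = some y},
          lacePart Λ Z sgn ω u ∂(P x)) * ∫⁻ ω, pathGreen Λ Z b ω ∂(P y) := by
      intro u hu
      have hm : Measurable fun ω => lacePart Λ Z sgn ω u := by
        have h := (measurable_lacePart Λ hpos hZ sgn k).comp (measurable_prodMk_right (y := u))
        exact h
      refine markov_sum Λ hJ hP x _ hm hG fun ω => ?_
      rw [lacePart, laceW_freeze Λ Z ω ⟨hu, le_refl (lacePt u (2 * k + 1))⟩, ← lacePart]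
    rw [setLIntegral_congr_fun (measurableSet_laceSlice k) h1]
    have hm := fun y => measurable_setLIntegral_lacePart Λ hpos hZ sgn (P x) k y
    rw [lintegral_finsetSum _ fun y _ => (hm y).mul_const _]
    exact Finset.sum_congr rfl fun y _ => lintegral_mul_const _ (hm y)
  have hm : ∀ k : ℕ, Measurable fun ω => ∫⁻ u in laceSlice k 0, lacePart Λ Z sgn ω u *
      (aliveInd Λ ω (lacePt u (2 * k + 1)) *
        pathGreen Λ Z b (shift (lacePt u (2 * k + 1)).toNNReal ω)) := fun k =>
    (hlace k).lintegral_prod_right'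
  have hm0 : Measurable fun ω => pointPart Λ Z sgn ω *
      (aliveInd Λ ω 0 * pathGreen Λ Z b (shift (0 : ℝ).toNNReal ω)) :=
    hpt.mul (measurable_restartGreen_zero Λ b hZ)
  unfold totalWeight
  rw [lintegral_add_left hm0,
    lintegral_tsum fun k => (hm k).aemeasurable, h0]
  simp only [hk, Real.toNNReal_zero]
  rw [Summable.tsum_finsetSum fun _ _ => ENNReal.summable, ← Finset.sum_add_distrib]
  refine Finset.sum_congr rfl fun y _ => ?_
  rw [ENNReal.tsum_mul_right, ← add_mul, kernelPart,
    tsum_eq_zero_add' (f := kernelTerm Λ P Z sgn x y) ENNReal.summable]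
  rfl

/-- The Dyson equation in `[0,∞]`, with the terms of negative sign moved to the left. -/
theorem lintegral_pathGreen_add {J : (Fin d → ℤ) → ℝ} (hJ : IsJumpKernel J)
    (hP : ∀ a, IsWalkLaw J a (P a)) (a b : Fin d → ℤ) :
    ∫⁻ ω, pathGreen Λ Z b ω ∂(P a) + ∑ x ∈ Λ, (∫⁻ ω, localTime Λ ω (Set.Ici 0) x ∂(P a)) *
        ∑ y ∈ Λ, kernelPart Λ P Z (-1) x y * ∫⁻ ω, pathGreen Λ Z b ω ∂(P y) =
      ∫⁻ ω, localTime Λ ω (Set.Ici 0) b ∂(P a) +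
        ∑ x ∈ Λ, (∫⁻ ω, localTime Λ ω (Set.Ici 0) x ∂(P a)) *
          ∑ y ∈ Λ, kernelPart Λ P Z 1 x y * ∫⁻ ω, pathGreen Λ Z b ω ∂(P y) := by
  have hloc : Measurable fun ω => localTime Λ ω (Set.Ici 0) b := by
    simp only [localTime_eq]
    exact (measurable_one.indicator (measurableSet_killed_real Λ b)).lintegral_prod_right'
  have h := fun sgn => lintegral_restart Λ hJ hP a (measurable_totalWeight Λ b hpos hZ sgn)
  simp only [lintegral_totalWeight Λ P hpos hZ hJ hP] at h
  rw [← h, ← h, ← lintegral_add_left (measurable_pathGreen Λ b hZ), ← lintegral_add_left hloc]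
  exact lintegral_congr fun ω => pathGreen_add Λ b hpos hZ ω

theorem kernelTerm_le {sgn : ℝ} (hs : |sgn| = 1) (x y : Fin d → ℤ) (m : ℕ) :
    kernelTerm Λ P Z sgn x y m ≤ absLaceTerm Λ P Z x m := by
  cases m with
  | zero =>
    refine (setLIntegral_le_lintegral _ _).trans (lintegral_mono fun ω => ?_)
    rw [interaction_eq, vertexPoint_occInter hpos hZ (isOccupation_occ Λ ω)]
    exact ofReal_mul_le_enorm hs _
  | succ k =>
    refine setLIntegral_mono' (measurableSet_laceSlice k) fun u hu => ?_
    refine (setLIntegral_le_lintegral _ _).trans (lintegral_mono fun ω => ?_)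
    rw [interaction_eq, laceWeight_cons
      (fun s t hst => vertexPair_occInter hpos hZ (isOccupation_occ Λ ω) hst) hu]
    exact ofReal_mul_le_enorm hs _

theorem laceTerm_eq_sub (hP : ∀ a, IsProbabilityMeasure (P a)) (x y : Fin d → ℤ) (m : ℕ)
    (hfin : absLaceTerm Λ P Z x m < ∞) :
    laceTerm Λ P Z x y m =
      (kernelTerm Λ P Z 1 x y m).toReal - (kernelTerm Λ P Z (-1) x y m).toReal := by
  classical
  have := hP x
  cases m with
  | zero =>
    have hK := measurableSet_killed_at Λ 0 y
    have hm : Measurable fun ω : CadlagPath d => logD Z 0 (occ Λ ω 0) :=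
      measurable_logD_apply (τ := fun _ : CadlagPath d => 0) hpos hZ measurable_const
        (fun _ => Set.self_mem_Ici)
        (measurable_occ_comp Λ measurable_id (measurable_const (a := (0 : ℝ))))
    have hfin' : ∫⁻ ω, ‖logD Z 0 (occ Λ ω 0)‖ₑ ∂(P x) < ∞ := by
      refine lt_of_eq_of_lt (lintegral_congr fun ω => ?_) hfin
      rw [interaction_eq, vertexPoint_occInter hpos hZ (isOccupation_occ Λ ω)]
    have hint : Integrable (fun ω => logD Z 0 (occ Λ ω 0)) (P x) :=
      ⟨hm.aestronglyMeasurable, hasFiniteIntegral_iff_enorm.2 hfin'⟩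
    have hi := hint.integrableOn (s := {ω | killed Λ ω 0 = some y})
    have h1 : laceTerm Λ P Z x y 0 =
        ∫ ω in {ω | killed Λ ω 0 = some y}, logD Z 0 (occ Λ ω 0) ∂(P x) := by
      rw [← integral_indicator hK]
      refine integral_congr_ae (Eventually.of_forall fun ω => ?_)
      simp only [interaction_eq, vertexPoint_occInter hpos hZ (isOccupation_occ Λ ω),
        Set.indicator_apply, Set.mem_ofPred_eq]
    rw [h1, integral_eq_lintegral_pos_part_sub_lintegral_neg_part hi]
    simp only [kernelTerm, pointPart, one_mul, neg_one_mul]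
  | succ k =>
    set W : (Fin (2 * k + 1) → ℝ) → CadlagPath d → ℝ := fun u ω =>
      if killed Λ ω (lacePt u (2 * k + 1)).toNNReal = some y then
        laceW (pairRate Z (occ Λ ω)) (occInter Z (occ Λ ω)) u else 0 with hW
    have hWm : Measurable fun p : (Fin (2 * k + 1) → ℝ) × CadlagPath d => W p.1 p.2 := by
      have h := (measurable_laceW_occ Λ hpos hZ k).comp
        (measurable_swap (α := Fin (2 * k + 1) → ℝ) (β := CadlagPath d))
      exact Measurable.ite (measurableSet_killed_lacePt Λ k y) h measurable_const
    have hcons : ∀ u ∈ laceSlice k 0, ∀ ω, laceWeight (interaction Λ Z ω)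
        (Fin.cons 0 u : Fin (2 * k + 1 + 1) → ℝ) =
        laceW (pairRate Z (occ Λ ω)) (occInter Z (occ Λ ω)) u := fun u hu ω => by
      rw [interaction_eq, laceWeight_cons
        (fun s t hst => vertexPair_occInter hpos hZ (isOccupation_occ Λ ω) hst) hu]
    have hWfin : ∫⁻ u in laceSlice k 0, ∫⁻ ω, ‖W u ω‖ₑ ∂(P x) < ∞ := by
      refine lt_of_le_of_lt ?_ hfin
      refine setLIntegral_mono' (measurableSet_laceSlice k) fun u hu => lintegral_mono fun ω => ?_
      rw [hcons u hu ω, hW]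
      dsimp only
      split_ifs
      · exact le_rfl
      · simp
    have h1 : laceTerm Λ P Z x y (k + 1) = ∫ u in laceSlice k 0, ∫ ω, W u ω ∂(P x) := by
      refine setIntegral_congr_fun (measurableSet_laceSlice k) fun u hu => ?_
      refine integral_congr_ae (Eventually.of_forall fun ω => ?_)
      dsimp only
      rw [hcons u hu ω, rightPt_cons, lacePt_of_ge u (by omega)]
    have h2 : ∀ sgn : ℝ, ∫⁻ u in laceSlice k 0, ∫⁻ ω, ENNReal.ofReal (sgn * W u ω) ∂(P x) =
        kernelTerm Λ P Z sgn x y (k + 1) := by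
      intro sgn
      refine lintegral_congr fun u => ?_
      rw [← lintegral_indicator (measurableSet_killed_at Λ _ y)]
      refine lintegral_congr fun ω => ?_
      rw [hW]
      simp only [Set.indicator_apply, Set.mem_ofPred_eq, mul_ite, mul_zero, lacePart]
      split_ifs <;> simp
    rw [h1, integral_integral_eq_sub hWm hWfin, ← h2, ← h2]
    simp only [one_mul, neg_one_mul]

theorem kernelPart_lt_top {sgn : ℝ} (hs : |sgn| = 1) {x : Fin d → ℤ} (y : Fin d → ℤ)
    (hfin : ∑' m : ℕ, absLaceTerm Λ P Z x m < ∞) : kernelPart Λ P Z sgn x y < ∞ :=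
  (ENNReal.tsum_le_tsum fun m => kernelTerm_le Λ P hpos hZ hs x y m).trans_lt hfin

theorem laceKernel_eq_sub (hP : ∀ a, IsProbabilityMeasure (P a)) {x : Fin d → ℤ} (y : Fin d → ℤ)
    (hfin : ∑' m : ℕ, absLaceTerm Λ P Z x m < ∞) :
    laceKernel Λ P Z x y =
      (kernelPart Λ P Z 1 x y).toReal - (kernelPart Λ P Z (-1) x y).toReal := by
  have hp := (kernelPart_lt_top Λ P hpos hZ (sgn := 1) (by simp) y hfin).ne
  have hn := (kernelPart_lt_top Λ P hpos hZ (sgn := -1) (by simp) y hfin).ne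
  have hm := fun m => (ENNReal.ne_top_of_tsum_ne_top hfin.ne m).lt_top
  unfold laceKernel kernelPart
  rw [ENNReal.tsum_toReal_eq (ENNReal.ne_top_of_tsum_ne_top hp),
    ENNReal.tsum_toReal_eq (ENNReal.ne_top_of_tsum_ne_top hn),
    ← (ENNReal.summable_toReal hp).tsum_sub (ENNReal.summable_toReal hn)]
  exact tsum_congr fun m => laceTerm_eq_sub Λ P hpos hZ hP x y m (hm m)

omit hpos hZ

open Classical in
include hZ in
theorem lintegral_pathGreen (Q : Measure (CadlagPath d)) [SFinite Q] (b : Fin d → ℤ) :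
    ∫⁻ ω, pathGreen Λ Z b ω ∂Q = ∫⁻ l in Set.Ici (0 : ℝ), ∫⁻ ω, endWeight Λ Z b ω l ∂Q :=
  lintegral_lintegral_swap (ν := volume.restrict (Set.Ici (0 : ℝ)))
    (f := fun ω l => endWeight Λ Z b ω l) (measurable_endWeight Λ b hZ).aemeasurable

include hZ in
theorem green_eq (a b : Fin d → ℤ) [SFinite (P a)] :
    green Λ P Z 0 a b = (∫⁻ ω, pathGreen Λ Z b ω ∂(P a)).toReal := by
  rw [lintegral_pathGreen Λ hZ]
  simp only [green, zero_add]
  rfl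

theorem lintegral_localTime_lt_top {J : (Fin d → ℤ) → ℝ} (hd : 1 ≤ d) (hJ : IsJumpKernel J)
    (hP : ∀ a, IsWalkLaw J a (P a)) (a x : Fin d → ℤ) :
    ∫⁻ ω, localTime Λ ω (Set.Ici 0) x ∂(P a) < ∞ := by
  have := (hP a).isProbabilityMeasure
  rw [lintegral_localTime, restrict_Ioi_eq_restrict_Ici]
  refine lt_of_le_of_lt (lintegral_mono fun s => measure_mono fun ω hω => ?_)
    (lintegral_prob_alive_lt_top Λ hd hJ hP a)
  exact ((killed_eq_some_iff Λ ω _ x).1 hω).1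

theorem Assumptions.lintegral_pathGreen_lt_top (h : Assumptions Λ P Z) {a : Fin d → ℤ}
    (ha : a ∈ Λ) [SFinite (P a)] (b : Fin d → ℤ) :
    ∫⁻ ω, pathGreen Λ Z b ω ∂(P a) < ∞ := by
  rw [lintegral_pathGreen Λ h.Z2]
  refine lt_of_le_of_lt (lintegral_mono fun l => lintegral_mono fun ω => ?_) (h.G0 a ha)
  unfold endWeight
  by_cases hk : killed Λ ω l.toNNReal = some b
  · rw [if_pos hk, if_pos (by simp [hk])]
  · rw [if_neg hk]
    exact zero_le

end

end LaceExpansion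

end

open LaceExpansion in
/-- The Dyson equation for the Green's function of a self-interacting walk in a finite volume. -/
theorem proposition6p2 {d : ℕ} (hd : 1 ≤ d) (J : (Fin d → ℤ) → ℝ) (hJ : IsJumpKernel J)
    (P : (Fin d → ℤ) → MeasureTheory.Measure (CadlagPath d)) (hP : ∀ a, IsWalkLaw J a (P a))
    (Λ : Finset (Fin d → ℤ)) (Z : (Λ → ℝ) → ℝ) (hZ : Assumptions Λ P Z)
    (a b : Fin d → ℤ) (ha : a ∈ Λ) (hb : b ∈ Λ) :
    green Λ P Z 0 a b = freeGreen Λ P a b +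
      ∑ x ∈ Λ, ∑ y ∈ Λ, freeGreen Λ P a x * laceKernel Λ P Z x y * green Λ P Z 0 y b := by
  have hprob := fun a => (hP a).isProbabilityMeasure
  have hpos := hZ.Z1.1
  have hdyson := congrArg ENNReal.toReal (lintegral_pathGreen_add Λ P hpos hZ.Z2 hJ hP a b)
  have hG : ∀ y ∈ Λ, ∫⁻ ω, pathGreen Λ Z b ω ∂(P y) ≠ ∞ := fun y hy =>
    (hZ.lintegral_pathGreen_lt_top Λ P hy b).ne
  have hS : ∀ x, ∫⁻ ω, localTime Λ ω (Set.Ici 0) x ∂(P a) ≠ ∞ := fun x =>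
    (lintegral_localTime_lt_top Λ P hd hJ hP a x).ne
  have hK : ∀ sgn : ℝ, |sgn| = 1 → ∀ x ∈ Λ, ∀ y ∈ Λ,
      kernelPart Λ P Z sgn x y * ∫⁻ ω, pathGreen Λ Z b ω ∂(P y) ≠ ∞ := fun sgn hs x hx y hy =>
    ENNReal.mul_ne_top (kernelPart_lt_top Λ P hpos hZ.Z2 hs y (hZ.F0 x hx)).ne (hG y hy)
  have hterm : ∀ sgn : ℝ, |sgn| = 1 → ∀ x ∈ Λ, (∫⁻ ω, localTime Λ ω (Set.Ici 0) x ∂(P a)) *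
      ∑ y ∈ Λ, kernelPart Λ P Z sgn x y * ∫⁻ ω, pathGreen Λ Z b ω ∂(P y) ≠ ∞ :=
    fun sgn hs x hx => ENNReal.mul_ne_top (hS x) (ENNReal.sum_ne_top.2 (hK sgn hs x hx))
  have htoReal : ∀ sgn : ℝ, |sgn| = 1 →
      (∑ x ∈ Λ, (∫⁻ ω, localTime Λ ω (Set.Ici 0) x ∂(P a)) *
        ∑ y ∈ Λ, kernelPart Λ P Z sgn x y * ∫⁻ ω, pathGreen Λ Z b ω ∂(P y)).toReal =
      ∑ x ∈ Λ, ∑ y ∈ Λ, freeGreen Λ P a x * (kernelPart Λ P Z sgn x y).toReal *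
        green Λ P Z 0 y b := by
    intro sgn hs
    rw [ENNReal.toReal_sum (hterm sgn hs)]
    refine Finset.sum_congr rfl fun x hx => ?_
    rw [ENNReal.toReal_mul, ENNReal.toReal_sum (hK sgn hs x hx), Finset.mul_sum]
    refine Finset.sum_congr rfl fun y _ => ?_
    rw [ENNReal.toReal_mul, green_eq Λ P hZ.Z2, freeGreen, mul_assoc]
  rw [ENNReal.toReal_add (hG a ha) (ENNReal.sum_ne_top.2 (hterm (-1) (by simp))),
    ENNReal.toReal_add (hS b) (ENNReal.sum_ne_top.2 (hterm 1 (by simp))), htoReal _ (by simp),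
    htoReal _ (by simp), ← green_eq Λ P hZ.Z2, ← freeGreen] at hdyson
  have hsum : ∑ x ∈ Λ, ∑ y ∈ Λ, freeGreen Λ P a x * laceKernel Λ P Z x y * green Λ P Z 0 y b =
      ∑ x ∈ Λ, ∑ y ∈ Λ, freeGreen Λ P a x * (kernelPart Λ P Z 1 x y).toReal *
          green Λ P Z 0 y b -
        ∑ x ∈ Λ, ∑ y ∈ Λ, freeGreen Λ P a x * (kernelPart Λ P Z (-1) x y).toReal *
          green Λ P Z 0 y b := by
    rw [← Finset.sum_sub_distrib]
    refine Finset.sum_congr rfl fun x hx => ?_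
    rw [← Finset.sum_sub_distrib]
    refine Finset.sum_congr rfl fun y _ => ?_
    rw [laceKernel_eq_sub Λ P hpos hZ.Z2 hprob y (hZ.F0 x hx)]
    ring
  linarith
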